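/- Let $\mathcal B$ be a bicategory whose hom-categories have all small colimits and which is closed (precomposition and postcomposition with any $1$-cell have right adjoints, i.e. right Kan extensions and lifts exist). A **$\mathcal B$-category** $(\mathbb M,A)$ is a (small) set $A$ with a typing function $t:A\to\mathrm{Ob}(\mathcal B)$, $1$-cells $\mathbb M(a,b):tb\to ta$, and $2$-cells $\iota_{abc}:\mathbb M(a,b)\mathbb M(b,c)\Rightarrow\mathbb M(a,c)$ and $\rho_a:\mathrm{id}_{ta}\Rightarrow\mathbb M(a,a)$ which are associative and unital. A **presingleton** $\sigma$ of type $t\sigma=x\in\mathrm{Ob}(\mathcal B)$ is a distributor from the unit $\mathcal B$-category on $x$ to $(\mathbb M,A)$: $1$-cells $\sigma(a):x\to ta$ with an associative and unital action $\mathbb M(a,b)\sigma(b)\Rightarrow\sigma(a)$; dually, a precosingleton $\tau$ has $1$-cells $\tau(a):ta\to x$ and an action $\tau(a)\mathbb M(a,b)\Rightarrow\tau(b)$. An adjunction $\sigma\dashv\tau$ consists of a morphism of distributors $\varepsilon_{ab}:\sigma(a)\tau(b)\Rightarrow\mathbb M(a,b)$ and a $2$-cell $\eta:\mathrm{id}_x\Rightarrow\int^{a}_{\mathbb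 M}\tau(a)\sigma(a)$ satisfying the triangle identities. A **singleton** is a presingleton that has a right adjoint. A presingleton is **representable** if it is isomorphic to $\mathbb M(-,a)$ for some $a\in A$ of the same type. A $\mathcal B$-category, possibly with a large set of elements, is **complete** if every singleton of it is representable. The **$\mathcal B$-category of singletons** $(\mathbb S,\mathcal CA)$ has as elements the singletons of $(\mathbb M,A)$. The $1$-cell $\mathbb S(\sigma,\tau):t\tau\to t\sigma$ is the colimit of all $1$-cells $f:t\tau\to t\sigma$ indexed by the category of pairs $(f,\ \alpha:\sigma f\Rightarrow\tau)$; it is the universal $1$-cell with a morphism $\mathrm{ev}:\sigma\,\mathbb S(\sigma,\tau)\Rightarrow\tau$. The unit at $\sigma$ is the inclusion of $\mathrm{id}_{t\sigma}$, and the composition sends the components $(f,\sigma f\Rightarrow\tau)$ and $(g,\tau g\Rightarrow\upsilon)$ to the component $(fg,\ \sigma fg\Rightarrow\tau g\Rightarrow\upsilon)$. Suppose moreover that $\mathcal B$ has an **involution** $(-)^\circ:\mathcal B^{\mathrm{op}}\to\mathcal B$ (reversing $1$-cells only) which is the identity on objects. A **symmetric structure** on $(\mathbb M,A)$ consists of identifications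 $\mathbb M(a,b)\cong\mathbb M(b,a)^\circ$, inverse to each other up to the involution, under which $\rho_a^\circ=\rho_a$ and $\iota_{abc}^\circ=\iota_{cba}$. (The involution and these identifications are taken up to coherent invertible $2$-cells; equalities are a special case.) Every presingleton $\sigma$ of a symmetric $(\mathbb M,A)$ has an involute $\sigma^\circ$, the precosingleton $\sigma^\circ(a)=\sigma(a)^\circ$. A **symmetric singleton** is a presingleton $\sigma$ with an adjunction $\sigma\dashv\sigma^\circ$ that is invariant under the involution, i.e. $\varepsilon_{ab}^\circ=\varepsilon_{ba}$ (whence also $\eta^\circ=\eta$). A symmetric $\mathcal B$-category is **symmetrically complete** if every symmetric singleton of it is representable. The **$\mathcal B$-category of symmetric singletons** $(\mathbb S,\mathcal C_sA)$ is the restriction of $(\mathbb S,\mathcal CA)$ to the symmetric singletons. A symmetric structure $\kappa_{\sigma\tau}:\mathbb S(\sigma,\tau)\cong\mathbb S(\tau,\sigma)^\circ$ on it is **canonical** if, for all $\sigma,\tau,a,b$, the $2$-cells $$\sigma(a)\mathbb S(\sigma,\tau)\tau(b)^\circ\xrightarrow{\ \mathrm{ev}\ }\tau(a)\tau(b)^\circ\xrightarrow{\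 \varepsilon^\tau_{ab}\ }\mathbb M(a,b)$$ and $$\sigma(a)\mathbb S(\sigma,\tau)\tau(b)^\circ\overset{\kappa}{\cong}\sigma(a)\bigl(\tau(b)\mathbb S(\tau,\sigma)\bigr)^\circ\xrightarrow{\ \mathrm{ev}^\circ\ }\sigma(a)\sigma(b)^\circ\xrightarrow{\ \varepsilon^\sigma_{ab}\ }\mathbb M(a,b)$$ are equal. **Proposition.** For any $\mathcal B$-category $(\mathbb M,A)$, the $\mathcal B$-category $(\mathbb S,\mathcal CA)$ of its singletons is complete. If $\mathcal B$ has an involution and $(\mathbb M,A)$ is symmetric, then the $\mathcal B$-category $(\mathbb S,\mathcal C_sA)$ of its symmetric singletons carries a canonical symmetric structure, and with any such structure it is symmetrically complete. -/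

import Mathlib

open CategoryTheory CategoryTheory.Limits CategoryTheory.Bicategory

universe s w v u

namespace EnrichedBicat

/-- A bicategory is closed when right Kan extensions and right Kan lifts along every `1`-cell
exist, that is, when pre- and postcomposition with any `1`-cell have right adjoints. -/
class ClosedBicategory (B : Type u) [Bicategory.{w, v} B] : Prop where
  isLeftAdjoint_precomp : ∀ {x y : B} (z : B) (f : x ⟶ y), (precomp z f).IsLeftAdjoint
  isLeftAdjoint_postcomp : ∀ {y z : B} (x : B) (f : y ⟶ z), (postcomp x f).IsLeftAdjoint

attribute [instance] ClosedBicategory.isLeftAdjoint_precomp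
  ClosedBicategory.isLeftAdjoint_postcomp

/-- A category enriched in the bicategory `B`: a set `carrier` typed by the objects of `B`, a
matrix `hom` of `1`-cells with `hom a b : type b ⟶ type a`, and composition (idempotency) and unit
(reflexivity) `2`-cells. Here `f ≫ g` is "first `f`, then `g`", so the composite usually written
`hom a b · hom b c` is `hom b c ≫ hom a b`. -/
structure EnrichedCat (B : Type u) [Bicategory.{w, v} B] where
  carrier : Type s
  type : carrier → B
  hom : ∀ a b : carrier, type b ⟶ type a
  comp : ∀ a b c : carrier, hom b c ≫ hom a b ⟶ hom a c
  refl : ∀ a : carrier, 𝟙 (type a) ⟶ hom a a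
  assoc : ∀ a b c d : carrier,
    (α_ (hom c d) (hom b c) (hom a b)).hom ≫ hom c d ◁ comp a b c ≫ comp a c d =
      comp b c d ▷ hom a b ≫ comp a b d
  comp_refl : ∀ a b : carrier, refl b ▷ hom a b ≫ comp a b b = (λ_ (hom a b)).hom
  refl_comp : ∀ a b : carrier, hom a b ◁ refl a ≫ comp a a b = (ρ_ (hom a b)).hom

variable {B : Type u} [Bicategory.{w, v} B]

/-- A presingleton of type `x`, i.e. a distributor from the unit `B`-category on the object `x`
to `M`: a family of `1`-cells `obj a : x ⟶ type a` with an action of `M`. -/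
structure Presingleton (M : EnrichedCat.{s} B) (x : B) where
  obj : ∀ a : M.carrier, x ⟶ M.type a
  act : ∀ a b : M.carrier, obj b ≫ M.hom a b ⟶ obj a
  act_refl : ∀ a : M.carrier, obj a ◁ M.refl a ≫ act a a = (ρ_ (obj a)).hom
  act_comp : ∀ a b c : M.carrier,
    act b c ▷ M.hom a b ≫ act a b =
      (α_ (obj c) (M.hom b c) (M.hom a b)).hom ≫ obj c ◁ M.comp a b c ≫ act a c

/-- A precosingleton of type `x`, i.e. a distributor from `M` to the unit `B`-category on `x`. -/
structure Precosingleton (M : EnrichedCat.{s} B) (x : B) where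
  obj : ∀ a : M.carrier, M.type a ⟶ x
  act : ∀ a b : M.carrier, M.hom a b ≫ obj a ⟶ obj b
  act_refl : ∀ a : M.carrier, M.refl a ▷ obj a ≫ act a a = (λ_ (obj a)).hom
  act_comp : ∀ a b c : M.carrier,
    M.hom b c ◁ act a b ≫ act b c =
      (α_ (M.hom b c) (M.hom a b) (obj a)).inv ≫ M.comp a b c ▷ obj a ≫ act a c

namespace Presingleton

variable {M : EnrichedCat.{s} B}

/-- Morphisms of presingletons are the morphisms of the corresponding distributors. -/
@[ext]
structure Hom {x : B} (σ τ : Presingleton M x) where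
  app : ∀ a : M.carrier, σ.obj a ⟶ τ.obj a
  act_app : ∀ a b : M.carrier, σ.act a b ≫ app a = app b ▷ M.hom a b ≫ τ.act a b

instance (x : B) : Category (Presingleton M x) where
  Hom := Hom
  id σ := { app := fun _ => 𝟙 _, act_app := by intros; simp }
  comp f g := { app := fun a => f.app a ≫ g.app a
                act_app := fun a b => by
                  rw [← Category.assoc, f.act_app, Category.assoc, g.act_app]; simp }
  id_comp f := by apply Hom.ext; funext a; simp
  comp_id f := by apply Hom.ext; funext a; simp
  assoc f g h := by apply Hom.ext; funext a; simp

@[ext]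
theorem hom_ext {x : B} {σ τ : Presingleton M x} {f g : σ ⟶ τ} (h : ∀ a, f.app a = g.app a) :
    f = g :=
  Hom.ext (funext h)

@[simp]
theorem id_app {x : B} (σ : Presingleton M x) (a : M.carrier) : Hom.app (𝟙 σ) a = 𝟙 (σ.obj a) :=
  rfl

@[simp]
theorem comp_app {x : B} {σ τ υ : Presingleton M x} (f : σ ⟶ τ) (g : τ ⟶ υ) (a : M.carrier) :
    (f ≫ g).app a = f.app a ≫ g.app a :=
  rfl

/-- The composite distributor `σ f` of a presingleton `σ` of type `x` with a `1`-cell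
`f : y ⟶ x`, seen as a distributor between unit `B`-categories. -/
@[simps]
def restrict {x y : B} (σ : Presingleton M x) (f : y ⟶ x) : Presingleton M y where
  obj a := f ≫ σ.obj a
  act a b := (α_ f (σ.obj b) (M.hom a b)).hom ≫ f ◁ σ.act a b
  act_refl a := by
    have h := congrArg (fun k => f ◁ k) (σ.act_refl a)
    simp only [whiskerLeft_comp] at h
    simp [comp_whiskerLeft, h]
  act_comp a b c := by
    have h := congrArg (fun k => f ◁ k) (σ.act_comp a b c)
    simp only [whiskerLeft_comp] at h
    simp [comp_whiskerLeft, h]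

/-- The component of a morphism `σ f ⟶ τ` at `a`. -/
def restrictApp {x y : B} {σ : Presingleton M x} {f : y ⟶ x} {τ : Presingleton M y}
    (p : σ.restrict f ⟶ τ) (a : M.carrier) : f ≫ σ.obj a ⟶ τ.obj a :=
  p.app a

theorem restrictApp_act {x y : B} {σ : Presingleton M x} {f : y ⟶ x} {τ : Presingleton M y}
    (p : σ.restrict f ⟶ τ) (a b : M.carrier) :
    restrictApp p b ▷ M.hom a b ≫ τ.act a b =
      (α_ f (σ.obj b) (M.hom a b)).hom ≫ f ◁ σ.act a b ≫ restrictApp p a :=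
  (p.act_app a b).symm.trans (Category.assoc _ _ _)

/-- A morphism `σ f ⟶ τ` from its components. -/
def restrictMk {x y : B} {σ : Presingleton M x} {f : y ⟶ x} {τ : Presingleton M y}
    (p : ∀ a : M.carrier, f ≫ σ.obj a ⟶ τ.obj a)
    (hp : ∀ a b : M.carrier, p b ▷ M.hom a b ≫ τ.act a b =
      (α_ f (σ.obj b) (M.hom a b)).hom ≫ f ◁ σ.act a b ≫ p a) : σ.restrict f ⟶ τ where
  app := p
  act_app a b := (Category.assoc _ _ _).trans (hp a b).symm

/-- `f ↦ σ f` as a functor. -/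
@[simps]
def restrictFunctor {x : B} (σ : Presingleton M x) (y : B) : (y ⟶ x) ⥤ Presingleton M y where
  obj f := σ.restrict f
  map β := { app := fun a => β ▷ σ.obj a
             act_app := fun a b => by simp [restrict, whisker_exchange] }
  map_id f := by ext a; simp; rfl
  map_comp f g := by ext a; simp; rfl

/-- The representable presingleton `M(-, a)`. -/
@[simps]
def representable (M : EnrichedCat.{s} B) (a : M.carrier) : Presingleton M (M.type a) where
  obj b := M.hom b a
  act b c := M.comp b c a
  act_refl b := M.refl_comp b a
  act_comp b c d := (M.assoc b c d a).symm

end Presingleton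

/-- A cowedge of `τ` and `σ` over `M`. -/
structure Cowedge {M : EnrichedCat.{s} B} {x y : B} (σ : Presingleton M x)
    (τ : Precosingleton M y) where
  pt : x ⟶ y
  leg : ∀ a : M.carrier, σ.obj a ≫ τ.obj a ⟶ pt
  wedge : ∀ a b : M.carrier,
    (α_ (σ.obj b) (M.hom a b) (τ.obj a)).hom ≫ σ.obj b ◁ τ.act a b ≫ leg b =
      σ.act a b ▷ τ.obj a ≫ leg a

/-- A universal cowedge; its vertex is the composite distributor `τ σ = ∫^{a : M} τ(a) σ(a)`. -/
def Cowedge.IsUniversal {M : EnrichedCat.{s} B} {x y : B} {σ : Presingleton M x}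
    {τ : Precosingleton M y} (E : Cowedge σ τ) : Prop :=
  ∀ W : Cowedge σ τ, ∃! k : E.pt ⟶ W.pt, ∀ a, E.leg a ≫ k = W.leg a

/-- `IsAdjunction σ τ e` says that `e`, with components `e a b : σ(a) τ(b) ⟶ M(a, b)`, is the
counit of an adjunction `σ ⊣ τ` in the bicategory of distributors: the `e a b` form a morphism of
distributors from `σ τ` to the identity distributor `M`, and there is a unit
`η : 𝟙 ⟶ ∫^a τ(a) σ(a)` satisfying the two triangle identities. The `2`-cells `T` in these
identities are the composites `σ (τ σ) ≅ (σ τ) σ ⟶ M σ ≅ σ` and `(τ σ) τ ≅ τ (σ τ) ⟶ τ M ≅ τ`,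
described on the legs of the coend (whiskering preserves coends in a closed bicategory). -/
structure IsAdjunction {M : EnrichedCat.{s} B} {x : B} (σ : Presingleton M x)
    (τ : Precosingleton M x) (e : ∀ a b : M.carrier, τ.obj b ≫ σ.obj a ⟶ M.hom a b) : Prop where
  counit_left : ∀ a' a b : M.carrier,
    e a b ▷ M.hom a' a ≫ M.comp a' a b =
      (α_ (τ.obj b) (σ.obj a) (M.hom a' a)).hom ≫ τ.obj b ◁ σ.act a' a ≫ e a' b
  counit_right : ∀ a b b' : M.carrier,
    M.hom b b' ◁ e a b ≫ M.comp a b b' =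
      (α_ (M.hom b b') (τ.obj b) (σ.obj a)).inv ≫ τ.act b b' ▷ σ.obj a ≫ e a b'
  exists_unit : ∃ (E : Cowedge σ τ) (η : 𝟙 x ⟶ E.pt), E.IsUniversal ∧
    (∀ a : M.carrier, ∃ T : E.pt ≫ σ.obj a ⟶ σ.obj a,
      (∀ b, E.leg b ▷ σ.obj a ≫ T =
        (α_ (σ.obj b) (τ.obj b) (σ.obj a)).hom ≫ σ.obj b ◁ e a b ≫ σ.act a b) ∧
      (λ_ (σ.obj a)).inv ≫ η ▷ σ.obj a ≫ T = 𝟙 (σ.obj a)) ∧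
    (∀ a : M.carrier, ∃ T : τ.obj a ≫ E.pt ⟶ τ.obj a,
      (∀ b, τ.obj a ◁ E.leg b ≫ T =
        (α_ (τ.obj a) (σ.obj b) (τ.obj b)).inv ≫ e b a ▷ τ.obj b ≫ τ.act b a) ∧
      (ρ_ (τ.obj a)).inv ≫ τ.obj a ◁ η ≫ T = 𝟙 (τ.obj a))

/-- A presingleton is a singleton if it has a right adjoint. -/
def Presingleton.IsSingleton {M : EnrichedCat.{s} B} {x : B} (σ : Presingleton M x) : Prop :=
  ∃ (τ : Precosingleton M x) (e : ∀ a b : M.carrier, τ.obj b ≫ σ.obj a ⟶ M.hom a b),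
    IsAdjunction σ τ e

/-- A presingleton of type `x` is representable if it is isomorphic, as a distributor, to
`M(-, a)` for some element `a` of type `x`. -/
def Presingleton.IsRepresentable {M : EnrichedCat.{s} B} {x : B} (σ : Presingleton M x) : Prop :=
  ∃ (a : M.carrier) (h : x = M.type a), Nonempty ((h ▸ σ) ≅ Presingleton.representable M a)

/-- A `B`-category is complete if every singleton of it is representable. -/
def EnrichedCat.IsComplete (M : EnrichedCat.{s} B) : Prop :=
  ∀ (x : B) (σ : Presingleton M x), σ.IsSingleton → σ.IsRepresentable

section Terminal

variable {M : EnrichedCat.{s} B}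

theorem Cowedge.exists_isUniversal [∀ x y : B, HasColimitsOfSize.{s, s} (x ⟶ y)] {x y : B}
    (σ : Presingleton M x) (τ : Precosingleton M y) : ∃ E : Cowedge σ τ, E.IsUniversal := by
  let J : MultispanShape.{s, s} :=
    { L := M.carrier × M.carrier, R := M.carrier, fst := fun p => p.2, snd := fun p => p.1 }
  let I : MultispanIndex J (x ⟶ y) :=
    { left := fun p => (σ.obj p.2 ≫ M.hom p.1 p.2) ≫ τ.obj p.1
      right := fun a => σ.obj a ≫ τ.obj a
      fst := fun p => (α_ (σ.obj p.2) (M.hom p.1 p.2) (τ.obj p.1)).hom ≫ σ.obj p.2 ◁ τ.act p.1 p.2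
      snd := fun p => σ.act p.1 p.2 ▷ τ.obj p.1 }
  let K : Multicofork I := colimit.cocone I.multispan
  have hK : IsColimit K := colimit.isColimit I.multispan
  refine ⟨⟨K.pt, fun a => K.π a, fun a b => ?_⟩, fun W => ?_⟩
  · have := K.condition (a, b)
    simpa [I] using this
  · let K' : Multicofork I := Multicofork.ofπ I W.pt W.leg (fun p => by
      have := W.wedge p.1 p.2
      simpa [I] using this)
    refine ⟨hK.desc K', fun a => hK.fac K' (.right a), fun k hk => ?_⟩
    apply Multicofork.IsColimit.hom_ext hK
    intro a
    exact (hk a).trans (hK.fac K' (.right a)).symm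

section

variable {x y : B} {σ : Presingleton M x} {τ : Precosingleton M y} {E : Cowedge σ τ}
  {D : Type*} [Category D]

theorem Cowedge.IsUniversal.map_hom_ext (hE : E.IsUniversal) (L : (x ⟶ y) ⥤ D) [L.IsLeftAdjoint]
    {Z : D} {k l : L.obj E.pt ⟶ Z} (h : ∀ a, L.map (E.leg a) ≫ k = L.map (E.leg a) ≫ l) :
    k = l := by
  let adj := Adjunction.ofIsLeftAdjoint L
  apply (adj.homEquiv _ _).injective
  obtain ⟨m, -, hm⟩ := hE ⟨_, fun a => E.leg a ≫ adj.homEquiv _ _ k, fun a b => by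
    simpa using congrArg (· ≫ adj.homEquiv _ _ k) (E.wedge a b)⟩
  rw [hm _ (fun a => rfl)]
  symm
  apply hm
  intro a
  change E.leg a ≫ _ = E.leg a ≫ _
  rw [← adj.homEquiv_naturality_left, ← adj.homEquiv_naturality_left, h]

theorem Cowedge.IsUniversal.map_desc (hE : E.IsUniversal) (L : (x ⟶ y) ⥤ D) [L.IsLeftAdjoint]
    {Z : D} (k : ∀ a, L.obj (σ.obj a ≫ τ.obj a) ⟶ Z)
    (hk : ∀ a b, L.map (α_ (σ.obj b) (M.hom a b) (τ.obj a)).hom ≫ L.map (σ.obj b ◁ τ.act a b) ≫ k b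
      = L.map (σ.act a b ▷ τ.obj a) ≫ k a) :
    ∃ T : L.obj E.pt ⟶ Z, ∀ a, L.map (E.leg a) ≫ T = k a := by
  let adj := Adjunction.ofIsLeftAdjoint L
  obtain ⟨m, hm, -⟩ := hE ⟨_, fun a => adj.homEquiv _ _ (k a), fun a b => by
    rw [← adj.homEquiv_naturality_left, ← adj.homEquiv_naturality_left,
      ← adj.homEquiv_naturality_left, hk]⟩
  refine ⟨(adj.homEquiv _ _).symm m, fun a => ?_⟩
  rw [← adj.homEquiv_naturality_left_symm, hm a, Equiv.symm_apply_apply]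

end

section

variable {x y z z' : B} {σ : Presingleton M x} {τ : Precosingleton M y}
  {E : Cowedge σ τ}

theorem Cowedge.IsUniversal.hom_ext (hE : E.IsUniversal) {f : x ⟶ y} {k l : E.pt ⟶ f}
    (h : ∀ a, E.leg a ≫ k = E.leg a ≫ l) : k = l :=
  hE.map_hom_ext (𝟭 _) h

variable [ClosedBicategory B]

theorem Cowedge.IsUniversal.whiskerLeft_hom_ext (hE : E.IsUniversal) {g : z ⟶ x} {f : z ⟶ y}
    {k l : g ≫ E.pt ⟶ f} (h : ∀ a, g ◁ E.leg a ≫ k = g ◁ E.leg a ≫ l) : k = l :=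
  hE.map_hom_ext (precomp y g) h

theorem Cowedge.IsUniversal.whiskerRight_whiskerRight_hom_ext (hE : E.IsUniversal) {g : y ⟶ z}
    {g' : z ⟶ z'} {f : x ⟶ z'} {k l : (E.pt ≫ g) ≫ g' ⟶ f}
    (h : ∀ a, E.leg a ▷ g ▷ g' ≫ k = E.leg a ▷ g ▷ g' ≫ l) : k = l :=
  hE.map_hom_ext (postcomp x g ⋙ postcomp x g') h

theorem Cowedge.IsUniversal.whiskerLeft_whiskerRight_hom_ext (hE : E.IsUniversal) {g : z ⟶ x}
    {g' : y ⟶ z'} {f : z ⟶ z'} {k l : (g ≫ E.pt) ≫ g' ⟶ f}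
    (h : ∀ a, (g ◁ E.leg a) ▷ g' ≫ k = (g ◁ E.leg a) ▷ g' ≫ l) : k = l :=
  hE.map_hom_ext (precomp y g ⋙ postcomp z g') h

theorem Cowedge.IsUniversal.whiskerLeft_desc (hE : E.IsUniversal) {g : z ⟶ x} {f : z ⟶ y}
    (k : ∀ a, g ≫ σ.obj a ≫ τ.obj a ⟶ f)
    (hk : ∀ a b, g ◁ (α_ (σ.obj b) (M.hom a b) (τ.obj a)).hom ≫ g ◁ σ.obj b ◁ τ.act a b ≫ k b
      = g ◁ σ.act a b ▷ τ.obj a ≫ k a) :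
    ∃ T : g ≫ E.pt ⟶ f, ∀ a, g ◁ E.leg a ≫ T = k a :=
  hE.map_desc (precomp y g) k hk

theorem Cowedge.IsUniversal.whiskerRight_desc (hE : E.IsUniversal) {g : y ⟶ z} {f : x ⟶ z}
    (k : ∀ a, (σ.obj a ≫ τ.obj a) ≫ g ⟶ f)
    (hk : ∀ a b, (α_ (σ.obj b) (M.hom a b) (τ.obj a)).hom ▷ g ≫ (σ.obj b ◁ τ.act a b) ▷ g ≫ k b
      = σ.act a b ▷ τ.obj a ▷ g ≫ k a) :
    ∃ T : E.pt ≫ g ⟶ f, ∀ a, E.leg a ▷ g ≫ T = k a :=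
  hE.map_desc (postcomp x g) k hk

end

theorem Presingleton.IsSingleton.exists_terminal_aux [ClosedBicategory B]
    [∀ x y : B, HasColimitsOfSize.{s, s} (x ⟶ y)] {x y : B} {σ : Presingleton M x}
    (hσ : σ.IsSingleton) (τ : Presingleton M y) :
    ∃ (f : y ⟶ x) (ev : ∀ a, f ≫ σ.obj a ⟶ τ.obj a),
      (∀ a b, ev b ▷ M.hom a b ≫ τ.act a b = (α_ _ _ _).hom ≫ f ◁ σ.act a b ≫ ev a) ∧
      ∀ (g : y ⟶ x) (p : ∀ a, g ≫ σ.obj a ⟶ τ.obj a),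
        (∀ a b, p b ▷ M.hom a b ≫ τ.act a b = (α_ _ _ _).hom ≫ g ◁ σ.act a b ≫ p a) →
        ∃! k : g ⟶ f, ∀ a, k ▷ σ.obj a ≫ ev a = p a := by
  obtain ⟨t, e, ⟨hl, hr, U, i, hU, hT, hT'⟩⟩ := hσ
  choose T hT hTi using hT
  choose T' hT' hTi' using hT'
  obtain ⟨E, hE⟩ := Cowedge.exists_isUniversal τ t
  -- the evaluation
  have h1 : ∀ a, ∃ ev : E.pt ≫ σ.obj a ⟶ τ.obj a, ∀ b, E.leg b ▷ σ.obj a ≫ ev =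
      (α_ (τ.obj b) (t.obj b) (σ.obj a)).hom ≫ τ.obj b ◁ e a b ≫ τ.act a b := by
    intro a
    refine hE.whiskerRight_desc (fun b =>
      (α_ (τ.obj b) (t.obj b) (σ.obj a)).hom ≫ τ.obj b ◁ e a b ≫ τ.act a b) ?_
    intro b c
    have q1 : t.act b c ▷ σ.obj a ≫ e a c =
        (α_ _ _ _).hom ≫ M.hom b c ◁ e a b ≫ M.comp a b c := by simp [hr]
    have q2 : τ.obj c ◁ M.comp a b c ≫ τ.act a c =
        (α_ _ _ _).inv ≫ τ.act b c ▷ M.hom a b ≫ τ.act a b := by simp [τ.act_comp]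
    calc
      _ = 𝟙 _ ⊗≫ τ.obj c ◁ (t.act b c ▷ σ.obj a ≫ e a c) ⊗≫ τ.act a c := by bicategory
      _ = 𝟙 _ ⊗≫ τ.obj c ◁ M.hom b c ◁ e a b ⊗≫ (τ.obj c ◁ M.comp a b c ≫ τ.act a c) := by
        rw [q1]; bicategory
      _ = 𝟙 _ ⊗≫ ((τ.obj c ≫ M.hom b c) ◁ e a b ≫ τ.act b c ▷ M.hom a b) ⊗≫ τ.act a b := by
        rw [q2]; bicategory
      _ = _ := by rw [whisker_exchange]; bicategory
  choose ev hev using h1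
  have h2 : ∀ a b, ev b ▷ M.hom a b ≫ τ.act a b =
      (α_ _ _ _).hom ≫ E.pt ◁ σ.act a b ≫ ev a := by
    intro a b
    apply hE.whiskerRight_whiskerRight_hom_ext
    intro c
    have q1 := hl a b c
    have q2 := τ.act_comp a b c
    calc
      _ = 𝟙 _ ⊗≫ (E.leg c ▷ σ.obj b ≫ ev b) ▷ M.hom a b ⊗≫ τ.act a b := by bicategory
      _ = 𝟙 _ ⊗≫ τ.obj c ◁ e b c ▷ M.hom a b ⊗≫ (τ.act b c ▷ M.hom a b ≫ τ.act a b) := by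
        rw [hev]; bicategory
      _ = 𝟙 _ ⊗≫ τ.obj c ◁ (e b c ▷ M.hom a b ≫ M.comp a b c) ⊗≫ τ.act a c := by
        rw [q2]; bicategory
      _ = 𝟙 _ ⊗≫ ((τ.obj c ≫ t.obj c) ◁ σ.act a b) ⊗≫
          ((α_ _ _ _).hom ≫ τ.obj c ◁ e a c ≫ τ.act a c) := by
        rw [q1]; bicategory
      _ = 𝟙 _ ⊗≫ ((τ.obj c ≫ t.obj c) ◁ σ.act a b ≫ E.leg c ▷ σ.obj a) ⊗≫ ev a := by
        rw [← hev]; bicategory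
      _ = _ := by rw [whisker_exchange]; bicategory
  -- the map induced by a morphism
  have h3 : ∀ (g : y ⟶ x) (p : ∀ a, g ≫ σ.obj a ⟶ τ.obj a),
      (∀ a b, p b ▷ M.hom a b ≫ τ.act a b = (α_ _ _ _).hom ≫ g ◁ σ.act a b ≫ p a) →
      ∃ R : g ≫ U.pt ⟶ E.pt, ∀ a,
      g ◁ U.leg a ≫ R = (α_ g (σ.obj a) (t.obj a)).inv ≫ p a ▷ t.obj a ≫ E.leg a := by
    intro g p hp
    refine hU.whiskerLeft_desc (fun a =>
      (α_ g (σ.obj a) (t.obj a)).inv ≫ p a ▷ t.obj a ≫ E.leg a) ?_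
    intro a b
    have q1 : g ◁ σ.act a b ≫ p a =
        (α_ _ _ _).inv ≫ p b ▷ M.hom a b ≫ τ.act a b := by
      simp [hp]
    have q2 := E.wedge a b
    calc
      _ = 𝟙 _ ⊗≫ ((g ≫ σ.obj b) ◁ t.act a b ≫ p b ▷ t.obj b) ⊗≫ E.leg b := by bicategory
      _ = 𝟙 _ ⊗≫ p b ▷ M.hom a b ▷ t.obj a ⊗≫
          ((α_ _ _ _).hom ≫ τ.obj b ◁ t.act a b ≫ E.leg b) := by
        rw [whisker_exchange]; bicategory
      _ = 𝟙 _ ⊗≫ ((α_ _ _ _).inv ≫ p b ▷ M.hom a b ≫ τ.act a b) ▷ t.obj a ⊗≫ E.leg a := by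
        rw [q2]; bicategory
      _ = _ := by rw [← q1]; bicategory
  refine ⟨E.pt, ev, h2, fun g p hp => ?_⟩
  obtain ⟨R, hR⟩ := h3 g p hp
  obtain ⟨S, hS⟩ := h3 E.pt ev h2
  have hSi : (ρ_ E.pt).inv ≫ E.pt ◁ i ≫ S = 𝟙 _ := by
    apply hE.hom_ext
    intro c
    have q : ∀ b, (τ.obj c ≫ t.obj c) ◁ U.leg b ≫ E.leg c ▷ U.pt ≫ S =
        (α_ _ _ _).hom ≫ τ.obj c ◁ (t.obj c ◁ U.leg b ≫ T' c) ≫ E.leg c := by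
      intro b
      have w := E.wedge b c
      rw [whisker_exchange_assoc, hS b, hT']
      calc
        _ = 𝟙 _ ⊗≫ (E.leg c ▷ σ.obj b ≫ ev b) ▷ t.obj b ⊗≫ E.leg b := by
          bicategory
        _ = 𝟙 _ ⊗≫ τ.obj c ◁ e b c ▷ t.obj b ⊗≫ (τ.act b c ▷ t.obj b ≫ E.leg b) := by
          rw [hev]; bicategory
        _ = _ := by rw [← w]; bicategory
    have q' : E.leg c ▷ U.pt ≫ S = (α_ _ _ _).hom ≫ τ.obj c ◁ T' c ≫ E.leg c := by
      apply hU.whiskerLeft_hom_ext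
      intro b
      rw [q]; bicategory
    calc
      _ = 𝟙 _ ⊗≫ (E.leg c ▷ 𝟙 x ≫ E.pt ◁ i) ⊗≫ S := by bicategory
      _ = 𝟙 _ ⊗≫ τ.obj c ◁ t.obj c ◁ i ⊗≫ (E.leg c ▷ U.pt ≫ S) := by
        rw [← whisker_exchange]; bicategory
      _ = τ.obj c ◁ ((ρ_ (t.obj c)).inv ≫ t.obj c ◁ i ≫ T' c) ≫ E.leg c := by
        rw [q']; bicategory
      _ = _ := by rw [hTi']; simp
  have hRT : ∀ a, R ▷ σ.obj a ≫ ev a = (α_ _ _ _).hom ≫ g ◁ T a ≫ p a := by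
    intro a
    apply hU.whiskerLeft_whiskerRight_hom_ext
    intro c
    have q1 : g ◁ σ.act a c ≫ p a =
        (α_ _ _ _).inv ≫ p c ▷ M.hom a c ≫ τ.act a c := by
      simp [hp]
    calc
      _ = (g ◁ U.leg c ≫ R) ▷ σ.obj a ≫ ev a := by bicategory
      _ = 𝟙 _ ⊗≫ p c ▷ t.obj c ▷ σ.obj a ⊗≫ (E.leg c ▷ σ.obj a ≫ ev a) := by
        rw [hR]; bicategory
      _ = 𝟙 _ ⊗≫ (p c ▷ (t.obj c ≫ σ.obj a) ≫ τ.obj c ◁ e a c) ⊗≫ τ.act a c := by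
        rw [hev]; bicategory
      _ = 𝟙 _ ⊗≫ g ◁ σ.obj c ◁ e a c ⊗≫
          ((α_ _ _ _).inv ≫ p c ▷ M.hom a c ≫ τ.act a c) := by
        rw [← whisker_exchange]; bicategory
      _ = 𝟙 _ ⊗≫ g ◁ ((α_ _ _ _).hom ≫ σ.obj c ◁ e a c ≫ σ.act a c) ⊗≫ p a := by
        rw [← q1]; bicategory
      _ = _ := by rw [← hT]; bicategory
  refine ⟨(ρ_ g).inv ≫ g ◁ i ≫ R, ?_, ?_⟩
  · intro a
    calc
      _ = 𝟙 _ ⊗≫ g ◁ i ▷ σ.obj a ⊗≫ (R ▷ σ.obj a ≫ ev a) := by bicategory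
      _ = g ◁ ((λ_ (σ.obj a)).inv ≫ i ▷ σ.obj a ≫ T a) ≫ p a := by rw [hRT]; bicategory
      _ = _ := by rw [hTi]; simp
  · intro k hk
    have hkR : k ▷ U.pt ≫ S = R := by
      apply hU.whiskerLeft_hom_ext
      intro a
      rw [hR, ← hk, whisker_exchange_assoc, hS]
      bicategory
    calc
      k = k ≫ ((ρ_ E.pt).inv ≫ E.pt ◁ i ≫ S) := by rw [hSi, Category.comp_id]
      _ = 𝟙 _ ⊗≫ (k ▷ 𝟙 x ≫ E.pt ◁ i) ⊗≫ S := by bicategory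
      _ = _ := by rw [← whisker_exchange, ← hkR]; bicategory

/-- If `σ` has a right adjoint, then among the pairs `(f, σ f ⟶ τ)` there is a terminal one. -/
theorem Presingleton.IsSingleton.hasTerminal [ClosedBicategory B]
    [∀ x y : B, HasColimitsOfSize.{s, s} (x ⟶ y)] {x y : B} {σ : Presingleton M x}
    (hσ : σ.IsSingleton) (τ : Presingleton M y) :
    HasTerminal (CostructuredArrow (σ.restrictFunctor y) τ) := by
  obtain ⟨f, ev, hev, h⟩ := hσ.exists_terminal_aux τ
  let T : CostructuredArrow (σ.restrictFunctor y) τ :=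
    CostructuredArrow.mk (Y := f) (Presingleton.restrictMk ev hev : σ.restrict f ⟶ τ)
  have h' : ∀ X : CostructuredArrow (σ.restrictFunctor y) τ, Nonempty (Unique (X ⟶ T)) := by
    intro X
    obtain ⟨k, hk, hu⟩ := h X.left (fun a => Presingleton.restrictApp X.hom a)
      (fun a b => Presingleton.restrictApp_act X.hom a b)
    refine ⟨⟨⟨CostructuredArrow.homMk k (Presingleton.hom_ext hk)⟩, fun m => ?_⟩⟩
    apply CostructuredArrow.hom_ext
    apply hu
    intro a
    exact congrArg (fun q => Presingleton.Hom.app q a) (CostructuredArrow.w m)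
  let u := fun X => (h' X).some
  have h1 : ∀ X, Nonempty (X ⟶ T) := fun X => ⟨(u X).default⟩
  have h2 : ∀ X, Subsingleton (X ⟶ T) := fun X => @Unique.instSubsingleton _ (u X)
  exact hasTerminal_of_unique T

end Terminal

/-- Singletons of `M`, of arbitrary type. -/
structure Singleton (M : EnrichedCat.{s} B) where
  type : B
  val : Presingleton M type
  isSingleton : val.IsSingleton

namespace Singleton

/-- For `p : σ f ⟶ τ` and `q : τ g ⟶ υ`, the composite `σ f g ⟶ τ g ⟶ υ`. -/
def compHom {M : EnrichedCat.{s} B} {x y z : B} {σ : Presingleton M x} {τ : Presingleton M y}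
    {υ : Presingleton M z} {f : y ⟶ x} {g : z ⟶ y} (p : σ.restrict f ⟶ τ)
    (q : τ.restrict g ⟶ υ) : σ.restrict (g ≫ f) ⟶ υ :=
  Presingleton.restrictMk (fun a => (α_ g f (σ.obj a)).hom ≫ g ◁ Presingleton.restrictApp p a ≫
      Presingleton.restrictApp q a) fun a b => by
    calc
      _ = 𝟙 _ ⊗≫ g ◁ Presingleton.restrictApp p b ▷ M.hom a b ⊗≫
          (Presingleton.restrictApp q b ▷ M.hom a b ≫ υ.act a b) := by bicategory
      _ = 𝟙 _ ⊗≫ g ◁ (Presingleton.restrictApp p b ▷ M.hom a b ≫ τ.act a b) ⊗≫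
          Presingleton.restrictApp q a := by
        rw [Presingleton.restrictApp_act]; bicategory
      _ = _ := by
        rw [Presingleton.restrictApp_act]; bicategory

/-- The morphism `σ 1 ≅ σ`. -/
def idHom {M : EnrichedCat.{s} B} {x : B} (σ : Presingleton M x) : σ.restrict (𝟙 x) ⟶ σ :=
  Presingleton.restrictMk (fun a => (λ_ (σ.obj a)).hom) (by intros; simp)

section Generic

variable {C D : Type*} [Category C] [Category D] (F : C ⥤ D) (d : D)
  [HasTerminal (CostructuredArrow F d)]

/-- For a functor `F` such that the category of pairs `(c, F c ⟶ d)` has a terminal object, the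
colimit of all `c` indexed by this category is the first component of a terminal object. -/
noncomputable def colimitIso :
    colimit (CostructuredArrow.proj F d) ≅ (⊤_ CostructuredArrow F d).left :=
  (colimit.isColimit (CostructuredArrow.proj F d)).coconePointUniqueUpToIso
    (colimitOfDiagramTerminal terminalIsTerminal (CostructuredArrow.proj F d))

theorem ι_colimitIso (X : CostructuredArrow F d) :
    colimit.ι (CostructuredArrow.proj F d) X ≫ (colimitIso F d).hom = (terminal.from X).left :=
  (colimit.isColimit (CostructuredArrow.proj F d)).comp_coconePointUniqueUpToIso_hom
    (colimitOfDiagramTerminal terminalIsTerminal (CostructuredArrow.proj F d)) X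

/-- The second component of that terminal object. -/
noncomputable def colimitEval : F.obj (colimit (CostructuredArrow.proj F d)) ⟶ d :=
  F.map (colimitIso F d).hom ≫ (⊤_ CostructuredArrow F d).hom

theorem map_colimitEval {c : C} (p : F.obj c ⟶ d) :
    F.map (colimit.ι (CostructuredArrow.proj F d) (CostructuredArrow.mk p)) ≫ colimitEval F d
      = p := by
  have h := (Functor.map_comp F _ _).symm.trans
    (congrArg F.map (ι_colimitIso F d (CostructuredArrow.mk p)))
  refine (Category.assoc _ _ _).symm.trans ?_
  refine (congrArg (· ≫ (⊤_ CostructuredArrow F d).hom) h).trans ?_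
  exact CostructuredArrow.w (terminal.from (CostructuredArrow.mk p))

theorem eq_colimit_ι {c : C} (k : c ⟶ colimit (CostructuredArrow.proj F d)) :
    k = colimit.ι (CostructuredArrow.proj F d)
      (CostructuredArrow.mk (F.map k ≫ colimitEval F d)) := by
  let m : CostructuredArrow.mk (F.map k ≫ colimitEval F d) ⟶ ⊤_ _ :=
    CostructuredArrow.homMk (k ≫ (colimitIso F d).hom) (by
      rw [Functor.map_comp, Category.assoc]; rfl)
  exact (cancel_mono (colimitIso F d).hom).1
    ((congrArg CommaMorphism.left (terminal.hom_ext m (terminal.from _))).trans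
      (ι_colimitIso F d _).symm)

end Generic

variable [ClosedBicategory B] [∀ x y : B, HasColimitsOfSize.{s, s} (x ⟶ y)]
  {M : EnrichedCat.{s} B}

instance (σ τ : Singleton M) :
    HasTerminal (CostructuredArrow (σ.val.restrictFunctor τ.type) τ.val) :=
  σ.isSingleton.hasTerminal τ.val

/-- The `1`-cell `S(σ, τ)`: the colimit of all `f : type τ ⟶ type σ`, indexed by the category of
pairs of such an `f` and a morphism of distributors `σ f ⟶ τ`. -/
noncomputable def hom (σ τ : Singleton M) : τ.type ⟶ σ.type :=
  colimit (CostructuredArrow.proj (σ.val.restrictFunctor τ.type) τ.val)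

/-- The canonical inclusion `f ⟶ S(σ, τ)` associated with `p : σ f ⟶ τ`. -/
noncomputable def incl (σ τ : Singleton M) {f : τ.type ⟶ σ.type}
    (p : σ.val.restrict f ⟶ τ.val) : f ⟶ σ.hom τ :=
  colimit.ι (CostructuredArrow.proj (σ.val.restrictFunctor τ.type) τ.val)
    (CostructuredArrow.mk (S := σ.val.restrictFunctor τ.type) p)

/-- The evaluation `σ S(σ, τ) ⟶ τ`, the unique morphism whose restriction along the inclusion
of `p : σ f ⟶ τ` is `p`. -/
noncomputable def ev (σ τ : Singleton M) : σ.val.restrict (σ.hom τ) ⟶ τ.val :=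
  colimitEval (σ.val.restrictFunctor τ.type) τ.val

theorem incl_ev (σ τ : Singleton M) {f : τ.type ⟶ σ.type} (p : σ.val.restrict f ⟶ τ.val) :
    (σ.val.restrictFunctor τ.type).map (σ.incl τ p) ≫ σ.ev τ = p :=
  map_colimitEval (σ.val.restrictFunctor τ.type) τ.val p

theorem eq_incl (σ τ : Singleton M) {f : τ.type ⟶ σ.type} (k : f ⟶ σ.hom τ) :
    k = σ.incl τ ((σ.val.restrictFunctor τ.type).map k ≫ σ.ev τ) :=
  eq_colimit_ι (σ.val.restrictFunctor τ.type) τ.val k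

/-- The component `σ(a) S(σ, τ) ⟶ τ(a)` of the evaluation. -/
noncomputable def evApp (σ τ : Singleton M) (a : M.carrier) :
    σ.hom τ ≫ σ.val.obj a ⟶ τ.val.obj a :=
  Presingleton.restrictApp (σ.ev τ) a

theorem incl_evApp (σ τ : Singleton M) {f : τ.type ⟶ σ.type} (p : σ.val.restrict f ⟶ τ.val)
    (a : M.carrier) : σ.incl τ p ▷ σ.val.obj a ≫ σ.evApp τ a = Presingleton.restrictApp p a :=
  congrArg (fun q => Presingleton.Hom.app q a) (σ.incl_ev τ p)

theorem hom_ext (σ τ : Singleton M) {f : τ.type ⟶ σ.type} {k l : f ⟶ σ.hom τ}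
    (h : ∀ a, k ▷ σ.val.obj a ≫ σ.evApp τ a = l ▷ σ.val.obj a ≫ σ.evApp τ a) : k = l := by
  rw [σ.eq_incl τ k, σ.eq_incl τ l]
  exact congrArg (σ.incl τ) (Presingleton.hom_ext h)

/-- The composition `S(σ, τ) S(τ, υ) ⟶ S(σ, υ)`; see `incl_comp`. -/
noncomputable def comp (σ τ υ : Singleton M) : τ.hom υ ≫ σ.hom τ ⟶ σ.hom υ :=
  σ.incl υ (compHom (σ.ev τ) (τ.ev υ))

theorem comp_evApp (σ τ υ : Singleton M) (a : M.carrier) :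
    comp σ τ υ ▷ σ.val.obj a ≫ σ.evApp υ a =
      (α_ _ _ _).hom ≫ τ.hom υ ◁ σ.evApp τ a ≫ τ.evApp υ a :=
  σ.incl_evApp υ _ a

theorem id_evApp (σ : Singleton M) (a : M.carrier) :
    σ.incl σ (idHom σ.val) ▷ σ.val.obj a ≫ σ.evApp σ a = (λ_ (σ.val.obj a)).hom :=
  σ.incl_evApp σ _ a

/-- The composition is the `2`-cell induced by the universal property of the colimits: on the
inclusions of `p : σ f ⟶ τ` and `q : τ g ⟶ υ` it is the inclusion of `σ f g ⟶ τ g ⟶ υ`. -/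
theorem incl_comp (σ τ υ : Singleton M) {f : τ.type ⟶ σ.type} {g : υ.type ⟶ τ.type}
    (p : σ.val.restrict f ⟶ τ.val) (q : τ.val.restrict g ⟶ υ.val) :
    g ◁ σ.incl τ p ≫ τ.incl υ q ▷ σ.hom τ ≫ comp σ τ υ = σ.incl υ (compHom p q) := by
  apply hom_ext
  intro a
  rw [incl_evApp]
  have hp := σ.incl_evApp τ p a
  have hq := τ.incl_evApp υ q a
  calc
    _ = 𝟙 _ ⊗≫ g ◁ σ.incl τ p ▷ σ.val.obj a ⊗≫
        (τ.incl υ q ▷ (σ.hom τ ≫ σ.val.obj a) ≫ τ.hom υ ◁ σ.evApp τ a) ⊗≫ τ.evApp υ a := by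
      simp only [comp_whiskerRight, Category.assoc, comp_evApp]
      bicategory
    _ = 𝟙 _ ⊗≫ g ◁ (σ.incl τ p ▷ σ.val.obj a ≫ σ.evApp τ a) ⊗≫
        (τ.incl υ q ▷ τ.val.obj a ≫ τ.evApp υ a) := by
      rw [← whisker_exchange]; bicategory
    _ = _ := by
      rw [hp, hq]
      change _ = (α_ g f (σ.val.obj a)).hom ≫ g ◁ Presingleton.restrictApp p a ≫
        Presingleton.restrictApp q a
      bicategory

end Singleton

section

variable [ClosedBicategory B] [∀ x y : B, HasColimitsOfSize.{s, s} (x ⟶ y)]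

/-- The `B`-category of singletons of `M`. -/
noncomputable def EnrichedCat.singletons (M : EnrichedCat.{s} B) :
    EnrichedCat.{max s u v w} B where
  carrier := Singleton M
  type σ := σ.type
  hom σ τ := σ.hom τ
  comp σ τ υ := Singleton.comp σ τ υ
  refl σ := σ.incl σ (Singleton.idHom σ.val)
  assoc σ τ υ ω := by
    apply Singleton.hom_ext
    intro a
    simp only [comp_whiskerRight, Category.assoc, Singleton.comp_evApp]
    calc
      _ = 𝟙 _ ⊗≫ υ.hom ω ◁ (Singleton.comp σ τ υ ▷ σ.val.obj a ≫ σ.evApp υ a) ⊗≫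
          υ.evApp ω a := by bicategory
      _ = 𝟙 _ ⊗≫ (υ.hom ω ≫ τ.hom υ) ◁ σ.evApp τ a ⊗≫ ((α_ _ _ _).hom ≫
          υ.hom ω ◁ τ.evApp υ a ≫ υ.evApp ω a) := by
        rw [Singleton.comp_evApp]; bicategory
      _ = 𝟙 _ ⊗≫ ((υ.hom ω ≫ τ.hom υ) ◁ σ.evApp τ a ≫ Singleton.comp τ υ ω ▷ τ.val.obj a) ⊗≫
          τ.evApp ω a := by
        rw [← Singleton.comp_evApp]; bicategory
      _ = _ := by
        rw [whisker_exchange]; bicategory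
  comp_refl σ τ := by
    apply Singleton.hom_ext
    intro a
    simp only [comp_whiskerRight, Category.assoc, Singleton.comp_evApp]
    calc
      _ = 𝟙 _ ⊗≫ (τ.incl τ (Singleton.idHom τ.val) ▷ (σ.hom τ ≫ σ.val.obj a) ≫
          τ.hom τ ◁ σ.evApp τ a) ⊗≫ τ.evApp τ a := by bicategory
      _ = 𝟙 _ ⊗≫ σ.evApp τ a ⊗≫ (τ.incl τ (Singleton.idHom τ.val) ▷ τ.val.obj a ≫
          τ.evApp τ a) := by
        rw [← whisker_exchange]; bicategory
      _ = _ := by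
        rw [Singleton.id_evApp]; bicategory
  refl_comp σ τ := by
    apply Singleton.hom_ext
    intro a
    simp only [comp_whiskerRight, Category.assoc, Singleton.comp_evApp]
    calc
      _ = 𝟙 _ ⊗≫ σ.hom τ ◁ (σ.incl σ (Singleton.idHom σ.val) ▷ σ.val.obj a ≫
          σ.evApp σ a) ⊗≫ σ.evApp τ a := by bicategory
      _ = _ := by
        rw [Singleton.id_evApp]; bicategory

end

/-- The full subcategory of `M` determined by a family `t` of elements of `M`. -/
@[simps]
def EnrichedCat.full (M : EnrichedCat.{s} B) {C : Type*} (t : C → M.carrier) :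
    EnrichedCat B where
  carrier := C
  type a := M.type (t a)
  hom a b := M.hom (t a) (t b)
  comp a b c := M.comp (t a) (t b) (t c)
  refl a := M.refl (t a)
  assoc _ _ _ _ := M.assoc _ _ _ _
  comp_refl _ _ := M.comp_refl _ _
  refl_comp _ _ := M.refl_comp _ _

/-- An involution on `B`: a homomorphism from `B` with `1`-cells reversed to `B` which is the
identity on objects and is its own inverse, all equalities of `1`-cells being replaced by coherent
invertible `2`-cells. -/
structure Involution (B : Type u) [Bicategory.{w, v} B] where
  inv : ∀ {x y : B}, (x ⟶ y) ⥤ (y ⟶ x)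
  invId : ∀ x : B, inv.obj (𝟙 x) ≅ 𝟙 x
  invComp : ∀ {x y z : B} (f : x ⟶ y) (g : y ⟶ z), inv.obj (f ≫ g) ≅ inv.obj g ≫ inv.obj f
  map_whiskerLeft : ∀ {x y z : B} (f : x ⟶ y) {g g' : y ⟶ z} (β : g ⟶ g'),
    inv.map (f ◁ β) ≫ (invComp f g').hom = (invComp f g).hom ≫ inv.map β ▷ inv.obj f
  map_whiskerRight : ∀ {x y z : B} {f f' : x ⟶ y} (β : f ⟶ f') (g : y ⟶ z),
    inv.map (β ▷ g) ≫ (invComp f' g).hom = (invComp f g).hom ≫ inv.obj g ◁ inv.map β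
  map_associator : ∀ {x y z t : B} (f : x ⟶ y) (g : y ⟶ z) (h : z ⟶ t),
    inv.map (α_ f g h).hom ≫ (invComp f (g ≫ h)).hom ≫ (invComp g h).hom ▷ inv.obj f =
      (invComp (f ≫ g) h).hom ≫ inv.obj h ◁ (invComp f g).hom ≫
        (α_ (inv.obj h) (inv.obj g) (inv.obj f)).inv
  map_leftUnitor : ∀ {x y : B} (f : x ⟶ y),
    inv.map (λ_ f).hom =
      (invComp (𝟙 x) f).hom ≫ inv.obj f ◁ (invId x).hom ≫ (ρ_ (inv.obj f)).hom
  map_rightUnitor : ∀ {x y : B} (f : x ⟶ y),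
    inv.map (ρ_ f).hom =
      (invComp f (𝟙 y)).hom ≫ (invId y).hom ▷ inv.obj f ≫ (λ_ (inv.obj f)).hom
  invol : ∀ {x y : B} (f : x ⟶ y), inv.obj (inv.obj f) ≅ f
  invol_natural : ∀ {x y : B} {f g : x ⟶ y} (β : f ⟶ g),
    inv.map (inv.map β) ≫ (invol g).hom = (invol f).hom ≫ β
  invol_id : ∀ x : B, (invol (𝟙 x)).hom = inv.map (invId x).hom ≫ (invId x).hom
  invol_comp : ∀ {x y z : B} (f : x ⟶ y) (g : y ⟶ z),
    (invol (f ≫ g)).hom =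
      inv.map (invComp f g).hom ≫ (invComp (inv.obj g) (inv.obj f)).hom ≫
        (invol f).hom ▷ inv.obj (inv.obj g) ≫ f ◁ (invol g).hom
  map_invol : ∀ {x y : B} (f : x ⟶ y), inv.map (invol f).hom = (invol (inv.obj f)).hom

/-- A symmetric structure on a `B`-category `M`, where `B` has an involution: coherent
identifications of `M(a, b)` with the involute of `M(b, a)`, for which the involutes of the unit
and composition `2`-cells are the unit and composition `2`-cells. -/
structure SymmetricStructure (I : Involution B) (M : EnrichedCat.{s} B) where
  iso : ∀ a b : M.carrier, M.hom a b ≅ I.inv.obj (M.hom b a)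
  iso_iso : ∀ a b : M.carrier,
    (iso a b).hom ≫ I.inv.map (iso b a).hom ≫ (I.invol (M.hom a b)).hom = 𝟙 (M.hom a b)
  refl_iso : ∀ a : M.carrier,
    M.refl a ≫ (iso a a).hom = (I.invId (M.type a)).inv ≫ I.inv.map (M.refl a)
  comp_iso : ∀ a b c : M.carrier,
    M.comp a b c ≫ (iso a c).hom =
      M.hom b c ◁ (iso a b).hom ≫ (iso b c).hom ▷ I.inv.obj (M.hom b a) ≫
        (I.invComp (M.hom b a) (M.hom c b)).inv ≫ I.inv.map (M.comp c b a)

namespace Involution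

variable (I : Involution B)

theorem whiskerRight_invComp_inv {x y z : B} (f : x ⟶ y) {g g' : y ⟶ z} (β : g ⟶ g') :
    I.inv.map β ▷ I.inv.obj f ≫ (I.invComp f g').inv =
      (I.invComp f g).inv ≫ I.inv.map (f ◁ β) := by
  rw [Iso.eq_inv_comp, ← Category.assoc, Iso.comp_inv_eq, I.map_whiskerLeft]

theorem whiskerLeft_invComp_inv {x y z : B} {f f' : x ⟶ y} (β : f ⟶ f') (g : y ⟶ z) :
    I.inv.obj g ◁ I.inv.map β ≫ (I.invComp f' g).inv =
      (I.invComp f g).inv ≫ I.inv.map (β ▷ g) := by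
  rw [Iso.eq_inv_comp, ← Category.assoc, Iso.comp_inv_eq, I.map_whiskerRight]

theorem invComp_inv_map_associator_inv {x y z t : B} (f : x ⟶ y) (g : y ⟶ z) (h : z ⟶ t) :
    (I.invComp g h).inv ▷ I.inv.obj f ≫ (I.invComp f (g ≫ h)).inv ≫ I.inv.map (α_ f g h).inv =
      (α_ (I.inv.obj h) (I.inv.obj g) (I.inv.obj f)).hom ≫
        I.inv.obj h ◁ (I.invComp f g).inv ≫ (I.invComp (f ≫ g) h).inv := by
  have h1 : (I.inv.mapIso (α_ f g h) ≪≫ I.invComp f (g ≫ h) ≪≫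
      whiskerRightIso (I.invComp g h) (I.inv.obj f)) =
      I.invComp (f ≫ g) h ≪≫ whiskerLeftIso (I.inv.obj h) (I.invComp f g) ≪≫
        (α_ (I.inv.obj h) (I.inv.obj g) (I.inv.obj f)).symm :=
    Iso.ext (I.map_associator f g h)
  simpa using congrArg Iso.inv h1

/-- The canonical `2`-cell from `g f°` to the involute of `f g°`. -/
def flip {x y z : B} (f : x ⟶ y) (g : x ⟶ z) :
    I.inv.obj f ≫ g ≅ I.inv.obj (I.inv.obj g ≫ f) :=
  whiskerLeftIso (I.inv.obj f) (I.invol g).symm ≪≫ (I.invComp (I.inv.obj g) f).symm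

end Involution

section Symmetric

variable {I : Involution B} {M : EnrichedCat.{s} B} (S : SymmetricStructure I M)

/-- The involute `σ°` of a presingleton, with `σ°(a) = σ(a)°`. -/
@[simps]
def Presingleton.involute {x : B} (σ : Presingleton M x) : Precosingleton M x where
  obj a := I.inv.obj (σ.obj a)
  act a b := (S.iso a b).hom ▷ I.inv.obj (σ.obj a) ≫
    (I.invComp (σ.obj a) (M.hom b a)).inv ≫ I.inv.map (σ.act b a)
  act_refl a := by
    rw [← comp_whiskerRight_assoc, S.refl_iso, comp_whiskerRight_assoc,
      ← Category.assoc (I.inv.map (M.refl a) ▷ _), I.whiskerRight_invComp_inv, Category.assoc,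
      ← Functor.map_comp, σ.act_refl, I.map_rightUnitor]
    simp
  act_comp a b c := by
    have h : I.inv.map (σ.obj a ◁ M.comp c b a) ≫ I.inv.map (σ.act c a) =
        I.inv.map (α_ (σ.obj a) (M.hom b a) (M.hom c b)).inv ≫
          I.inv.map (σ.act b a ▷ M.hom c b) ≫ I.inv.map (σ.act c b) := by
      simp only [← Functor.map_comp, σ.act_comp]
      simp
    symm
    rw [← comp_whiskerRight_assoc, S.comp_iso]
    simp only [comp_whiskerRight, Category.assoc]
    rw [← Category.assoc (I.inv.map (M.comp c b a) ▷ _), I.whiskerRight_invComp_inv,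
      Category.assoc, h]
    have h2 := I.invComp_inv_map_associator_inv (σ.obj a) (M.hom b a) (M.hom c b)
    rw [← Category.assoc (I.invComp (σ.obj a) _).inv, ← Category.assoc (_ ▷ _) (_ ≫ _), h2]
    simp only [whiskerLeft_comp, Category.assoc]
    have h3 := I.whiskerLeft_invComp_inv (σ.act b a) (M.hom c b)
    rw [← Category.assoc (I.invComp _ (M.hom c b)).inv, ← h3]
    calc
      _ = 𝟙 _ ⊗≫ M.hom b c ◁ (S.iso a b).hom ▷ I.inv.obj (σ.obj a) ⊗≫
          ((S.iso b c).hom ▷ (I.inv.obj (M.hom b a) ≫ I.inv.obj (σ.obj a)) ≫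
          I.inv.obj (M.hom c b) ◁ ((I.invComp (σ.obj a) (M.hom b a)).inv ≫
            I.inv.map (σ.act b a))) ⊗≫
          (I.invComp (σ.obj b) (M.hom c b)).inv ≫ I.inv.map (σ.act c b) := by bicategory
      _ = _ := by
        rw [← whisker_exchange]; bicategory

/-- A family of `2`-cells `e a b : σ(a) σ(b)° ⟶ M(a, b)` is symmetric if it is fixed by the
involution, i.e. `(e a b)° = e b a` up to the canonical identifications. -/
def IsSymmetricCounit {x : B} (σ : Presingleton M x)
    (e : ∀ a b : M.carrier, I.inv.obj (σ.obj b) ≫ σ.obj a ⟶ M.hom a b) : Prop :=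
  ∀ a b : M.carrier,
    (I.flip (σ.obj b) (σ.obj a)).hom ≫ I.inv.map (e b a) = e a b ≫ (S.iso a b).hom

/-- A symmetric singleton of `M`: a presingleton `σ` with a symmetric adjunction `σ ⊣ σ°`, i.e.
an adjunction whose counit (hence also its unit) is fixed by the involution. -/
structure SymSingleton where
  type : B
  val : Presingleton M type
  counit : ∀ a b : M.carrier, I.inv.obj (val.obj b) ≫ val.obj a ⟶ M.hom a b
  symmetric : IsSymmetricCounit S val counit
  adjunction : IsAdjunction val (val.involute S) counit

/-- `M` with its symmetric structure is symmetrically complete if every symmetric singleton of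
`M` is representable. -/
def SymmetricStructure.IsSymmetricallyComplete : Prop :=
  ∀ σ : SymSingleton S, σ.val.IsRepresentable

variable {S}

/-- A symmetric singleton is a singleton. -/
def SymSingleton.toSingleton (σ : SymSingleton S) : Singleton M where
  type := σ.type
  val := σ.val
  isSingleton := ⟨_, _, σ.adjunction⟩

variable [ClosedBicategory B] [∀ x y : B, HasColimitsOfSize.{s, s} (x ⟶ y)]

variable (S) in
/-- The `B`-category of symmetric singletons of `M`: the restriction of the `B`-category of
singletons to the symmetric ones. -/
noncomputable def symSingletons : EnrichedCat.{max s u v w} B :=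
  M.singletons.full (SymSingleton.toSingleton (S := S))

/-- The canonical symmetric structure on the `B`-category of symmetric singletons. The `2`-cells
`S(σ, τ) ≅ S(τ, σ)°` are those for which the following two `2`-cells
`σ(a) S(σ, τ) τ(b)° ⟶ M(a, b)` agree: on the one hand
`σ(a) S(σ, τ) τ(b)° ⟶ τ(a) τ(b)° ⟶ M(a, b)`, on the other hand
`σ(a) S(σ, τ) τ(b)° ≅ σ(a) (τ(b) S(τ, σ))° ⟶ σ(a) σ(b)° ⟶ M(a, b)`. -/
def IsCanonical (K : SymmetricStructure I (symSingletons S)) : Prop :=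
  ∀ (σ τ : SymSingleton S) (a b : M.carrier),
    I.inv.obj (τ.val.obj b) ◁ σ.toSingleton.evApp τ.toSingleton a ≫ τ.counit a b =
      (α_ (I.inv.obj (τ.val.obj b)) (σ.toSingleton.hom τ.toSingleton) (σ.val.obj a)).inv ≫
        (I.inv.obj (τ.val.obj b) ◁ (K.iso σ τ).hom) ▷ σ.val.obj a ≫
        (I.invComp (τ.toSingleton.hom σ.toSingleton) (τ.val.obj b)).inv ▷ σ.val.obj a ≫
        I.inv.map (τ.toSingleton.evApp σ.toSingleton b) ▷ σ.val.obj a ≫ σ.counit a b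

end Symmetric

end EnrichedBicat

/-! Let `Φ ⊣ Ψ` be an adjunction over the `B`-category of singletons. Representable presingletons of
`M` are singletons, so `Φ` restricts along `a ↦ M(-, a)` to a presingleton `ω` of `M` with `ω(a) =
Φ(M(-, a))`. Completeness amounts to two facts: `ω` is again a singleton, and `Φ ≅ S(-, ω)`.

Both come from density. If `σ ⊣ σ'` has unit `η : 1 ⟶ ∫^b σ'(b) σ(b)`, a triangle identity says that
the identity of `σ` factors through `η` and the composites of `σ σ'(b) ⟶ M(-, b)` with the Yoneda
morphism `M(-, b) σ(b) ⟶ σ`. Such data are preserved by every module on which morphisms `σ f ⟶ τ`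
act, so a singleton is an absolute colimit of representables. Hence a coend over all singletons has
the same universal property over the representables (`ModuleCowedge.IsUniversal.res`), and `Φ ⊣ Ψ`
restricts to an adjunction over `M` (`IsModuleAdjunction.res`). Density also gives an element `i : 1
⟶ Φ(ω)` through which `2`-cells `f ⟶ Φ(σ)` correspond to morphisms `σ f ⟶ ω`
(`RightModule.exists_universal`). As `S(σ, ω)` classifies the same morphisms, `Φ` is represented by
`ω`.

For symmetric singletons the argument is the same, once the restricted adjunction `ω ⊣ ω°` is known
to be symmetric. Canonicity at a pair of representables, evaluated at the units of `M`, forces `κ`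
to be the given identification `M(a, b) ≅ M(b, a)°` up to Yoneda, so symmetry over `S` restricts to
symmetry over `M`.

For existence of a canonical structure, the adjunctions `σ ⊣ σ°` and `τ ⊣ τ°` assign to `p : τ g ⟶
σ` a mate `σ g° ⟶ τ`: take the involute `g° τ° ⟶ σ°` and transpose. The equation defining the mate
determines it, which yields compatibility with units, composition and the double involution. The
mate of the evaluation `τ S(τ, σ) ⟶ σ` is a `2`-cell `S(τ, σ)° ⟶ S(σ, τ)`; it is invertible because
taking mates is involutive, and the equation defining it is canonicity. -/

namespace EnrichedBicat

variable {B : Type u} [Bicategory.{w, v} B] {M : EnrichedCat.{s} B}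

open Presingleton EnrichedBicat.Singleton

/-! ### Calculus of morphisms `σ f ⟶ τ`, the Yoneda lemma, adjunctions. -/

section

namespace Presingleton

section HomCalculus

variable {x y z : B} {σ : Presingleton M x} {τ : Presingleton M y} {υ : Presingleton M z}

theorem restrictHom_ext {f : y ⟶ x} {p q : σ.restrict f ⟶ τ}
    (h : ∀ a, restrictApp p a = restrictApp q a) : p = q :=
  hom_ext h

/-- Precomposition of `p : σ f ⟶ τ` with a `2`-cell `g ⟶ f`. -/
def precompose {f g : y ⟶ x} (β : g ⟶ f) (p : σ.restrict f ⟶ τ) : σ.restrict g ⟶ τ :=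
  (σ.restrictFunctor y).map β ≫ p

@[simp]
theorem restrictApp_precompose {f g : y ⟶ x} (β : g ⟶ f) (p : σ.restrict f ⟶ τ)
    (a : M.carrier) : restrictApp (precompose β p) a = β ▷ σ.obj a ≫ restrictApp p a :=
  rfl

@[simp]
theorem restrictApp_compHom {f : y ⟶ x} {g : z ⟶ y} (p : σ.restrict f ⟶ τ)
    (q : τ.restrict g ⟶ υ) (a : M.carrier) :
    restrictApp (compHom p q) a = (α_ g f (σ.obj a)).hom ≫ g ◁ restrictApp p a ≫ restrictApp q a :=
  rfl

@[simp]
theorem restrictApp_idHom (a : M.carrier) : restrictApp (idHom σ) a = (λ_ (σ.obj a)).hom :=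
  rfl

@[simp]
theorem id_precompose {f : y ⟶ x} (p : σ.restrict f ⟶ τ) : precompose (𝟙 f) p = p :=
  restrictHom_ext fun a => by simp

theorem comp_precompose {f g h : y ⟶ x} (γ : h ⟶ g) (β : g ⟶ f) (p : σ.restrict f ⟶ τ) :
    precompose (γ ≫ β) p = precompose γ (precompose β p) :=
  restrictHom_ext fun a => by simp

theorem compHom_precompose {f : y ⟶ x} {g g' : z ⟶ y} (β : g' ⟶ g) (p : σ.restrict f ⟶ τ)
    (q : τ.restrict g ⟶ υ) : compHom p (precompose β q) = precompose (β ▷ f) (compHom p q) :=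
  restrictHom_ext fun a => by
    simp only [restrictApp_compHom, restrictApp_precompose]
    rw [whisker_exchange_assoc]
    simp

theorem precompose_compHom {f f' : y ⟶ x} {g : z ⟶ y} (β : f' ⟶ f) (p : σ.restrict f ⟶ τ)
    (q : τ.restrict g ⟶ υ) : compHom (precompose β p) q = precompose (g ◁ β) (compHom p q) :=
  restrictHom_ext fun a => by simp

theorem compHom_idHom {f : y ⟶ x} (p : σ.restrict f ⟶ τ) :
    compHom p (idHom τ) = precompose (λ_ f).hom p :=
  restrictHom_ext fun a => by simp

/-- The morphism from the restriction of the representable presingleton `M(-, a)` along `τ(a)` to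
`τ` which corresponds to the identity of `τ(a)` under the Yoneda lemma. -/
def ofRepresentable (τ : Presingleton M y) (a : M.carrier) :
    (representable M a).restrict (τ.obj a) ⟶ τ :=
  restrictMk (fun b => τ.act b a) fun b c => τ.act_comp b c a

/-- Naturality of the Yoneda correspondence: in components this is exactly the compatibility of `p`
with the actions of `M`. -/
theorem ofRepresentable_compHom {f : y ⟶ x} (p : σ.restrict f ⟶ τ) (a : M.carrier) :
    compHom (ofRepresentable σ a) p = precompose (restrictApp p a) (ofRepresentable τ a) :=
  restrictHom_ext fun b => (restrictApp_act p b a).symm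

theorem refl_ofRepresentable (a : M.carrier) :
    precompose (M.refl a) (ofRepresentable (representable M a) a) = idHom (representable M a) :=
  restrictHom_ext fun b => M.comp_refl b a

/-- The component `f M(b, a) ⟶ τ(b)` of a morphism `M(-, a) f ⟶ τ`. -/
def representableApp {a : M.carrier} {f : y ⟶ M.type a} (p : (representable M a).restrict f ⟶ τ)
    (b : M.carrier) : f ≫ M.hom b a ⟶ τ.obj b :=
  restrictApp p b

theorem representableApp_act {a : M.carrier} {f : y ⟶ M.type a}
    (p : (representable M a).restrict f ⟶ τ) (b c : M.carrier) :
    representableApp p c ▷ M.hom b c ≫ τ.act b c =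
      (α_ f (M.hom c a) (M.hom b c)).hom ≫ f ◁ M.comp b c a ≫ representableApp p b :=
  restrictApp_act p b c

/-- The `2`-cell `f ⟶ τ(a)` which corresponds to a morphism `M(-, a) f ⟶ τ` under the Yoneda
lemma. -/
def yoneda {a : M.carrier} {f : y ⟶ M.type a} (p : (representable M a).restrict f ⟶ τ) :
    f ⟶ τ.obj a :=
  (ρ_ f).inv ≫ f ◁ M.refl a ≫ representableApp p a

theorem yoneda_precompose {a : M.carrier} {f g : y ⟶ M.type a} (β : g ⟶ f)
    (p : (representable M a).restrict f ⟶ τ) : yoneda (precompose β p) = β ≫ yoneda p := by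
  change (ρ_ g).inv ≫ g ◁ M.refl a ≫ β ▷ M.hom a a ≫ representableApp p a = _
  rw [whisker_exchange_assoc]
  simp [yoneda]

theorem yoneda_ofRepresentable (a : M.carrier) : yoneda (ofRepresentable τ a) = 𝟙 (τ.obj a) := by
  change (ρ_ (τ.obj a)).inv ≫ τ.obj a ◁ M.refl a ≫ τ.act a a = _
  simp [τ.act_refl]

theorem precompose_yoneda {a : M.carrier} {f : y ⟶ M.type a}
    (p : (representable M a).restrict f ⟶ τ) :
    precompose (yoneda p) (ofRepresentable τ a) = p := by
  apply restrictHom_ext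
  intro b
  change ((ρ_ f).inv ≫ f ◁ M.refl a ≫ representableApp p a) ▷ M.hom b a ≫ τ.act b a =
    representableApp p b
  simp only [comp_whiskerRight, Category.assoc, representableApp_act, whisker_assoc,
    Iso.inv_hom_id_assoc]
  rw [← whiskerLeft_comp_assoc, M.comp_refl]
  simp

theorem precompose_ofRepresentable_injective {a : M.carrier} {f : y ⟶ M.type a}
    {β γ : f ⟶ τ.obj a}
    (h : precompose β (ofRepresentable τ a) = precompose γ (ofRepresentable τ a)) : β = γ := by
  simpa [yoneda_precompose, yoneda_ofRepresentable] using congrArg yoneda h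

end HomCalculus

end Presingleton

namespace IsAdjunction

variable {x : B} {σ : Presingleton M x} {σ' : Precosingleton M x}
  {e : ∀ a b : M.carrier, σ'.obj b ≫ σ.obj a ⟶ M.hom a b}

/-- The components `σ(b) σ'(a) ⟶ M(b, a)` of the counit as a morphism of presingletons. -/
def counitHom (h : IsAdjunction σ σ' e) (a : M.carrier) :
    σ.restrict (σ'.obj a) ⟶ representable M a :=
  restrictMk (fun b => e b a) fun b c => h.counit_left b c a

/-- The counit condition in the variable of `σ'`; the condition in the variable of `σ` is what makes
`counitHom` a morphism. -/
theorem counitHom_compHom (h : IsAdjunction σ σ' e) (a b : M.carrier) :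
    compHom (h.counitHom a) (ofRepresentable (representable M b) a) =
      precompose (σ'.act a b) (h.counitHom b) :=
  restrictHom_ext fun d => by
    change (α_ _ _ _).hom ≫ M.hom a b ◁ e d a ≫ M.comp d a b = σ'.act a b ▷ σ.obj d ≫ e d b
    rw [h.counit_right, Iso.hom_inv_id_assoc]

/-- The `2`-cells `T` of the first triangle identity assemble to one morphism of presingletons, so
that modules can act on it. Compatibility with the action is tested on the legs of the coend, where
`T` is a composite `σ σ'(b) σ(b) ⟶ M(-, b) σ(b) ⟶ σ` of morphisms of presingletons. This is the form
in which `σ` is an absolute colimit of representables. -/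
theorem exists_unitHom [ClosedBicategory B] (h : IsAdjunction σ σ' e) :
    ∃ (E : Cowedge σ σ') (η : 𝟙 x ⟶ E.pt) (T : σ.restrict E.pt ⟶ σ), E.IsUniversal ∧
      (∀ b, precompose (E.leg b) T = compHom (h.counitHom b) (ofRepresentable σ b)) ∧
      precompose η T = idHom σ ∧
      ∀ a, ∃ T' : σ'.obj a ≫ E.pt ⟶ σ'.obj a,
        (∀ b, σ'.obj a ◁ E.leg b ≫ T' =
          (α_ (σ'.obj a) (σ.obj b) (σ'.obj b)).inv ≫ e b a ▷ σ'.obj b ≫ σ'.act b a) ∧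
        (ρ_ (σ'.obj a)).inv ≫ σ'.obj a ◁ η ≫ T' = 𝟙 (σ'.obj a) := by
  obtain ⟨E, η, hE, hT, hT'⟩ := h.exists_unit
  choose T hT hη using hT
  refine ⟨E, η, restrictMk T ?_, hE, fun b => restrictHom_ext fun a => hT a b,
    restrictHom_ext fun a => ?_, hT'⟩
  · intro a b
    apply hE.whiskerRight_whiskerRight_hom_ext
    intro c
    have q : (E.leg c ▷ σ.obj b ≫ T b) ▷ M.hom a b ≫ σ.act a b =
        (α_ (σ.obj c ≫ σ'.obj c) (σ.obj b) (M.hom a b)).hom ≫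
          (σ.obj c ≫ σ'.obj c) ◁ σ.act a b ≫ E.leg c ▷ σ.obj a ≫ T a := by
      rw [hT, hT]
      exact restrictApp_act (compHom (h.counitHom c) (ofRepresentable σ c)) a b
    rw [← comp_whiskerRight_assoc, q, whisker_exchange_assoc]
    simp
  · have := hη a
    rw [Iso.inv_comp_eq, Category.comp_id] at this
    exact this

end IsAdjunction

end

/-! ### Modules over a class of presingletons and the density of the representables. -/

section

/-- A right module over the full subcategory of presingletons satisfying `P`: a family of `1`-cells
`obj h : x ⟶ y`, for the presingletons of type `y` which satisfy `P`, on which the morphisms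
`σ f ⟶ τ` act functorially. -/
structure RightModule (P : ∀ ⦃y : B⦄, Presingleton M y → Sort*) (x : B) where
  obj : ∀ {y : B} {σ : Presingleton M y}, P σ → (x ⟶ y)
  act : ∀ {y z : B} {σ : Presingleton M y} {τ : Presingleton M z} (h : P σ) (k : P τ) {f : z ⟶ y},
    (σ.restrict f ⟶ τ) → (obj k ≫ f ⟶ obj h)
  whiskerLeft_act : ∀ {y z : B} {σ : Presingleton M y} {τ : Presingleton M z} (h : P σ) (k : P τ)
    {f g : z ⟶ y} (β : g ⟶ f) (p : σ.restrict f ⟶ τ),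
    obj k ◁ β ≫ act h k p = act h k (precompose β p)
  act_id : ∀ {y : B} {σ : Presingleton M y} (h : P σ), act h h (idHom σ) = (ρ_ (obj h)).hom
  act_comp : ∀ {y z t : B} {σ : Presingleton M y} {τ : Presingleton M z} {υ : Presingleton M t}
    (h : P σ) (k : P τ) (l : P υ) {f : z ⟶ y} {g : t ⟶ z} (p : σ.restrict f ⟶ τ)
    (q : τ.restrict g ⟶ υ),
    act k l q ▷ f ≫ act h k p = (α_ (obj l) g f).hom ≫ act h l (compHom p q)

/-- A left module over the full subcategory of presingletons satisfying `P`. -/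
structure LeftModule (P : ∀ ⦃y : B⦄, Presingleton M y → Sort*) (x : B) where
  obj : ∀ {y : B} {σ : Presingleton M y}, P σ → (y ⟶ x)
  act : ∀ {y z : B} {σ : Presingleton M y} {τ : Presingleton M z} (h : P σ) (k : P τ) {f : z ⟶ y},
    (σ.restrict f ⟶ τ) → (f ≫ obj h ⟶ obj k)
  whiskerRight_act : ∀ {y z : B} {σ : Presingleton M y} {τ : Presingleton M z} (h : P σ) (k : P τ)
    {f g : z ⟶ y} (β : g ⟶ f) (p : σ.restrict f ⟶ τ),
    β ▷ obj h ≫ act h k p = act h k (precompose β p)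
  act_id : ∀ {y : B} {σ : Presingleton M y} (h : P σ), act h h (idHom σ) = (λ_ (obj h)).hom
  act_comp : ∀ {y z t : B} {σ : Presingleton M y} {τ : Presingleton M z} {υ : Presingleton M t}
    (h : P σ) (k : P τ) (l : P υ) {f : z ⟶ y} {g : t ⟶ z} (p : σ.restrict f ⟶ τ)
    (q : τ.restrict g ⟶ υ),
    g ◁ act h k p ≫ act k l q = (α_ g f (obj h)).inv ≫ act h l (compHom p q)

namespace RightModule

variable {P : ∀ ⦃y : B⦄, Presingleton M y → Sort*} {x : B} (Φ : RightModule P x)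

/-- This identity serves both as associativity of the restriction `res` and as linearity and
naturality of `toRes`: both ways around are the action of `σ(a) f ⟶ τ(a)` followed by the Yoneda
morphism. -/
theorem act_ofRepresentable {y z : B} {σ : Presingleton M y} {τ : Presingleton M z} {a : M.carrier}
    (i : P (representable M a)) (h : P σ) (k : P τ) {f : z ⟶ y} (p : σ.restrict f ⟶ τ) :
    Φ.act h k p ▷ σ.obj a ≫ Φ.act i h (ofRepresentable σ a) =
      (α_ (Φ.obj k) f (σ.obj a)).hom ≫ Φ.obj k ◁ restrictApp p a ≫
        Φ.act i k (ofRepresentable τ a) := by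
  rw [Φ.act_comp, ofRepresentable_compHom, Φ.whiskerLeft_act]

/-- The presingleton of `M` obtained by restriction to the representable presingletons. -/
def res (r : ∀ a, P (representable M a)) : Presingleton M x where
  obj a := Φ.obj (r a)
  act a b := Φ.act (r a) (r b) (ofRepresentable (representable M b) a)
  act_refl a := by
    refine (Φ.whiskerLeft_act _ _ _ _).trans ?_
    rw [refl_ofRepresentable, Φ.act_id]
  act_comp a b c := Φ.act_ofRepresentable (r a) (r b) (r c) _

variable (r : ∀ a, P (representable M a)) {y z : B} {σ : Presingleton M y} {τ : Presingleton M z}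

/-- The canonical morphism from `σ Φ(σ)` to the restriction of `Φ` to the representables. -/
def toRes (h : P σ) : σ.restrict (Φ.obj h) ⟶ Φ.res r :=
  restrictMk (fun a => Φ.act (r a) h (ofRepresentable σ a)) fun a b => 
    Φ.act_ofRepresentable (r a) (r b) h _

theorem precompose_act_toRes (h : P σ) (k : P τ) {f : z ⟶ y} (p : σ.restrict f ⟶ τ) :
    precompose (Φ.act h k p) (Φ.toRes r h) = compHom p (Φ.toRes r k) :=
  restrictHom_ext fun a => Φ.act_ofRepresentable (r a) h k p

end RightModule

namespace LeftModule

variable {P : ∀ ⦃y : B⦄, Presingleton M y → Sort*} {x : B} (Ψ : LeftModule P x)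

theorem act_ofRepresentable {y z : B} {σ : Presingleton M y} {τ : Presingleton M z} {a : M.carrier}
    (i : P (representable M a)) (h : P σ) (k : P τ) {f : z ⟶ y} (p : σ.restrict f ⟶ τ) :
    f ◁ Ψ.act i h (ofRepresentable σ a) ≫ Ψ.act h k p =
      (α_ f (σ.obj a) (Ψ.obj i)).inv ≫ restrictApp p a ▷ Ψ.obj i ≫
        Ψ.act i k (ofRepresentable τ a) := by
  rw [Ψ.act_comp, ofRepresentable_compHom, Ψ.whiskerRight_act]

/-- The precosingleton of `M` obtained by restriction to the representable presingletons. -/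
def res (r : ∀ a, P (representable M a)) : Precosingleton M x where
  obj a := Ψ.obj (r a)
  act a b := Ψ.act (r a) (r b) (ofRepresentable (representable M b) a)
  act_refl a := by
    refine (Ψ.whiskerRight_act _ _ _ _).trans ?_
    rw [refl_ofRepresentable, Ψ.act_id]
  act_comp a b c := Ψ.act_ofRepresentable (r a) (r b) (r c) _

/-- Linearity in `a` of the `2`-cells `Ψ(σ) σ'(a) ⟶ Ψ(M(-, a))`, needed when a coend over `σ` and
`σ'` is mapped into a cowedge on representables. -/
theorem act_counitHom {y : B} {σ : Presingleton M y} {σ' : Precosingleton M y}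
    {e : ∀ a b : M.carrier, σ'.obj b ≫ σ.obj a ⟶ M.hom a b} (adj : IsAdjunction σ σ' e)
    {a b : M.carrier} (i : P (representable M a)) (j : P (representable M b)) (h : P σ) :
    M.hom a b ◁ Ψ.act h i (adj.counitHom a) ≫
        Ψ.act i j (ofRepresentable (representable M b) a) =
      (α_ (M.hom a b) (σ'.obj a) (Ψ.obj h)).inv ≫ σ'.act a b ▷ Ψ.obj h ≫
        Ψ.act h j (adj.counitHom b) := by
  rw [Ψ.whiskerRight_act, ← adj.counitHom_compHom]
  exact Ψ.act_comp _ _ _ _ _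

end LeftModule

theorem Cowedge.IsUniversal.whiskerLeft_whiskerRight_desc [ClosedBicategory B] {x y z z' : B}
    {σ : Presingleton M x} {τ : Precosingleton M y} {E : Cowedge σ τ} (hE : E.IsUniversal)
    {g : z ⟶ x} {g' : y ⟶ z'} {f : z ⟶ z'} (k : ∀ a, (g ≫ σ.obj a ≫ τ.obj a) ≫ g' ⟶ f)
    (hk : ∀ a b, (g ◁ (α_ (σ.obj b) (M.hom a b) (τ.obj a)).hom) ▷ g' ≫
      (g ◁ σ.obj b ◁ τ.act a b) ▷ g' ≫ k b = (g ◁ σ.act a b ▷ τ.obj a) ▷ g' ≫ k a) :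
    ∃ T : (g ≫ E.pt) ≫ g' ⟶ f, ∀ a, (g ◁ E.leg a) ▷ g' ≫ T = k a :=
  hE.map_desc (precomp y g ⋙ postcomp z g') k hk

section Density

variable [ClosedBicategory B] {P : ∀ ⦃y : B⦄, Presingleton M y → Sort*} {x x' : B}
  (Φ : RightModule P x) (Ψ : LeftModule P x') (r : ∀ a, P (representable M a))
  {y : B} {σ : Presingleton M y} {σ' : Precosingleton M y}
  {e : ∀ a b : M.carrier, σ'.obj b ≫ σ.obj a ⟶ M.hom a b}

/-- The `2`-cells `Φ(M(-, c)) σ'(c) ⟶ Φ(σ)` are jointly epic, also after composition with a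
`1`-cell. -/
theorem RightModule.hom_ext_of_isAdjunction (h : P σ) (adj : IsAdjunction σ σ' e) {z : B}
    {g : y ⟶ z} {f : x ⟶ z} {k l : Φ.obj h ≫ g ⟶ f}
    (H : ∀ c, Φ.act h (r c) (adj.counitHom c) ▷ g ≫ k =
      Φ.act h (r c) (adj.counitHom c) ▷ g ≫ l) : k = l := by
  obtain ⟨E, η, T, hE, hT, hη, -⟩ := adj.exists_unitHom
  -- On each leg the action of `T` passes through the action of a counit component, where `k` and
  -- `l` agree by hypothesis.
  have h1 : Φ.act h h T ▷ g ≫ k = Φ.act h h T ▷ g ≫ l := by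
    apply hE.whiskerLeft_whiskerRight_hom_ext
    intro a
    rw [← comp_whiskerRight_assoc, ← comp_whiskerRight_assoc, Φ.whiskerLeft_act, hT,
      ← cancel_epi ((α_ _ _ _).hom ▷ g), ← comp_whiskerRight_assoc, ← comp_whiskerRight_assoc,
      ← Φ.act_comp h (r a) h, comp_whiskerRight_assoc, comp_whiskerRight_assoc, H]
  -- Since `η` followed by `T` is the identity of `σ`, the action of `T` is a split epimorphism,
  -- also after whiskering with `g`.
  have h2 : (Φ.obj h ◁ η) ▷ g ≫ Φ.act h h T ▷ g = (ρ_ (Φ.obj h)).hom ▷ g := by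
    rw [← comp_whiskerRight, Φ.whiskerLeft_act, hη, Φ.act_id]
  rw [← cancel_epi ((ρ_ (Φ.obj h)).hom ▷ g), ← h2, Category.assoc, h1, Category.assoc]

/-- A cowedge of the restrictions of `Φ` and `Ψ` extends to `σ`. -/
theorem Cowedge.exists_extension (W : Cowedge (Φ.res r) (Ψ.res r)) (h : P σ)
    (adj : IsAdjunction σ σ' e) :
    ∃ l : Φ.obj h ≫ Ψ.obj h ⟶ W.pt,
      ∀ (c : M.carrier) (g : M.type c ⟶ y) (q : σ.restrict g ⟶ representable M c),
        Φ.act h (r c) q ▷ Ψ.obj h ≫ l =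
          (α_ (Φ.obj (r c)) g (Ψ.obj h)).hom ≫ Φ.obj (r c) ◁ Ψ.act h (r c) q ≫ W.leg c := by
  obtain ⟨E, η, T, hE, hT, hη, -⟩ := adj.exists_unitHom
  let A : ∀ a, Φ.obj h ≫ σ.obj a ⟶ Φ.obj (r a) := fun a => Φ.act (r a) h (ofRepresentable σ a)
  let C : ∀ a, σ'.obj a ≫ Ψ.obj h ⟶ Ψ.obj (r a) := fun a => Ψ.act h (r a) (adj.counitHom a)
  let ω (a b) : Φ.obj (r b) ≫ M.hom a b ⟶ Φ.obj (r a) :=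
    Φ.act (r a) (r b) (ofRepresentable (representable M b) a)
  let ζ (a b) : M.hom a b ≫ Ψ.obj (r a) ⟶ Ψ.obj (r b) :=
    Ψ.act (r a) (r b) (ofRepresentable (representable M b) a)
  let W' (a) : Φ.obj (r a) ≫ Ψ.obj (r a) ⟶ W.pt := W.leg a
  have hW (a b) : (α_ (Φ.obj (r b)) (M.hom a b) (Ψ.obj (r a))).hom ≫ Φ.obj (r b) ◁ ζ a b ≫ W' b =
      ω a b ▷ Ψ.obj (r a) ≫ W' a := W.wedge a b
  have hA (a b) : A b ▷ M.hom a b ≫ ω a b = (α_ _ _ _).hom ≫ Φ.obj h ◁ σ.act a b ≫ A a :=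
    restrictApp_act (Φ.toRes r h) a b
  have hC (a b) : σ'.act a b ▷ Ψ.obj h ≫ C b = (α_ _ _ _).hom ≫ M.hom a b ◁ C a ≫ ζ a b := by
    rw [← Iso.inv_comp_eq]
    exact (Ψ.act_counitHom adj (r a) (r b) h).symm
  -- The extension inserts `η` between `Φ(σ)` and `Ψ(σ)`, then uses `σ(a)` to pass from `Φ(σ)` to
  -- `Φ(M(-, a))` and `σ'(a)` to pass from `Ψ(σ)` to `Ψ(M(-, a))`, where `W` has a leg. `D` is the
  -- part after `η`; the linearity of `A` and `C` and the wedge condition of `W` make it well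
  -- defined on the coend.
  obtain ⟨D, hD'⟩ := hE.whiskerLeft_whiskerRight_desc (g := Φ.obj h) (g' := Ψ.obj h) (f := W.pt)
    (fun a => 𝟙 _ ⊗≫ A a ▷ σ'.obj a ▷ Ψ.obj h ⊗≫ Φ.obj (r a) ◁ C a ≫ W' a) (by
      intro a b
      calc
        _ = 𝟙 _ ⊗≫ ((Φ.obj h ≫ σ.obj b) ◁ (σ'.act a b ▷ Ψ.obj h) ≫
            A b ▷ (σ'.obj b ≫ Ψ.obj h)) ⊗≫ Φ.obj (r b) ◁ C b ≫ W' b := by bicategory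
        _ = 𝟙 _ ⊗≫ A b ▷ ((M.hom a b ≫ σ'.obj a) ≫ Ψ.obj h) ⊗≫
            Φ.obj (r b) ◁ (σ'.act a b ▷ Ψ.obj h ≫ C b) ≫ W' b := by
          rw [whisker_exchange]; bicategory
        _ = 𝟙 _ ⊗≫ A b ▷ M.hom a b ▷ (σ'.obj a ≫ Ψ.obj h) ⊗≫ (Φ.obj (r b) ≫ M.hom a b) ◁ C a ⊗≫
            ((α_ _ _ _).hom ≫ Φ.obj (r b) ◁ ζ a b ≫ W' b) := by
          rw [hC]; bicategory
        _ = 𝟙 _ ⊗≫ A b ▷ M.hom a b ▷ (σ'.obj a ≫ Ψ.obj h) ⊗≫ ((Φ.obj (r b) ≫ M.hom a b) ◁ C a ≫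
            ω a b ▷ Ψ.obj (r a)) ≫ W' a := by
          rw [hW]; bicategory
        _ = 𝟙 _ ⊗≫ (A b ▷ M.hom a b ≫ ω a b) ▷ (σ'.obj a ≫ Ψ.obj h) ⊗≫
            Φ.obj (r a) ◁ C a ≫ W' a := by
          rw [whisker_exchange]; bicategory
        _ = _ := by rw [hA]; bicategory)
  refine ⟨((ρ_ (Φ.obj h)).inv ≫ Φ.obj h ◁ η) ▷ Ψ.obj h ≫ D, ?_⟩
  intro c g q
  let Q (a) : g ≫ σ.obj a ⟶ M.hom a c := restrictApp q a
  have hQA (a) : Φ.act h (r c) q ▷ σ.obj a ≫ A a = (α_ _ _ _).hom ≫ Φ.obj (r c) ◁ Q a ≫ ω a c :=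
    congrArg (fun p => restrictApp p a) (Φ.precompose_act_toRes r h (r c) q)
  have hQC (a) : Q a ▷ Ψ.obj (r a) ≫ ζ a c = (α_ _ _ _).hom ≫ g ◁
      Ψ.act (r a) h (ofRepresentable σ a) ≫ Ψ.act h (r c) q := by
    rw [← Iso.inv_comp_eq]
    exact (Ψ.act_ofRepresentable (r a) h (r c) q).symm
  have hTC (a) : (α_ (σ.obj a) (σ'.obj a) (Ψ.obj h)).hom ≫
      σ.obj a ◁ C a ≫ Ψ.act (r a) h (ofRepresentable σ a) =
      E.leg a ▷ Ψ.obj h ≫ Ψ.act h h T := by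
    rw [Ψ.act_comp, Iso.hom_inv_id_assoc, Ψ.whiskerRight_act, hT]
  -- After acting by `q`, all the legs of `W` occurring in `D` are moved by the wedge condition to
  -- the single leg at `c`; what remains on the side of `Ψ` is the action of `T`, which `η` will
  -- cancel.
  have key : Φ.act h (r c) q ▷ E.pt ▷ Ψ.obj h ≫ D =
      𝟙 _ ⊗≫ Φ.obj (r c) ◁ (g ◁ Ψ.act h h T ≫ Ψ.act h (r c) q) ≫ W' c := by
    apply hE.whiskerLeft_whiskerRight_hom_ext
    intro a
    calc
      _ = (Φ.act h (r c) q ▷ (σ.obj a ≫ σ'.obj a)) ▷ Ψ.obj h ≫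
          (Φ.obj h ◁ E.leg a) ▷ Ψ.obj h ≫ D := by
        rw [← comp_whiskerRight_assoc, whisker_exchange, comp_whiskerRight_assoc]
      _ = 𝟙 _ ⊗≫ (Φ.act h (r c) q ▷ σ.obj a ≫ A a) ▷ (σ'.obj a ≫ Ψ.obj h) ⊗≫
          Φ.obj (r a) ◁ C a ≫ W' a := by
        rw [hD' a]; bicategory
      _ = 𝟙 _ ⊗≫ Φ.obj (r c) ◁ Q a ▷ (σ'.obj a ≫ Ψ.obj h) ⊗≫
          (ω a c ▷ (σ'.obj a ≫ Ψ.obj h) ≫ Φ.obj (r a) ◁ C a) ≫ W' a := by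
        rw [hQA]; bicategory
      _ = 𝟙 _ ⊗≫ Φ.obj (r c) ◁ Q a ▷ (σ'.obj a ≫ Ψ.obj h) ⊗≫
          (Φ.obj (r c) ≫ M.hom a c) ◁ C a ≫ (ω a c ▷ Ψ.obj (r a) ≫ W' a) := by
        rw [← whisker_exchange]; bicategory
      _ = 𝟙 _ ⊗≫ Φ.obj (r c) ◁ (Q a ▷ (σ'.obj a ≫ Ψ.obj h) ≫ M.hom a c ◁ C a) ⊗≫
          Φ.obj (r c) ◁ ζ a c ≫ W' c := by
        rw [← hW]; bicategory
      _ = 𝟙 _ ⊗≫ Φ.obj (r c) ◁ ((g ≫ σ.obj a) ◁ C a ⊗≫ (Q a ▷ Ψ.obj (r a) ≫ ζ a c)) ≫ W' c := by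
        rw [← whisker_exchange]; bicategory
      _ = 𝟙 _ ⊗≫ Φ.obj (r c) ◁ (g ◁ ((α_ (σ.obj a) (σ'.obj a) (Ψ.obj h)).hom ≫ σ.obj a ◁ C a ≫
          Ψ.act (r a) h (ofRepresentable σ a)) ≫ Ψ.act h (r c) q) ≫ W' c := by
        rw [hQC]; bicategory
      _ = _ := by
        rw [hTC]; bicategory
  have hηΨ : η ▷ Ψ.obj h ≫ Ψ.act h h T = (λ_ (Ψ.obj h)).hom := by
    rw [Ψ.whiskerRight_act, hη, Ψ.act_id]
  calc
    _ = 𝟙 _ ⊗≫ (Φ.act h (r c) q ▷ 𝟙 y ≫ Φ.obj h ◁ η) ▷ Ψ.obj h ≫ D := by bicategory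
    _ = 𝟙 _ ⊗≫ ((Φ.obj (r c) ≫ g) ◁ η) ▷ Ψ.obj h ≫ Φ.act h (r c) q ▷ E.pt ▷ Ψ.obj h ≫ D := by
      rw [← whisker_exchange]; bicategory
    _ = 𝟙 _ ⊗≫ Φ.obj (r c) ◁ (g ◁ (η ▷ Ψ.obj h ≫ Ψ.act h h T) ≫ Ψ.act h (r c) q) ≫ W' c := by
      rw [key]; bicategory
    _ = _ := by
      rw [hηΨ]; bicategory

end Density

end

/-! ### Coends and adjunctions of modules, restricted to representables; universal elements. -/

section

variable {P : ∀ ⦃y : B⦄, Presingleton M y → Sort*} {x x' : B}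

/-- A cowedge of a left module and a right module. -/
structure ModuleCowedge (Φ : RightModule P x) (Ψ : LeftModule P x') where
  pt : x ⟶ x'
  leg : ∀ {y : B} {σ : Presingleton M y} (h : P σ), Φ.obj h ≫ Ψ.obj h ⟶ pt
  wedge : ∀ {y z : B} {σ : Presingleton M y} {τ : Presingleton M z} (h : P σ) (k : P τ) {f : z ⟶ y}
    (p : σ.restrict f ⟶ τ),
    (α_ (Φ.obj k) f (Ψ.obj h)).hom ≫ Φ.obj k ◁ Ψ.act h k p ≫ leg k =
      Φ.act h k p ▷ Ψ.obj h ≫ leg h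

namespace ModuleCowedge

variable {Φ : RightModule P x} {Ψ : LeftModule P x'}

/-- A universal cowedge of modules. -/
def IsUniversal (U : ModuleCowedge Φ Ψ) : Prop :=
  ∀ W : ModuleCowedge Φ Ψ, ∃! k : U.pt ⟶ W.pt,
    ∀ {y : B} {σ : Presingleton M y} (h : P σ), U.leg h ≫ k = W.leg h

/-- The restriction of a cowedge of modules to the representable presingletons. -/
def res (U : ModuleCowedge Φ Ψ) (r : ∀ a, P (representable M a)) :
    Cowedge (Φ.res r) (Ψ.res r) where
  pt := U.pt
  leg a := U.leg (r a)
  wedge a b := U.wedge (r a) (r b) _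

/-- A universal cowedge of modules restricts to a universal cowedge over `M`, because singletons
are absolute colimits of representables. -/
theorem IsUniversal.res [ClosedBicategory B] {U : ModuleCowedge Φ Ψ} (hU : U.IsUniversal)
    (r : ∀ a, P (representable M a))
    (hP : ∀ {y : B} {σ : Presingleton M y}, P σ → σ.IsSingleton) : (U.res r).IsUniversal := by
  -- By density it suffices to precompose with `Φ(M(-, c)) σ'(c) ⟶ Φ(σ)`; the wedge condition then
  -- turns the leg at `σ` into the leg at `M(-, c)`.
  have huniq : ∀ {f : x ⟶ x'} (k l : U.pt ⟶ f), (∀ a, U.leg (r a) ≫ k = U.leg (r a) ≫ l) →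
      ∀ {y : B} {σ : Presingleton M y} (h : P σ), U.leg h ≫ k = U.leg h ≫ l := by
    intro f k l H y σ h
    obtain ⟨σ', e, adj⟩ := hP h
    apply Φ.hom_ext_of_isAdjunction r h adj
    intro c
    rw [← Category.assoc, ← U.wedge, Category.assoc, Category.assoc, H, ← Category.assoc,
      ← Category.assoc, Category.assoc _ (_ ◁ _), U.wedge, Category.assoc]
  intro W
  have hl : ∀ {y : B} {σ : Presingleton M y} (h : P σ), ∃ l : Φ.obj h ≫ Ψ.obj h ⟶ W.pt,
      ∀ (c : M.carrier) (g : M.type c ⟶ y) (q : σ.restrict g ⟶ representable M c),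
        Φ.act h (r c) q ▷ Ψ.obj h ≫ l =
          (α_ (Φ.obj (r c)) g (Ψ.obj h)).hom ≫ Φ.obj (r c) ◁ Ψ.act h (r c) q ≫ W.leg c := by
    intro y σ h
    obtain ⟨σ', e, adj⟩ := hP h
    exact W.exists_extension Φ Ψ r h adj
  let leg : ∀ {y : B} {σ : Presingleton M y} (h : P σ), Φ.obj h ≫ Ψ.obj h ⟶ W.pt :=
    fun h => (hl h).choose
  have hleg : ∀ {y : B} {σ : Presingleton M y} (h : P σ) (c : M.carrier) (g : M.type c ⟶ y)
      (q : σ.restrict g ⟶ representable M c), Φ.act h (r c) q ▷ Ψ.obj h ≫ leg h =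
          (α_ (Φ.obj (r c)) g (Ψ.obj h)).hom ≫ Φ.obj (r c) ◁ Ψ.act h (r c) q ≫ W.leg c :=
    fun h => (hl h).choose_spec
  -- The legs are chosen from an existence statement, so agreement with `W` at a representable has
  -- to be extracted from their defining property, taken at the identity morphism.
  have hrep : ∀ a, leg (r a) = W.leg a := by
    intro a
    have := hleg (r a) a (𝟙 _) (idHom _)
    rw [Φ.act_id, Ψ.act_id] at this
    exact (cancel_epi ((ρ_ (Φ.obj (r a))).hom ▷ Ψ.obj (r a))).1 (this.trans
      ((Category.assoc _ _ _).symm.trans (congrArg (· ≫ W.leg a) (triangle _ _))))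
  let W' : ModuleCowedge Φ Ψ :=
    { pt := W.pt
      leg := leg
      wedge := by
        intro y z σ τ h k f p
        obtain ⟨τ', e, adj⟩ := hP k
        rw [← cancel_epi (α_ _ _ _).inv, Iso.inv_hom_id_assoc]
        -- By density the wedge condition is tested at the counit components of `τ`. There both
        -- sides reduce to the leg at `c`, by the property of the legs for the counit and for its
        -- composite with `p`; this is why that property is asked for arbitrary morphisms into a
        -- representable.
        apply Φ.hom_ext_of_isAdjunction r k adj
        intro c
        have h1 := hleg k c _ (adj.counitHom c)
        have h2 := hleg h c _ (compHom p (adj.counitHom c))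
        have h3 := Φ.act_comp h k (r c) p (adj.counitHom c)
        have h4 := Ψ.act_comp h k (r c) p (adj.counitHom c)
        calc
          _ = 𝟙 _ ⊗≫ (Φ.obj (r c) ≫ τ'.obj c) ◁ Ψ.act h k p ⊗≫
              Φ.act k (r c) (adj.counitHom c) ▷ Ψ.obj k ≫ leg k := by
            rw [← whisker_exchange_assoc]; bicategory
          _ = 𝟙 _ ⊗≫ Φ.obj (r c) ◁ (τ'.obj c ◁ Ψ.act h k p ≫ Ψ.act k (r c) (adj.counitHom c)) ≫
              W.leg c := by
            rw [h1]; bicategory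
          _ = 𝟙 _ ⊗≫ (Φ.act h (r c) (compHom p (adj.counitHom c)) ▷ Ψ.obj h ≫ leg h) := by
            rw [h2, h4]; bicategory
          _ = 𝟙 _ ⊗≫ (Φ.act k (r c) (adj.counitHom c) ▷ f ≫ Φ.act h k p) ▷ Ψ.obj h ≫ leg h := by
            rw [h3]; bicategory
          _ = _ := by bicategory }
  obtain ⟨k, hk, hk'⟩ := hU W'
  refine ⟨k, fun a => (hk (r a)).trans (hrep a), fun l hl => hk' l ?_⟩
  intro y σ h
  rw [← hk h]
  apply huniq
  intro a
  exact (hl a).trans ((hk (r a)).trans (hrep a)).symm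

end ModuleCowedge

/-- An adjunction between modules, with counit `ν h k`, given as a morphism of presingletons
corresponding to a `2`-cell `Φ(σ) Ψ(τ) ⟶ S(σ, τ)`. -/
structure IsModuleAdjunction (Φ : RightModule P x) (Ψ : LeftModule P x)
    (ν : ∀ {y z : B} {σ : Presingleton M y} {τ : Presingleton M z} (h : P σ) (k : P τ),
      σ.restrict (Ψ.obj k ≫ Φ.obj h) ⟶ τ) : Prop where
  counit_left : ∀ {y y' z : B} {σ : Presingleton M y} {σ' : Presingleton M y'}
    {τ : Presingleton M z} (h : P σ) (h' : P σ') (k : P τ) {f : y ⟶ y'} (p : σ'.restrict f ⟶ σ),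
    compHom p (ν h k) =
      precompose ((α_ (Ψ.obj k) (Φ.obj h) f).hom ≫ Ψ.obj k ◁ Φ.act h' h p) (ν h' k)
  counit_right : ∀ {y z z' : B} {σ : Presingleton M y} {τ : Presingleton M z}
    {τ' : Presingleton M z'} (h : P σ) (k : P τ) (k' : P τ') {f : z' ⟶ z} (p : τ.restrict f ⟶ τ'),
    compHom (ν h k) p =
      precompose ((α_ f (Ψ.obj k) (Φ.obj h)).inv ≫ Ψ.act k k' p ▷ Φ.obj h) (ν h k')
  exists_unit : ∃ (U : ModuleCowedge Φ Ψ) (η : 𝟙 x ⟶ U.pt), U.IsUniversal ∧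
    (∀ {y : B} {σ : Presingleton M y} (h : P σ), ∃ T : U.pt ≫ Φ.obj h ⟶ Φ.obj h,
      (∀ {z : B} {τ : Presingleton M z} (k : P τ), U.leg k ▷ Φ.obj h ≫ T =
        (α_ (Φ.obj k) (Ψ.obj k) (Φ.obj h)).hom ≫ Φ.act h k (ν h k)) ∧
      (λ_ (Φ.obj h)).inv ≫ η ▷ Φ.obj h ≫ T = 𝟙 (Φ.obj h)) ∧
    (∀ {y : B} {σ : Presingleton M y} (h : P σ), ∃ T : Ψ.obj h ≫ U.pt ⟶ Ψ.obj h,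
      (∀ {z : B} {τ : Presingleton M z} (k : P τ), Ψ.obj h ◁ U.leg k ≫ T =
        (α_ (Ψ.obj h) (Φ.obj k) (Ψ.obj k)).inv ≫ Ψ.act k h (ν k h)) ∧
      (ρ_ (Ψ.obj h)).inv ≫ Ψ.obj h ◁ η ≫ T = 𝟙 (Ψ.obj h))

/-- An adjunction between modules restricts to an adjunction over `M`. -/
theorem IsModuleAdjunction.res [ClosedBicategory B] {Φ : RightModule P x} {Ψ : LeftModule P x}
    {ν : ∀ {y z : B} {σ : Presingleton M y} {τ : Presingleton M z} (h : P σ) (k : P τ),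
      σ.restrict (Ψ.obj k ≫ Φ.obj h) ⟶ τ} (adj : IsModuleAdjunction Φ Ψ ν)
    (r : ∀ a, P (representable M a))
    (hP : ∀ {y : B} {σ : Presingleton M y}, P σ → σ.IsSingleton) :
    IsAdjunction (Φ.res r) (Ψ.res r) (fun a b => yoneda (ν (r a) (r b))) := by
  -- By Yoneda the morphism `ν` and the `2`-cell into `M(a, b)` determine each other; all identities
  -- below are transported along this correspondence.
  have hν : ∀ a b, precompose (yoneda (ν (r a) (r b))) (ofRepresentable (representable M b) a) =
      ν (r a) (r b) := fun a b => precompose_yoneda _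
  refine ⟨fun a' a b => ?_, fun a b b' => ?_, ?_⟩
  · have h := adj.counit_left (r a) (r a') (r b) (ofRepresentable (representable M a) a')
    rw [ofRepresentable_compHom, ← hν a' b, ← comp_precompose] at h
    have h' := precompose_ofRepresentable_injective h
    rw [← hν a b] at h'
    exact h'.trans (Category.assoc _ _ _)
  · have h := adj.counit_right (r a) (r b) (r b') (ofRepresentable (representable M b') b)
    rw [← hν a b, ← hν a b', precompose_compHom, ofRepresentable_compHom, ← comp_precompose,
      ← comp_precompose] at h
    exact (precompose_ofRepresentable_injective h).trans (Category.assoc _ _ _)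
  · obtain ⟨U, η, hU, hT, hT'⟩ := adj.exists_unit
    refine ⟨U.res r, η, hU.res r hP, fun a => ?_, fun a => ?_⟩
    · obtain ⟨T, h1, h2⟩ := hT (r a)
      exact ⟨T, fun b => (h1 (r b)).trans (congrArg (_ ≫ ·)
        ((congrArg (Φ.act _ _) (hν a b).symm).trans (Φ.whiskerLeft_act _ _ _ _).symm)), h2⟩
    · obtain ⟨T, h1, h2⟩ := hT' (r a)
      exact ⟨T, fun b => (h1 (r b)).trans (congrArg (_ ≫ ·)
        ((congrArg (Ψ.act _ _) (hν b a).symm).trans (Ψ.whiskerRight_act _ _ _ _).symm)), h2⟩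

/-- If the restriction of a right module to the representables belongs to `P`, then the right
module is represented by this restriction. -/
theorem RightModule.exists_universal [ClosedBicategory B] (Φ : RightModule P x)
    (r : ∀ a, P (representable M a))
    (hP : ∀ {y : B} {σ : Presingleton M y}, P σ → σ.IsSingleton) (h₀ : P (Φ.res r)) :
    ∃ i : 𝟙 x ⟶ Φ.obj h₀, ∀ {y : B} {σ : Presingleton M y} (h : P σ),
      (∀ {f : x ⟶ y} (p : σ.restrict f ⟶ Φ.res r),
        precompose ((λ_ f).inv ≫ i ▷ f ≫ Φ.act h h₀ p) (Φ.toRes r h) = p) ∧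
      (λ_ (Φ.obj h)).inv ≫ i ▷ Φ.obj h ≫ Φ.act h h₀ (Φ.toRes r h) = 𝟙 (Φ.obj h) := by
  obtain ⟨ω', e, adj⟩ := hP h₀
  obtain ⟨E, η, T, hE, hT, hη, -⟩ := adj.exists_unitHom
  -- The universal element is `η ≫ m`, where `m` maps the coend of `ω'(a) ω(a)` to `Φ(ω)`. Since
  -- `ω(a)` is `Φ(M(-, a))`, its legs are available as the action of `Φ` on the counit components `ω
  -- ω'(a) ⟶ M(-, a)`.
  obtain ⟨m, hm⟩ : ∃ m : E.pt ⟶ Φ.obj h₀, ∀ a, E.leg a ≫ m = Φ.act h₀ (r a) (adj.counitHom a) :=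
    (hE ⟨Φ.obj h₀, fun a => Φ.act h₀ (r a) (adj.counitHom a), fun a b => by
    have h1 : Φ.act (r a) (r b) (ofRepresentable (representable M b) a) ▷ ω'.obj a ≫
        Φ.act h₀ (r a) (adj.counitHom a) = (α_ _ _ _).hom ≫ Φ.obj (r b) ◁ ω'.act a b ≫
          Φ.act h₀ (r b) (adj.counitHom b) := by
      rw [Φ.whiskerLeft_act, ← adj.counitHom_compHom]
      exact Φ.act_comp _ _ _ _ _
    exact h1.symm⟩).exists
  have hmT : precompose m (Φ.toRes r h₀) = T := by
    apply restrictHom_ext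
    intro a
    apply hE.map_hom_ext (postcomp x ((Φ.res r).obj a))
    intro b
    have h1 : precompose (E.leg b) (precompose m (Φ.toRes r h₀)) = precompose (E.leg b) T := by
      rw [← comp_precompose, hm b, hT]
      exact Φ.precompose_act_toRes r h₀ (r b) (adj.counitHom b)
    exact congrArg (fun p => restrictApp p a) h1
  -- The element corresponds to the identity of `ω`, by the first triangle identity; this is the
  -- Yoneda-type normalization from which both claims follow.
  have hi : precompose (η ≫ m) (Φ.toRes r h₀) = idHom (Φ.res r) := by
    rw [comp_precompose, hmT, hη]
  have hi' : ∀ c, (η ≫ m) ▷ Φ.obj (r c) ≫ Φ.act (r c) h₀ (Φ.toRes r (r c)) =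
      (λ_ (Φ.obj (r c))).hom :=
    fun c => congrArg (fun p => restrictApp p c) hi
  refine ⟨η ≫ m, fun {y σ} h => ⟨fun {f} p => ?_, ?_⟩⟩
  · rw [comp_precompose, comp_precompose, precompose_act_toRes, ← compHom_precompose, hi,
      compHom_idHom, ← comp_precompose, Iso.inv_hom_id, id_precompose]
  · obtain ⟨σ', e', adj'⟩ := hP h
    -- By density the second identity need only be checked on representables, where it is a
    -- component of `hi`.
    rw [← cancel_epi (ρ_ (Φ.obj h)).hom]
    apply Φ.hom_ext_of_isAdjunction r h adj'
    intro c
    have h1 := Φ.act_comp h (r c) h₀ (adj'.counitHom c) (Φ.toRes r (r c))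
    rw [← precompose_act_toRes, ← Φ.whiskerLeft_act] at h1
    calc
      _ = (ρ_ _).hom ≫ (λ_ _).inv ≫ ((𝟙 x ◁ Φ.act h (r c) (adj'.counitHom c) ≫
          (η ≫ m) ▷ Φ.obj h) ≫ Φ.act h h₀ (Φ.toRes r h)) := by bicategory
      _ = 𝟙 _ ⊗≫ (η ≫ m) ▷ Φ.obj (r c) ▷ σ'.obj c ≫ ((α_ _ _ _).hom ≫
          Φ.obj h₀ ◁ Φ.act h (r c) (adj'.counitHom c) ≫ Φ.act h h₀ (Φ.toRes r h)) := by
        rw [whisker_exchange]; bicategory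
      _ = 𝟙 _ ⊗≫ ((η ≫ m) ▷ Φ.obj (r c) ≫ Φ.act (r c) h₀ (Φ.toRes r (r c))) ▷ σ'.obj c ⊗≫
          Φ.act h (r c) (adj'.counitHom c) := by
        rw [← h1]; bicategory
      _ = _ := by
        rw [hi']; bicategory

/-- The restriction is replaced by a variable `ω`, so that case analysis on membership of `ω` in an
indexed family remains possible. The comparison `toRes` then becomes existential data `A`, with the
naturality that is used later. -/
theorem RightModule.exists_universal_of_eq [ClosedBicategory B] (Φ : RightModule P x)
    (r : ∀ a, P (representable M a))
    (hP : ∀ {y : B} {σ : Presingleton M y}, P σ → σ.IsSingleton) {ω : Presingleton M x}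
    (hω : Φ.res r = ω) (h₀ : P ω) :
    ∃ (A : ∀ {y : B} {σ : Presingleton M y} (h : P σ), σ.restrict (Φ.obj h) ⟶ ω)
      (i : 𝟙 x ⟶ Φ.obj h₀),
      (∀ {y z : B} {σ : Presingleton M y} {τ : Presingleton M z} (h : P σ) (k : P τ) {f : z ⟶ y}
        (p : σ.restrict f ⟶ τ), precompose (Φ.act h k p) (A h) = compHom p (A k)) ∧
      ∀ {y : B} {σ : Presingleton M y} (h : P σ),
        (∀ {f : x ⟶ y} (p : σ.restrict f ⟶ ω),
          precompose ((λ_ f).inv ≫ i ▷ f ≫ Φ.act h h₀ p) (A h) = p) ∧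
        (λ_ (Φ.obj h)).inv ≫ i ▷ Φ.obj h ≫ Φ.act h h₀ (A h) = 𝟙 (Φ.obj h) := by
  subst hω
  obtain ⟨i, hi⟩ := Φ.exists_universal r hP h₀
  exact ⟨fun h => Φ.toRes r h, i, fun h k _ p => Φ.precompose_act_toRes r h k p, fun h => hi h⟩

end

/-! ### Presingletons over a `B`-category of singletons, viewed as modules. -/

section

/-- The fibres of a family of singletons. -/
inductive Fiber {C : Type*} (t : C → Singleton M) : ∀ ⦃y : B⦄, Presingleton M y → Type _
  | mk (c : C) : Fiber t (t c).val

theorem Fiber.isSingleton {C : Type*} {t : C → Singleton M} {y : B} {σ : Presingleton M y}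
    (h : Fiber t σ) : σ.IsSingleton := by
  cases h with
  | mk c => exact (t c).isSingleton

/-- A morphism of presingletons with invertible components is invertible. -/
def Presingleton.isoMk {x : B} {σ τ : Presingleton M x} (f : σ ⟶ τ)
    (g : ∀ a, τ.obj a ⟶ σ.obj a) (h : ∀ a, f.app a ≫ g a = 𝟙 _) (h' : ∀ a, g a ≫ f.app a = 𝟙 _) :
    σ ≅ τ where
  hom := f
  inv :=
    { app := g
      act_app := fun a b => by
        have h1 : f.app b ▷ M.hom a b ≫ τ.act a b ≫ g a = σ.act a b := by
          rw [← Category.assoc, ← f.act_app, Category.assoc, h, Category.comp_id]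
        rw [← h1, ← comp_whiskerRight_assoc, h', id_whiskerRight, Category.id_comp] }
  hom_inv_id := Presingleton.hom_ext h
  inv_hom_id := Presingleton.hom_ext h'

variable [ClosedBicategory B] [∀ x y : B, HasColimitsOfSize.{s, s} (x ⟶ y)]

namespace Singleton

theorem precompose_incl_ev (σ τ : Singleton M) {f : τ.type ⟶ σ.type}
    (p : σ.val.restrict f ⟶ τ.val) : precompose (σ.incl τ p) (σ.ev τ) = p :=
  σ.incl_ev τ p

theorem incl_precompose_ev (σ τ : Singleton M) {f : τ.type ⟶ σ.type} (k : f ⟶ σ.hom τ) :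
    σ.incl τ (precompose k (σ.ev τ)) = k :=
  (σ.eq_incl τ k).symm

theorem precompose_ev_injective (σ τ : Singleton M) {f : τ.type ⟶ σ.type} {k l : f ⟶ σ.hom τ}
    (h : precompose k (σ.ev τ) = precompose l (σ.ev τ)) : k = l := by
  rw [← σ.incl_precompose_ev τ k, h, σ.incl_precompose_ev τ l]

theorem comp_incl (σ τ : Singleton M) {f g : τ.type ⟶ σ.type} (β : g ⟶ f)
    (p : σ.val.restrict f ⟶ τ.val) : β ≫ σ.incl τ p = σ.incl τ (precompose β p) := by
  apply precompose_ev_injective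
  rw [comp_precompose, precompose_incl_ev, precompose_incl_ev]

theorem incl_ev_self (σ τ : Singleton M) : σ.incl τ (σ.ev τ) = 𝟙 _ := by
  apply precompose_ev_injective
  rw [precompose_incl_ev, id_precompose]

theorem precompose_comp_ev (σ τ υ : Singleton M) :
    precompose (comp σ τ υ) (σ.ev υ) = compHom (σ.ev τ) (τ.ev υ) :=
  precompose_incl_ev _ _ _

end Singleton

section Family

variable {C : Type*} {t : C → Singleton M} {x x' : B}

namespace Family

variable (Φ : Presingleton (M.singletons.full t) x)

/-- The components of a presingleton of a full subcategory of the `B`-category of singletons. -/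
def obj (c : C) : x ⟶ (t c).type :=
  Φ.obj c

/-- The action on a presingleton of a full subcategory of the `B`-category of singletons. -/
def act (c d : C) : obj Φ d ≫ (t c).hom (t d) ⟶ obj Φ c :=
  Φ.act c d

theorem act_refl (c : C) : obj Φ c ◁ (t c).incl (t c) (idHom (t c).val) ≫ act Φ c c =
    (ρ_ (obj Φ c)).hom :=
  Φ.act_refl c

theorem act_comp (c d e : C) : act Φ d e ▷ (t c).hom (t d) ≫ act Φ c d =
    (α_ (obj Φ e) ((t d).hom (t e)) ((t c).hom (t d))).hom ≫
      obj Φ e ◁ Singleton.comp (t c) (t d) (t e) ≫ act Φ c e :=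
  Φ.act_comp c d e

variable (Ψ : Precosingleton (M.singletons.full t) x)

/-- The components of a precosingleton of a full subcategory of the `B`-category of singletons. -/
def coobj (c : C) : (t c).type ⟶ x :=
  Ψ.obj c

/-- The action on a precosingleton of a full subcategory of the `B`-category of singletons. -/
def coact (c d : C) : (t c).hom (t d) ≫ coobj Ψ c ⟶ coobj Ψ d :=
  Ψ.act c d

theorem coact_refl (c : C) : (t c).incl (t c) (idHom (t c).val) ▷ coobj Ψ c ≫ coact Ψ c c =
    (λ_ (coobj Ψ c)).hom :=
  Ψ.act_refl c

theorem coact_comp (c d e : C) : (t d).hom (t e) ◁ coact Ψ c d ≫ coact Ψ d e =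
    (α_ ((t d).hom (t e)) ((t c).hom (t d)) (coobj Ψ c)).inv ≫
      Singleton.comp (t c) (t d) (t e) ▷ coobj Ψ c ≫ coact Ψ c e :=
  Ψ.act_comp c d e

/-- The components of the right module associated with a presingleton. -/
def fiberObj : ∀ {y : B} {σ : Presingleton M y}, Fiber t σ → (x ⟶ y)
  | _, _, .mk c => obj Φ c

/-- The action on the right module associated with a presingleton. -/
noncomputable def fiberAct : ∀ {y z : B} {σ : Presingleton M y} {τ : Presingleton M z}
    (h : Fiber t σ) (k : Fiber t τ) {f : z ⟶ y}, (σ.restrict f ⟶ τ) →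
      (fiberObj Φ k ≫ f ⟶ fiberObj Φ h)
  | _, _, _, _, .mk c, .mk d, _, p => obj Φ d ◁ (t c).incl (t d) p ≫ act Φ c d

/-- The components of the left module associated with a precosingleton. -/
def fiberCoobj : ∀ {y : B} {σ : Presingleton M y}, Fiber t σ → (y ⟶ x)
  | _, _, .mk c => coobj Ψ c

/-- The action on the left module associated with a precosingleton. -/
noncomputable def fiberCoact : ∀ {y z : B} {σ : Presingleton M y} {τ : Presingleton M z}
    (h : Fiber t σ) (k : Fiber t τ) {f : z ⟶ y}, (σ.restrict f ⟶ τ) →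
      (f ≫ fiberCoobj Ψ h ⟶ fiberCoobj Ψ k)
  | _, _, _, _, .mk c, .mk d, _, p => (t c).incl (t d) p ▷ coobj Ψ c ≫ coact Ψ c d

end Family

open Family

/-- A presingleton of a full subcategory of the `B`-category of singletons as a right module. -/
noncomputable def Presingleton.toModule (Φ : Presingleton (M.singletons.full t) x) :
    RightModule (Fiber t) x where
  obj := fiberObj Φ
  act := fiberAct Φ
  whiskerLeft_act := by
    rintro _ _ _ _ ⟨c⟩ ⟨d⟩ f g β p
    dsimp only [fiberObj, fiberAct, fiberCoobj, fiberCoact]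
    rw [← comp_incl, whiskerLeft_comp, Category.assoc]
  act_id := by
    rintro _ _ ⟨c⟩
    exact Family.act_refl Φ c
  act_comp := by
    rintro _ _ _ _ _ _ ⟨c⟩ ⟨d⟩ ⟨e⟩ f g p q
    dsimp only [fiberObj, fiberAct, fiberCoobj, fiberCoact]
    calc
      _ = 𝟙 _ ⊗≫ Family.obj Φ e ◁ (t d).incl (t e) q ▷ f ⊗≫ (Family.act Φ d e ▷ f ≫
          Family.obj Φ d ◁ (t c).incl (t d) p) ≫ Family.act Φ c d := by bicategory
      _ = 𝟙 _ ⊗≫ Family.obj Φ e ◁ ((t d).incl (t e) q ▷ f ≫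
          (t d).hom (t e) ◁ (t c).incl (t d) p) ⊗≫ (Family.act Φ d e ▷ (t c).hom (t d) ≫
            Family.act Φ c d) := by
        rw [← whisker_exchange]; bicategory
      _ = 𝟙 _ ⊗≫ Family.obj Φ e ◁ (g ◁ (t c).incl (t d) p ≫ (t d).incl (t e) q ▷ (t c).hom (t d) ≫
          Singleton.comp (t c) (t d) (t e)) ≫ Family.act Φ c e := by
        rw [← whisker_exchange, Family.act_comp]; bicategory
      _ = _ := by
        rw [incl_comp]; bicategory

/-- A precosingleton of a full subcategory of the `B`-category of singletons as a left module. -/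
noncomputable def Precosingleton.toModule (Ψ : Precosingleton (M.singletons.full t) x) :
    LeftModule (Fiber t) x where
  obj := fiberCoobj Ψ
  act := fiberCoact Ψ
  whiskerRight_act := by
    rintro _ _ _ _ ⟨c⟩ ⟨d⟩ f g β p
    dsimp only [fiberObj, fiberAct, fiberCoobj, fiberCoact]
    rw [← comp_incl, comp_whiskerRight, Category.assoc]
  act_id := by
    rintro _ _ ⟨c⟩
    exact coact_refl Ψ c
  act_comp := by
    rintro _ _ _ _ _ _ ⟨c⟩ ⟨d⟩ ⟨e⟩ f g p q
    dsimp only [fiberObj, fiberAct, fiberCoobj, fiberCoact]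
    calc
      _ = 𝟙 _ ⊗≫ g ◁ (t c).incl (t d) p ▷ coobj Ψ c ⊗≫ (g ◁ coact Ψ c d ≫
          (t d).incl (t e) q ▷ coobj Ψ d) ≫ coact Ψ d e := by bicategory
      _ = 𝟙 _ ⊗≫ (g ◁ (t c).incl (t d) p ≫ (t d).incl (t e) q ▷ (t c).hom (t d)) ▷ coobj Ψ c ⊗≫
          ((t d).hom (t e) ◁ coact Ψ c d ≫ coact Ψ d e) := by
        rw [whisker_exchange]; bicategory
      _ = 𝟙 _ ⊗≫ (g ◁ (t c).incl (t d) p ≫ (t d).incl (t e) q ▷ (t c).hom (t d) ≫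
          Singleton.comp (t c) (t d) (t e)) ▷ coobj Ψ c ≫ coact Ψ c e := by
        rw [coact_comp]; bicategory
      _ = _ := by
        rw [incl_comp]; bicategory

/-- The original action is recovered because the inclusion belonging to the evaluation is the
identity. -/
theorem Presingleton.toModule_act_ev (Φ : Presingleton (M.singletons.full t) x) (c d : C) :
    Φ.toModule.act (Fiber.mk c) (Fiber.mk d) ((t c).ev (t d)) = Family.act Φ c d := by
  change Family.obj Φ d ◁ (t c).incl (t d) ((t c).ev (t d)) ≫ Family.act Φ c d = _
  rw [incl_ev_self, whiskerLeft_id, Category.id_comp]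

/-- A presingleton of a full subcategory of the `B`-category of singletons is representable if its
restriction to the representable presingletons belongs to this subcategory. -/
theorem Presingleton.isRepresentable_of_fiber (Φ : Presingleton (M.singletons.full t) x)
    (r : ∀ a, Fiber t (representable M a)) {ω : Presingleton M x} (hω : Φ.toModule.res r = ω)
    (h₀ : Fiber t ω) : Φ.IsRepresentable := by
  -- This identifies `x` with the type of `c₀` definitionally, so no transport occurs in the final
  -- isomorphism.
  cases h₀ with
  | mk c₀ =>
    obtain ⟨A, i, hA, hi⟩ := Φ.toModule.exists_universal_of_eq r Fiber.isSingleton hω (Fiber.mk c₀)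
    let A' (c : C) : (t c).val.restrict (Family.obj Φ c) ⟶ (t c₀).val := A (Fiber.mk c)
    let i' : 𝟙 _ ⟶ Family.obj Φ c₀ := i
    -- `k` classifies the comparison morphism to `ω`, while `l` acts on the universal element; the
    -- two parts of `hi` make them mutually inverse.
    let k (c : C) : Family.obj Φ c ⟶ (t c).hom (t c₀) := (t c).incl (t c₀) (A' c)
    let l (c : C) : (t c).hom (t c₀) ⟶ Family.obj Φ c :=
      (λ_ _).inv ≫ i' ▷ (t c).hom (t c₀) ≫ Family.act Φ c c₀
    have hA' (c d : C) : precompose (Family.act Φ c d) (A' c) =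
        compHom ((t c).ev (t d)) (A' d) :=
      (congrArg (precompose · (A' c)) (Φ.toModule_act_ev c d).symm).trans (hA _ _ _)
    have hlA (c : C) : precompose (l c) (A' c) = (t c).ev (t c₀) :=
      (congrArg (fun β => precompose ((λ_ _).inv ≫ i' ▷ (t c).hom (t c₀) ≫ β) (A' c))
        (Φ.toModule_act_ev c c₀).symm).trans ((hi (Fiber.mk c)).1 _)
    have hkl (c : C) : k c ≫ l c = 𝟙 _ := by
      have h1 : (λ_ _).inv ≫ i' ▷ Family.obj Φ c ≫ Family.obj Φ c₀ ◁ k c ≫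
          Family.act Φ c c₀ = 𝟙 _ := (hi (Fiber.mk c)).2
      rw [← h1, ← whisker_exchange_assoc]
      simp [l]
    have hlk (c : C) : l c ≫ k c = 𝟙 _ :=
      (comp_incl _ _ _ _).trans ((congrArg _ (hlA c)).trans (incl_ev_self _ _))
    have hk (c d : C) : Family.act Φ c d ≫ k c =
        k d ▷ (t c).hom (t d) ≫ Singleton.comp (t c) (t d) (t c₀) := by
      have h1 := incl_comp (t c) (t d) (t c₀) ((t c).ev (t d)) (A' d)
      rw [incl_ev_self, whiskerLeft_id, Category.id_comp] at h1
      exact (comp_incl _ _ _ _).trans ((congrArg _ (hA' c d)).trans h1.symm)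
    let K : Φ ⟶ representable (M.singletons.full t) c₀ := ⟨k, hk⟩
    exact ⟨c₀, rfl, ⟨Presingleton.isoMk K l hkl hlk⟩⟩

variable {Φ : Presingleton (M.singletons.full t) x} {Ψ : Precosingleton (M.singletons.full t) x}

/-- The counit of an adjunction over a full subcategory of the `B`-category of singletons, as a
family of morphisms of presingletons. -/
noncomputable def Family.counit
    (e : ∀ c d : C, Ψ.obj d ≫ Φ.obj c ⟶ (M.singletons.full t).hom c d) :
    ∀ {y z : B} {σ : Presingleton M y} {τ : Presingleton M z} (h : Fiber t σ) (k : Fiber t τ),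
      σ.restrict (Ψ.toModule.obj k ≫ Φ.toModule.obj h) ⟶ τ
  | _, _, _, _, .mk c, .mk d => precompose (e c d) ((t c).ev (t d))

/-- Every `p : σ f ⟶ τ` is the evaluation precomposed with the inclusion of `p`. The conditions for
arbitrary `p` therefore reduce, by exchange, to those for the evaluations, which are the conditions
over the `B`-category of singletons. -/
theorem IsAdjunction.toModule {e : ∀ c d : C, Ψ.obj d ≫ Φ.obj c ⟶ (M.singletons.full t).hom c d}
    (adj : IsAdjunction Φ Ψ e) :
    IsModuleAdjunction Φ.toModule Ψ.toModule (Family.counit e) := by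
  let e' (c d : C) : coobj Ψ d ≫ Family.obj Φ c ⟶ (t c).hom (t d) := e c d
  have hl (c' c d : C) : e' c d ▷ (t c').hom (t c) ≫ Singleton.comp (t c') (t c) (t d) =
      (α_ _ _ _).hom ≫ coobj Ψ d ◁ Family.act Φ c' c ≫ e' c' d := adj.counit_left c' c d
  have hr (c d d' : C) : (t d).hom (t d') ◁ e' c d ≫ Singleton.comp (t c) (t d) (t d') =
      (α_ _ _ _).inv ≫ coact Ψ d d' ▷ Family.obj Φ c ≫ e' c d' := adj.counit_right c d d'
  refine ⟨?_, ?_, ?_⟩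
  · rintro _ _ _ _ _ _ ⟨c⟩ ⟨c'⟩ ⟨d⟩ f p
    change compHom p (precompose (e' c d) ((t c).ev (t d))) =
      precompose ((α_ (coobj Ψ d) (Family.obj Φ c) f).hom ≫
        coobj Ψ d ◁ (Family.obj Φ c ◁ (t c').incl (t c) p ≫ Family.act Φ c' c))
        (precompose (e' c' d) ((t c').ev (t d)))
    have h1 : compHom p ((t c).ev (t d)) =
        precompose ((t c).hom (t d) ◁ (t c').incl (t c) p ≫ Singleton.comp (t c') (t c) (t d))
          ((t c').ev (t d)) := by
      rw [comp_precompose, precompose_comp_ev, ← precompose_compHom, precompose_incl_ev]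
    rw [compHom_precompose, h1, ← comp_precompose, ← comp_precompose]
    congr 1
    rw [← whisker_exchange_assoc, hl]
    simp
  · rintro _ _ _ _ _ _ ⟨c⟩ ⟨d⟩ ⟨d'⟩ f p
    change compHom (precompose (e' c d) ((t c).ev (t d))) p =
      precompose ((α_ f (coobj Ψ d) (Family.obj Φ c)).inv ≫
        ((t d).incl (t d') p ▷ coobj Ψ d ≫ coact Ψ d d') ▷ Family.obj Φ c)
        (precompose (e' c d') ((t c).ev (t d')))
    have h1 : compHom ((t c).ev (t d)) p =
        precompose ((t d).incl (t d') p ▷ (t c).hom (t d) ≫ Singleton.comp (t c) (t d) (t d'))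
          ((t c).ev (t d')) := by
      rw [comp_precompose, precompose_comp_ev, ← compHom_precompose, precompose_incl_ev]
    rw [precompose_compHom, h1, ← comp_precompose, ← comp_precompose]
    congr 1
    rw [whisker_exchange_assoc, hr]
    simp
  · obtain ⟨E, η, hE, hT, hT'⟩ := adj.exists_unit
    let leg (c : C) : Family.obj Φ c ≫ coobj Ψ c ⟶ E.pt := E.leg c
    have hw (c d : C) : (α_ (Family.obj Φ d) ((t c).hom (t d)) (coobj Ψ c)).hom ≫
        Family.obj Φ d ◁ coact Ψ c d ≫ leg d = Family.act Φ c d ▷ coobj Ψ c ≫ leg c :=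
      E.wedge c d
    let U : ModuleCowedge Φ.toModule Ψ.toModule :=
      { pt := E.pt
        leg := fun
          | .mk c => leg c
        wedge := by
          rintro _ _ _ _ ⟨c⟩ ⟨d⟩ f p
          change (α_ (Family.obj Φ d) f (coobj Ψ c)).hom ≫
            Family.obj Φ d ◁ ((t c).incl (t d) p ▷ coobj Ψ c ≫ coact Ψ c d) ≫ leg d =
              (Family.obj Φ d ◁ (t c).incl (t d) p ≫ Family.act Φ c d) ▷ coobj Ψ c ≫ leg c
          rw [comp_whiskerRight, Category.assoc, ← hw]
          simp }
    refine ⟨U, η, ?_, ?_, ?_⟩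
    · intro W
      obtain ⟨k, hk, hk'⟩ := hE ⟨W.pt, fun c => W.leg (Fiber.mk c), fun c d => by
        let W' (c : C) : Family.obj Φ c ≫ coobj Ψ c ⟶ W.pt := W.leg (Fiber.mk c)
        have h1 : (α_ (Family.obj Φ d) ((t c).hom (t d)) (coobj Ψ c)).hom ≫ Family.obj Φ d ◁
            ((t c).incl (t d) ((t c).ev (t d)) ▷ coobj Ψ c ≫ coact Ψ c d) ≫ W' d =
            (Family.obj Φ d ◁ (t c).incl (t d) ((t c).ev (t d)) ≫ Family.act Φ c d) ▷
              coobj Ψ c ≫ W' c := W.wedge (Fiber.mk c) (Fiber.mk d) ((t c).ev (t d))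
        rw [incl_ev_self, whiskerLeft_id, id_whiskerRight, Category.id_comp,
          Category.id_comp] at h1
        exact h1⟩
      refine ⟨k, ?_, fun l hl => hk' l fun c => hl (Fiber.mk c)⟩
      rintro _ _ ⟨c⟩
      exact hk c
    · rintro _ _ ⟨c⟩
      obtain ⟨T, h1, h2⟩ := hT c
      refine ⟨T, ?_, h2⟩
      rintro _ _ ⟨d⟩
      refine (h1 d).trans (congrArg (_ ≫ ·) ?_)
      change Family.obj Φ d ◁ e' c d ≫ Family.act Φ c d =
        Family.obj Φ d ◁ (t c).incl (t d) (precompose (e' c d) ((t c).ev (t d))) ≫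
          Family.act Φ c d
      rw [incl_precompose_ev]
    · rintro _ _ ⟨c⟩
      obtain ⟨T, h1, h2⟩ := hT' c
      refine ⟨T, ?_, h2⟩
      rintro _ _ ⟨d⟩
      refine (h1 d).trans (congrArg (_ ≫ ·) ?_)
      change e' d c ▷ coobj Ψ d ≫ coact Ψ d c =
        (t d).incl (t c) (precompose (e' d c) ((t d).ev (t c))) ▷ coobj Ψ d ≫ coact Ψ d c
      rw [incl_precompose_ev]

end Family

end

/-! ### Representables are (symmetric) singletons; completeness. -/

section

/-- The representable precosingleton `M(a, -)`. -/
def Precosingleton.corepresentable (M : EnrichedCat.{s} B) (a : M.carrier) :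
    Precosingleton M (M.type a) where
  obj b := M.hom a b
  act b c := M.comp a b c
  act_refl b := M.comp_refl a b
  act_comp b c d := by
    rw [← M.assoc, Iso.inv_hom_id_assoc]

/-- By the co-Yoneda lemma the coend of `M(a, b) M(b, a)` over `b` is `M(a, a)`, with the
compositions as legs. With the unit of `M` at `a` as `η` and composition as counit, the triangle
identities are the unit laws. -/
theorem isAdjunction_representable (M : EnrichedCat.{s} B) (a : M.carrier) :
    IsAdjunction (representable M a) (Precosingleton.corepresentable M a)
      (fun b c => M.comp b a c) := by
  refine ⟨fun b' b c => (M.assoc b' b a c).symm,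
    fun b c c' => ?_, ?_⟩
  · change M.hom c c' ◁ M.comp b a c ≫ M.comp b c c' =
      (α_ _ _ _).inv ≫ M.comp a c c' ▷ M.hom b a ≫ M.comp b a c'
    rw [← M.assoc, Iso.inv_hom_id_assoc]
  · let E : Cowedge (representable M a) (Precosingleton.corepresentable M a) :=
      ⟨M.hom a a, fun b => M.comp a b a, fun b c => M.assoc a b c a⟩
    refine ⟨E, M.refl a, ?_, fun b => ?_, fun b => ?_⟩
    · intro W
      let leg (b) : M.hom b a ≫ M.hom a b ⟶ W.pt := W.leg b
      have hw (b c) : (α_ (M.hom c a) (M.hom b c) (M.hom a b)).hom ≫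
          M.hom c a ◁ M.comp a b c ≫ leg c = M.comp b c a ▷ M.hom a b ≫ leg b := W.wedge b c
      -- The map out of `M(a, a)` inserts the unit at `a` and applies the leg at `a`.
      refine ⟨(ρ_ (M.hom a a)).inv ≫ M.hom a a ◁ M.refl a ≫ leg a, fun b => ?_, fun k hk => ?_⟩
      · change M.comp a b a ≫ (ρ_ (M.hom a a)).inv ≫ M.hom a a ◁ M.refl a ≫ leg a = leg b
        calc
          _ = 𝟙 _ ⊗≫ (M.comp a b a ▷ 𝟙 _ ≫ M.hom a a ◁ M.refl a) ≫ leg a := by bicategory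
          _ = 𝟙 _ ⊗≫ (M.hom b a ≫ M.hom a b) ◁ M.refl a ⊗≫
              (M.comp a b a ▷ M.hom a a ≫ leg a) := by
            rw [← whisker_exchange]; bicategory
          _ = 𝟙 _ ⊗≫ M.hom b a ◁ (M.hom a b ◁ M.refl a ≫ M.comp a a b) ≫ leg b := by
            rw [← hw]; bicategory
          _ = _ := by rw [M.refl_comp]; bicategory
      · have h : M.comp a a a ≫ k = leg a := hk a
        change k = _
        rw [← h, ← Category.assoc (M.hom a a ◁ M.refl a), M.refl_comp, Iso.inv_hom_id_assoc]
    · refine ⟨M.comp b a a, fun c => (M.assoc b a c a).symm, ?_⟩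
      change (λ_ (M.hom b a)).inv ≫ M.refl a ▷ M.hom b a ≫ M.comp b a a = 𝟙 (M.hom b a)
      rw [M.comp_refl, Iso.inv_hom_id]
    · refine ⟨M.comp a a b, fun c => ?_, ?_⟩
      · change M.hom a b ◁ M.comp a c a ≫ M.comp a a b = (α_ (M.hom a b) (M.hom c a)
          (M.hom a c)).inv ≫ M.comp c a b ▷ M.hom a c ≫ M.comp a c b
        rw [← M.assoc, Iso.inv_hom_id_assoc]
      · change (ρ_ (M.hom a b)).inv ≫ M.hom a b ◁ M.refl a ≫ M.comp a a b = 𝟙 (M.hom a b)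
        rw [M.refl_comp, Iso.inv_hom_id]

/-- A right adjoint may be replaced with an isomorphic precosingleton. -/
theorem IsAdjunction.of_iso {x : B} {σ : Presingleton M x} {τ τ' : Precosingleton M x}
    {e : ∀ a b : M.carrier, τ.obj b ≫ σ.obj a ⟶ M.hom a b} (adj : IsAdjunction σ τ e)
    (θ : ∀ a, τ.obj a ≅ τ'.obj a)
    (hθ : ∀ a b, τ.act a b ≫ (θ b).hom = M.hom a b ◁ (θ a).hom ≫ τ'.act a b) :
    IsAdjunction σ τ' (fun a b => (θ b).inv ▷ σ.obj a ≫ e a b) := by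
  have hθ' (a b) : τ'.act a b ≫ (θ b).inv = M.hom a b ◁ (θ a).inv ≫ τ.act a b := by
    rw [← cancel_mono (θ b).hom, Category.assoc, Category.assoc, hθ, Iso.inv_hom_id,
      ← whiskerLeft_comp_assoc, Iso.inv_hom_id]
    simp
  refine ⟨fun a' a b => ?_, fun a b b' => ?_, ?_⟩
  · rw [comp_whiskerRight, Category.assoc, adj.counit_left, whisker_exchange_assoc]
    simp
  · rw [whiskerLeft_comp, Category.assoc, adj.counit_right, ← comp_whiskerRight_assoc, hθ']
    simp
  · obtain ⟨E, η, hE, hT, hT'⟩ := adj.exists_unit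
    let E' : Cowedge σ τ' := ⟨E.pt, fun a => σ.obj a ◁ (θ a).inv ≫ E.leg a, fun a b => by
      rw [← whiskerLeft_comp_assoc, hθ', whiskerLeft_comp_assoc, ← whisker_exchange_assoc,
        ← E.wedge]
      simp⟩
    refine ⟨E', η, fun W => ?_, fun a => ?_, fun a => ?_⟩
    · obtain ⟨k, hk, hk'⟩ := hE ⟨W.pt, fun a => σ.obj a ◁ (θ a).hom ≫ W.leg a, fun a b => by
        rw [← whiskerLeft_comp_assoc, hθ, ← whisker_exchange_assoc, ← W.wedge]
        simp⟩
      refine ⟨k, fun a => ?_, fun l hl => hk' l fun a => ?_⟩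
      · change (σ.obj a ◁ (θ a).inv ≫ E.leg a) ≫ k = _
        rw [Category.assoc, hk, ← whiskerLeft_comp_assoc, Iso.inv_hom_id, whiskerLeft_id,
          Category.id_comp]
      · change _ = σ.obj a ◁ (θ a).hom ≫ W.leg a
        have h : (σ.obj a ◁ (θ a).inv ≫ E.leg a) ≫ l = W.leg a := hl a
        rw [← h, Category.assoc, ← whiskerLeft_comp_assoc, Iso.hom_inv_id, whiskerLeft_id,
          Category.id_comp]
    · obtain ⟨T, h1, h2⟩ := hT a
      refine ⟨T, fun b => ?_, h2⟩
      change (σ.obj b ◁ (θ b).inv ≫ E.leg b) ▷ σ.obj a ≫ T = _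
      rw [comp_whiskerRight_assoc, h1]
      simp
    · obtain ⟨T, h1, h2⟩ := hT' a
      refine ⟨(θ a).inv ▷ E.pt ≫ T ≫ (θ a).hom, fun b => ?_, ?_⟩
      · change τ'.obj a ◁ (σ.obj b ◁ (θ b).inv ≫ E.leg b) ≫ _ = _
        rw [whiskerLeft_comp_assoc, whisker_exchange_assoc, reassoc_of% (h1 b), hθ]
        calc
          _ = 𝟙 _ ⊗≫ (τ'.obj a ≫ σ.obj b) ◁ (θ b).inv ⊗≫ (θ a).inv ▷ σ.obj b ▷ τ.obj b ≫
              (e b a ▷ τ.obj b ≫ M.hom b a ◁ (θ b).hom) ≫ τ'.act b a := by bicategory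
          _ = 𝟙 _ ⊗≫ (τ'.obj a ≫ σ.obj b) ◁ (θ b).inv ≫ (((θ a).inv ▷ σ.obj b ≫ e b a) ▷ τ.obj b ≫
              M.hom b a ◁ (θ b).hom) ≫ τ'.act b a := by bicategory
          _ = 𝟙 _ ⊗≫ (τ'.obj a ≫ σ.obj b) ◁ ((θ b).inv ≫ (θ b).hom) ≫
              ((θ a).inv ▷ σ.obj b ≫ e b a) ▷ τ'.obj b ≫ τ'.act b a := by
            rw [← whisker_exchange]; bicategory
          _ = _ := by rw [Iso.inv_hom_id]; bicategory
      · change (ρ_ (τ'.obj a)).inv ≫ τ'.obj a ◁ η ≫ (θ a).inv ▷ E.pt ≫ T ≫ (θ a).hom = _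
        rw [whisker_exchange_assoc]
        calc
          _ = (θ a).inv ≫ ((ρ_ (τ.obj a)).inv ≫ τ.obj a ◁ η ≫ T) ≫ (θ a).hom := by simp
          _ = _ := by rw [h2]; simp

/-- The representable singletons. -/
def Singleton.representable (M : EnrichedCat.{s} B) (a : M.carrier) : Singleton M where
  type := M.type a
  val := Presingleton.representable M a
  isSingleton := ⟨_, _, isAdjunction_representable M a⟩

theorem EnrichedCat.isComplete_singletons [ClosedBicategory B]
    [∀ x y : B, HasColimitsOfSize.{s, s} (x ⟶ y)] (M : EnrichedCat.{s} B) :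
    M.singletons.IsComplete := by
  -- The full subcategory on the identity family is `M.singletons` by definition; this form fits the
  -- results on families of singletons.
  have key : (M.singletons.full id).IsComplete := by
    rintro x Φ ⟨Ψ, e, adj⟩
    let r (a : M.carrier) : Fiber (id : Singleton M → Singleton M) (Presingleton.representable M a) :=
      Fiber.mk (Singleton.representable M a)
    exact Φ.isRepresentable_of_fiber r rfl (Fiber.mk (t := id)
      ⟨x, Φ.toModule.res r, _, _, adj.toModule.res r Fiber.isSingleton⟩)
  exact key

section Symmetric

variable {I : Involution B} (S : SymmetricStructure I M)

theorem SymmetricStructure.invol_inv_map_iso_inv (a b : M.carrier) :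
    (I.invol (M.hom b a)).inv ≫ I.inv.map (S.iso a b).inv = (S.iso b a).hom := by
  have h := S.iso_iso b a
  rw [← Category.assoc, ← Iso.eq_comp_inv, Category.id_comp] at h
  rw [← h, Category.assoc, ← Functor.map_comp, Iso.hom_inv_id, CategoryTheory.Functor.map_id,
    Category.comp_id]

theorem isAdjunction_representable_involute (a : M.carrier) :
    IsAdjunction (Presingleton.representable M a) ((Presingleton.representable M a).involute S)
      (fun b c => (S.iso a c).inv ▷ M.hom b a ≫ M.comp b a c) :=
  (isAdjunction_representable M a).of_iso
    (τ' := (Presingleton.representable M a).involute S) (fun b => S.iso a b) fun b c => S.comp_iso a b c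

/-- The counit is the composition of `M` up to the symmetry isomorphism, so its invariance is the
compatibility of composition with the involution. -/
theorem isSymmetricCounit_representable (a : M.carrier) :
    IsSymmetricCounit S (Presingleton.representable M a)
      (fun b c => (S.iso a c).inv ▷ M.hom b a ≫ M.comp b a c) := by
  intro b c
  change (I.flip (M.hom c a) (M.hom b a)).hom ≫
    I.inv.map ((S.iso a b).inv ▷ M.hom c a ≫ M.comp c a b) =
      ((S.iso a c).inv ▷ M.hom b a ≫ M.comp b a c) ≫ (S.iso b c).hom
  have h := I.whiskerLeft_invComp_inv (S.iso a b).inv (M.hom c a)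
  rw [Category.assoc, S.comp_iso, ← whisker_exchange_assoc, ← comp_whiskerRight_assoc,
    Iso.inv_hom_id, id_whiskerRight, Category.id_comp, Functor.map_comp,
    ← S.invol_inv_map_iso_inv a b]
  simp only [Involution.flip, Iso.trans_hom, Iso.symm_hom, whiskerLeftIso_hom, Category.assoc,
    whiskerLeft_comp]
  rw [← reassoc_of% h]

/-- The representable symmetric singletons. -/
def SymSingleton.representable (a : M.carrier) : SymSingleton S where
  type := M.type a
  val := Presingleton.representable M a
  counit b c := (S.iso a c).inv ▷ M.hom b a ≫ M.comp b a c
  symmetric := isSymmetricCounit_representable S a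
  adjunction := isAdjunction_representable_involute S a

end Symmetric

end

/-! ### Canonical structures at representables; symmetric completeness. -/

section

variable {I : Involution B}

/-- Canonicity for the pair `M(-, a)`, `M(-, b)`, with `h`, `h'` in the role of the hom `1`-cells
and `k` in that of `κ`. Evaluating `H` at the units of `a` and `b` cancels the compositions and
leaves the compatibility of `k` with the symmetry of `M`. -/
theorem SymmetricStructure.iso_of_canonical (S : SymmetricStructure I M) {a b : M.carrier}
    (h : M.type b ⟶ M.type a) (h' : M.type a ⟶ M.type b) (ev : h ≫ M.hom a a ⟶ M.hom a b)
    (ev' : h' ≫ M.hom b b ⟶ M.hom b a) (k : h ⟶ I.inv.obj h')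
    (H : I.inv.obj (M.hom b b) ◁ ev ≫ (S.iso b b).inv ▷ M.hom a b ≫ M.comp a b b =
      (α_ _ _ _).inv ≫ (I.inv.obj (M.hom b b) ◁ k) ▷ M.hom a a ≫
        (I.invComp h' (M.hom b b)).inv ▷ M.hom a a ≫ I.inv.map ev' ▷ M.hom a a ≫
          (S.iso a b).inv ▷ M.hom a a ≫ M.comp a a b) :
    ((ρ_ h).inv ≫ h ◁ M.refl a ≫ ev) ≫ (S.iso a b).hom =
      k ≫ I.inv.map ((ρ_ h').inv ≫ h' ◁ M.refl b ≫ ev') := by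
  -- The unit law at `b` inserts the unit and the symmetry isomorphism, so that the left side of `H`
  -- appears.
  have h1 : (ρ_ h).inv ≫ h ◁ M.refl a ≫ ev =
      𝟙 _ ⊗≫ (M.refl b ≫ (S.iso b b).hom) ▷ h ⊗≫ (I.inv.obj (M.hom b b) ≫ h) ◁ M.refl a ⊗≫
        (I.inv.obj (M.hom b b) ◁ ev ≫ (S.iso b b).inv ▷ M.hom a b ≫ M.comp a b b) := by
    calc
      _ = (ρ_ h).inv ≫ h ◁ M.refl a ≫ ev ≫ (λ_ _).inv ≫ (M.refl b ▷ M.hom a b ≫ M.comp a b b) := by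
        rw [M.comp_refl, Iso.inv_hom_id, Category.comp_id]
      _ = (ρ_ h).inv ≫ h ◁ M.refl a ≫ ev ≫ (λ_ _).inv ≫ ((M.refl b ≫ (S.iso b b).hom) ▷ M.hom a b ≫
          (S.iso b b).inv ▷ M.hom a b ≫ M.comp a b b) := by
        simp
      _ = 𝟙 _ ⊗≫ h ◁ M.refl a ⊗≫ (𝟙 _ ◁ ev ≫ (M.refl b ≫ (S.iso b b).hom) ▷ M.hom a b) ≫
          (S.iso b b).inv ▷ M.hom a b ≫ M.comp a b b := by
        bicategory
      _ = 𝟙 _ ⊗≫ 𝟙 _ ◁ (h ◁ M.refl a) ⊗≫ (M.refl b ≫ (S.iso b b).hom) ▷ (h ≫ M.hom a a) ≫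
          I.inv.obj (M.hom b b) ◁ ev ≫ (S.iso b b).inv ▷ M.hom a b ≫ M.comp a b b := by
        rw [whisker_exchange]; bicategory
      _ = 𝟙 _ ⊗≫ (𝟙 _ ◁ (h ◁ M.refl a) ≫ (M.refl b ≫ (S.iso b b).hom) ▷ (h ≫ M.hom a a)) ≫
          I.inv.obj (M.hom b b) ◁ ev ≫ (S.iso b b).inv ▷ M.hom a b ≫ M.comp a b b := by
        bicategory
      _ = _ := by
        rw [whisker_exchange]; bicategory
  have h2 : I.inv.map ((ρ_ h').inv ≫ h' ◁ M.refl b ≫ ev') =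
      (λ_ _).inv ≫ (M.refl b ≫ (S.iso b b).hom) ▷ I.inv.obj h' ≫
        (I.invComp h' (M.hom b b)).inv ≫ I.inv.map ev' := by
    have h3 := I.whiskerRight_invComp_inv h' (M.refl b)
    have h4 : I.inv.map (ρ_ h').inv = (λ_ _).inv ≫ (I.invId _).inv ▷ I.inv.obj h' ≫
        (I.invComp h' (𝟙 _)).inv := by
      rw [← cancel_epi (I.inv.map (ρ_ h').hom), ← Functor.map_comp, I.map_rightUnitor]
      simp
    rw [S.refl_iso, comp_whiskerRight_assoc, reassoc_of% h3, Functor.map_comp, Functor.map_comp, h4]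
    simp
  -- The unit law at `a` evaluates the composition that remains on the right side of `H`.
  have h5 : (ρ_ _).inv ≫ I.inv.obj (M.hom b a) ◁ M.refl a ≫ (S.iso a b).inv ▷ M.hom a a ≫
      M.comp a a b = (S.iso a b).inv := by
    rw [whisker_exchange_assoc, M.refl_comp]
    simp
  rw [← Iso.eq_comp_inv, h1, H, Category.assoc, h2]
  conv_rhs => rw [← h5]
  calc
    _ = 𝟙 _ ⊗≫ ((M.refl b ≫ (S.iso b b).hom) ▷ h ≫ I.inv.obj (M.hom b b) ◁ k) ⊗≫
        (I.inv.obj (M.hom b b) ≫ I.inv.obj h') ◁ M.refl a ≫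
        (I.invComp h' (M.hom b b)).inv ▷ M.hom a a ≫ I.inv.map ev' ▷ M.hom a a ≫
          (S.iso a b).inv ▷ M.hom a a ≫ M.comp a a b := by
      have h6 : (I.inv.obj (M.hom b b) ≫ h) ◁ M.refl a ≫ (I.inv.obj (M.hom b b) ◁ k) ▷ M.hom a a =
        (I.inv.obj (M.hom b b) ◁ k) ▷ 𝟙 _ ≫ (I.inv.obj (M.hom b b) ≫ I.inv.obj h') ◁ M.refl a :=
        whisker_exchange _ _
      calc
        _ = 𝟙 _ ⊗≫ (M.refl b ≫ (S.iso b b).hom) ▷ h ⊗≫ ((I.inv.obj (M.hom b b) ≫ h) ◁ M.refl a ≫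
            (I.inv.obj (M.hom b b) ◁ k) ▷ M.hom a a) ≫
            (I.invComp h' (M.hom b b)).inv ▷ M.hom a a ≫ I.inv.map ev' ▷ M.hom a a ≫
              (S.iso a b).inv ▷ M.hom a a ≫ M.comp a a b := by bicategory
        _ = _ := by rw [h6]; bicategory
    _ = k ≫ 𝟙 _ ⊗≫ (M.refl b ≫ (S.iso b b).hom) ▷ I.inv.obj h' ⊗≫
        ((I.inv.obj (M.hom b b) ≫ I.inv.obj h') ◁ M.refl a ≫
        (I.invComp h' (M.hom b b)).inv ▷ M.hom a a) ≫ I.inv.map ev' ▷ M.hom a a ≫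
          (S.iso a b).inv ▷ M.hom a a ≫ M.comp a a b := by
      rw [← whisker_exchange]; bicategory
    _ = k ≫ 𝟙 _ ⊗≫ (M.refl b ≫ (S.iso b b).hom) ▷ I.inv.obj h' ≫
        (I.invComp h' (M.hom b b)).inv ⊗≫ (I.inv.obj (h' ≫ M.hom b b) ◁ M.refl a ≫
          I.inv.map ev' ▷ M.hom a a) ≫ (S.iso a b).inv ▷ M.hom a a ≫ M.comp a a b := by
      rw [whisker_exchange]; bicategory
    _ = _ := by
      rw [whisker_exchange]; bicategory

/-- Used to show that restricting the involute of a presingleton to the representables gives the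
involute of its restriction. The identity `2`-cells match the shape required by
`IsAdjunction.of_iso` for identity isomorphisms. -/
theorem SymmetricStructure.involute_act_of_comm (S : SymmetricStructure I M) {x : B}
    {a b : M.carrier} {f : x ⟶ M.type a} {g : x ⟶ M.type b} {h : M.type b ⟶ M.type a}
    {h' : M.type a ⟶ M.type b} (j : M.hom a b ⟶ h) (j' : M.hom b a ⟶ h') (k : h ⟶ I.inv.obj h')
    (A : f ≫ h' ⟶ g) (H : j ≫ k = (S.iso a b).hom ≫ I.inv.map j') :
    (j ▷ I.inv.obj f ≫ k ▷ I.inv.obj f ≫ (I.invComp f h').inv ≫ I.inv.map A) ≫ 𝟙 _ =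
      M.hom a b ◁ 𝟙 _ ≫ (S.iso a b).hom ▷ I.inv.obj f ≫
        (I.invComp f (M.hom b a)).inv ≫ I.inv.map (f ◁ j' ≫ A) := by
  have h1 := I.whiskerRight_invComp_inv f j'
  rw [Category.comp_id, whiskerLeft_id, Category.id_comp, ← comp_whiskerRight_assoc, H,
    comp_whiskerRight_assoc, reassoc_of% h1, Functor.map_comp]

variable [ClosedBicategory B] [∀ x y : B, HasColimitsOfSize.{s, s} (x ⟶ y)]

namespace Singleton

variable (M) in
/-- The `1`-cell `S(M(-, a), M(-, b))`. -/
noncomputable def representableHom (a b : M.carrier) : M.type b ⟶ M.type a :=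
  (Singleton.representable M a).hom (Singleton.representable M b)

/-- The `2`-cell `S(M(-, a), M(-, b)) ⟶ M(a, b)` given by the Yoneda lemma. -/
noncomputable def homRepresentable (a b : M.carrier) : representableHom M a b ⟶ M.hom a b :=
  (ρ_ _).inv ≫ _ ◁ M.refl a ≫ (Singleton.representable M a).evApp (Singleton.representable M b) a

/-- The `2`-cell `M(a, b) ⟶ S(M(-, a), M(-, b))` given by the Yoneda lemma. -/
noncomputable def inclRepresentable (a b : M.carrier) : M.hom a b ⟶ representableHom M a b :=
  (Singleton.representable M a).incl (Singleton.representable M b)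
    (ofRepresentable (Presingleton.representable M b) a)

theorem homRepresentable_incl (a b : M.carrier) :
    homRepresentable a b ≫ inclRepresentable a b = 𝟙 _ := by
  refine (comp_incl _ _ _ _).trans (Eq.trans ?_ (incl_ev_self _ _))
  exact congrArg _ (precompose_yoneda ((Singleton.representable M a).ev _))

theorem incl_homRepresentable (a b : M.carrier) :
    inclRepresentable a b ≫ homRepresentable a b = 𝟙 _ := by
  refine (yoneda_precompose (a := a) _ _).symm.trans ?_
  refine (congrArg (yoneda (a := a)) (precompose_incl_ev (Singleton.representable M a)
    (Singleton.representable M b) _)).trans ?_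
  exact yoneda_ofRepresentable a

end Singleton

variable {S : SymmetricStructure I M}

/-- The `2`-cells of a symmetric structure on the `B`-category of symmetric singletons, at a pair of
representables. -/
noncomputable def symIsoRepresentable (K : SymmetricStructure I (symSingletons S))
    (a b : M.carrier) : representableHom M a b ⟶ I.inv.obj (representableHom M b a) :=
  (K.iso (SymSingleton.representable S a) (SymSingleton.representable S b)).hom

theorem IsCanonical.homRepresentable_iso {K : SymmetricStructure I (symSingletons S)}
    (hK : IsCanonical K) (a b : M.carrier) : homRepresentable a b ≫ (S.iso a b).hom =
      symIsoRepresentable K a b ≫ I.inv.map (homRepresentable b a) :=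
  S.iso_of_canonical _ _ _ _ _
    (hK (SymSingleton.representable S a) (SymSingleton.representable S b) a b)

theorem IsCanonical.inclRepresentable_iso {K : SymmetricStructure I (symSingletons S)}
    (hK : IsCanonical K) (a b : M.carrier) : inclRepresentable a b ≫ symIsoRepresentable K a b =
      (S.iso a b).hom ≫ I.inv.map (inclRepresentable b a) := by
  calc
    _ = inclRepresentable a b ≫ symIsoRepresentable K a b ≫
        I.inv.map (homRepresentable b a ≫ inclRepresentable b a) := by
      rw [homRepresentable_incl]; simp
    _ = inclRepresentable a b ≫ (symIsoRepresentable K a b ≫ I.inv.map (homRepresentable b a)) ≫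
        I.inv.map (inclRepresentable b a) := by simp
    _ = (inclRepresentable a b ≫ homRepresentable a b) ≫ (S.iso a b).hom ≫
        I.inv.map (inclRepresentable b a) := by
      rw [← hK.homRepresentable_iso]; simp
    _ = _ := by rw [incl_homRepresentable, Category.id_comp]

/-- The restriction `ω` of a symmetric singleton has the restriction of the involute as right
adjoint, which canonicity identifies with `ω°`. By canonicity the restricted counit is symmetric
too, so `ω` is an element of the `B`-category of symmetric singletons and represents the given one.
-/
theorem IsCanonical.isSymmetricallyComplete {K : SymmetricStructure I (symSingletons S)}
    (hK : IsCanonical K) : K.IsSymmetricallyComplete := by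
  intro Φ
  let t : SymSingleton S → Singleton M := SymSingleton.toSingleton
  let y : M.carrier → SymSingleton S := SymSingleton.representable S
  let r (a : M.carrier) : Fiber t (Presingleton.representable M a) := Fiber.mk (y a)
  let φ : Presingleton (M.singletons.full t) Φ.type := Φ.val
  let ψ : Precosingleton (M.singletons.full t) Φ.type := Φ.val.involute K
  let ω : Presingleton M Φ.type := φ.toModule.res r
  have adj : IsAdjunction φ ψ Φ.counit := Φ.adjunction
  let f (a : M.carrier) : Φ.type ⟶ M.type a := Family.obj φ (y a)
  let A (a b : M.carrier) : f b ≫ representableHom M a b ⟶ f a := Family.act φ (y a) (y b)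
  let c (a b : M.carrier) : I.inv.obj (f b) ≫ f a ⟶ representableHom M a b :=
    Φ.counit (y a) (y b)
  have adjω := (adj.toModule.res r Fiber.isSingleton).of_iso (τ' := ω.involute S)
    (fun a => Iso.refl (I.inv.obj (f a))) fun a b =>
      S.involute_act_of_comm _ _ _ (A b a) (hK.inclRepresentable_iso a b)
  let e (a b : M.carrier) : I.inv.obj (ω.obj b) ≫ ω.obj a ⟶ M.hom a b :=
    c a b ≫ homRepresentable a b
  -- The counit produced by the general restriction is the Yoneda transpose of `c` followed by the
  -- evaluation, composed with an identity; naturality of Yoneda gives the explicit form `e`.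
  have he : IsAdjunction ω (ω.involute S) e := by
    refine Eq.mp (congrArg (IsAdjunction ω (ω.involute S)) (funext fun a => funext fun b => ?_)) adjω
    have h1 : ∀ z : I.inv.obj (f b) ≫ f a ⟶ M.hom a b, 𝟙 (I.inv.obj (f b)) ▷ f a ≫ z = z :=
      fun z => by simp
    exact (h1 _).trans (yoneda_precompose (a := a) (c a b) _)
  have hs : IsSymmetricCounit S ω e := by
    intro a b
    have h1 : (I.flip (f b) (f a)).hom ≫ I.inv.map (c b a) = c a b ≫ symIsoRepresentable K a b :=
      Φ.symmetric (y a) (y b)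
    change (I.flip (f b) (f a)).hom ≫ I.inv.map (c b a ≫ homRepresentable b a) =
      (c a b ≫ homRepresentable a b) ≫ (S.iso a b).hom
    rw [Functor.map_comp, reassoc_of% h1, Category.assoc, hK.homRepresentable_iso]
  exact φ.isRepresentable_of_fiber r rfl (Fiber.mk (t := t) ⟨Φ.type, ω, e, hs, he⟩)

end

/-! ### Transposition along an adjunction; coherence of the involution. -/

section

section Transpose

variable [ClosedBicategory B] {x : B} {σ : Presingleton M x} {σ' : Precosingleton M x}
  {e : ∀ a b : M.carrier, σ'.obj b ≫ σ.obj a ⟶ M.hom a b}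

/-- The first triangle identity recovers `m : g ⟶ σ(b)` from `η` and the pairings of `m` with the
counit. -/
theorem IsAdjunction.hom_ext (adj : IsAdjunction σ σ' e) {b : M.carrier} {g : x ⟶ M.type b}
    {k l : g ⟶ σ.obj b} (h : ∀ a, σ'.obj a ◁ k ≫ e b a = σ'.obj a ◁ l ≫ e b a) : k = l := by
  obtain ⟨E, η, hE, hT, -⟩ := adj.exists_unit
  obtain ⟨T, h1, h2⟩ := hT b
  have h3 (m : g ⟶ σ.obj b) : m = (λ_ g).inv ≫ η ▷ g ≫ E.pt ◁ m ≫ T := by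
    rw [← whisker_exchange_assoc]
    conv_lhs => rw [← Category.comp_id m, ← h2]
    simp
  have h4 (m : g ⟶ σ.obj b) (a) : E.leg a ▷ g ≫ E.pt ◁ m ≫ T =
      (α_ _ _ _).hom ≫ σ.obj a ◁ (σ'.obj a ◁ m ≫ e b a) ≫ σ.act b a := by
    rw [← whisker_exchange_assoc, h1]
    simp
  have h5 : E.pt ◁ k ≫ T = E.pt ◁ l ≫ T := by
    apply hE.map_hom_ext (postcomp x g)
    intro a
    exact (h4 k a).trans ((by rw [h]) : _ = _) |>.trans (h4 l a).symm
  rw [h3 k, h3 l, h5]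

/-- Morphisms `ρ ⟶ σ` into a left adjoint `σ ⊣ σ'` correspond to morphisms of distributors from
`ρ σ'` to `M`. -/
theorem IsAdjunction.exists_hom (adj : IsAdjunction σ σ' e) (ρ : Presingleton M x)
    (n : ∀ a b : M.carrier, σ'.obj a ≫ ρ.obj b ⟶ M.hom b a)
    (hl : ∀ a b' b : M.carrier, n a b ▷ M.hom b' b ≫ M.comp b' b a =
      (α_ _ _ _).hom ≫ σ'.obj a ◁ ρ.act b' b ≫ n a b')
    (hr : ∀ a a' b : M.carrier, M.hom a a' ◁ n a b ≫ M.comp b a a' =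
      (α_ _ _ _).inv ≫ σ'.act a a' ▷ ρ.obj b ≫ n a' b) :
    ∃ q : ∀ b, ρ.obj b ⟶ σ.obj b,
      (∀ a b, q b ▷ M.hom a b ≫ σ.act a b = ρ.act a b ≫ q a) ∧
      ∀ a b, σ'.obj a ◁ q b ≫ e b a = n a b := by
  obtain ⟨E, η, hE, hT, hT'⟩ := adj.exists_unit
  -- The transpose of `n` is `η` followed by `n` and the action of `σ`, where `R` is the part after
  -- `η`, defined on the legs of the coend.
  have hR : ∀ b, ∃ R : E.pt ≫ ρ.obj b ⟶ σ.obj b, ∀ a, E.leg a ▷ ρ.obj b ≫ R =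
      (α_ _ _ _).hom ≫ σ.obj a ◁ n a b ≫ σ.act b a := by
    intro b
    refine hE.whiskerRight_desc (fun a => (α_ _ _ _).hom ≫ σ.obj a ◁ n a b ≫ σ.act b a) ?_
    intro a a'
    have q1 : σ'.act a a' ▷ ρ.obj b ≫ n a' b =
        (α_ _ _ _).hom ≫ M.hom a a' ◁ n a b ≫ M.comp b a a' := by rw [hr]; simp
    have q2 := σ.act_comp b a a'
    calc
      _ = 𝟙 _ ⊗≫ σ.obj a' ◁ (σ'.act a a' ▷ ρ.obj b ≫ n a' b) ≫ σ.act b a' := by bicategory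
      _ = 𝟙 _ ⊗≫ (σ.obj a' ≫ M.hom a a') ◁ n a b ⊗≫ ((α_ _ _ _).hom ≫
          σ.obj a' ◁ M.comp b a a' ≫ σ.act b a') := by
        rw [q1]; bicategory
      _ = 𝟙 _ ⊗≫ ((σ.obj a' ≫ M.hom a a') ◁ n a b ≫ σ.act a a' ▷ M.hom b a) ≫ σ.act b a := by
        rw [← q2]; bicategory
      _ = _ := by rw [whisker_exchange]; bicategory
  choose R hR using hR
  -- Pairing with the counit moves it past `R`; the second triangle identity then removes `η` and
  -- leaves `n`.
  have hq : ∀ a b, σ'.obj a ◁ ((λ_ _).inv ≫ η ▷ ρ.obj b ≫ R b) ≫ e b a = n a b := by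
    intro c b
    obtain ⟨T, h1, h2⟩ := hT' c
    have key : (σ'.obj c ◁ R b) ≫ e b c = (α_ _ _ _).inv ≫ T ▷ ρ.obj b ≫ n c b := by
      rw [← cancel_epi (α_ _ _ _).hom, Iso.hom_inv_id_assoc]
      apply hE.whiskerLeft_whiskerRight_hom_ext
      intro a
      have q1 : σ'.obj c ◁ σ.act b a ≫ e b c = (α_ _ _ _).inv ≫ e a c ▷ M.hom b a ≫
          M.comp b a c := by rw [adj.counit_left, Iso.inv_hom_id_assoc]
      calc
        _ = 𝟙 _ ⊗≫ σ'.obj c ◁ (E.leg a ▷ ρ.obj b ≫ R b) ≫ e b c := by bicategory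
        _ = 𝟙 _ ⊗≫ σ'.obj c ◁ σ.obj a ◁ n a b ≫ (σ'.obj c ◁ σ.act b a ≫ e b c) := by
          rw [hR]; bicategory
        _ = 𝟙 _ ⊗≫ ((σ'.obj c ≫ σ.obj a) ◁ n a b ≫ e a c ▷ M.hom b a) ≫ M.comp b a c := by
          rw [q1]; bicategory
        _ = 𝟙 _ ⊗≫ e a c ▷ (σ'.obj a ≫ ρ.obj b) ≫ (M.hom a c ◁ n a b ≫ M.comp b a c) := by
          rw [whisker_exchange]; bicategory
        _ = ((α_ _ _ _).inv ≫ e a c ▷ σ'.obj a ≫ σ'.act a c) ▷ ρ.obj b ≫ n c b := by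
          rw [hr]; bicategory
        _ = _ := by
          rw [← h1, comp_whiskerRight, Category.assoc]
    calc
      _ = 𝟙 _ ⊗≫ σ'.obj c ◁ η ▷ ρ.obj b ≫ (σ'.obj c ◁ R b ≫ e b c) := by bicategory
      _ = ((ρ_ (σ'.obj c)).inv ≫ σ'.obj c ◁ η ≫ T) ▷ ρ.obj b ≫ n c b := by
        rw [key]; bicategory
      _ = _ := by rw [h2]; simp
  -- Linearity of the transpose is tested after pairing with the counit, where it becomes the
  -- hypothesis `hl`.
  refine ⟨fun b => (λ_ _).inv ≫ η ▷ ρ.obj b ≫ R b, fun a b => adj.hom_ext fun c => ?_, hq⟩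
  set q : ∀ b, ρ.obj b ⟶ σ.obj b := fun b => (λ_ _).inv ≫ η ▷ ρ.obj b ≫ R b
  have q1 : σ'.obj c ◁ σ.act a b ≫ e a c = (α_ _ _ _).inv ≫ e b c ▷ M.hom a b ≫
      M.comp a b c := by rw [adj.counit_left, Iso.inv_hom_id_assoc]
  have hqa : σ'.obj c ◁ q a ≫ e a c = n c a := hq c a
  have hqb : σ'.obj c ◁ q b ≫ e b c = n c b := hq c b
  change σ'.obj c ◁ (q b ▷ M.hom a b ≫ σ.act a b) ≫ e a c = σ'.obj c ◁ (ρ.act a b ≫ q a) ≫ e a c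
  calc
    _ = (α_ _ _ _).inv ≫ (σ'.obj c ◁ q b ≫ e b c) ▷ M.hom a b ≫ M.comp a b c := by
      rw [whiskerLeft_comp, Category.assoc, q1]; simp
    _ = σ'.obj c ◁ ρ.act a b ≫ n c a := by
      rw [hqb, hl, Iso.inv_hom_id_assoc]
    _ = _ := by rw [← hqa]; simp

end Transpose

namespace Involution

variable (I : Involution B)

theorem whiskerRight_flip {x y z : B} {f f' : x ⟶ y} (β : f ⟶ f') (g : x ⟶ z) :
    I.inv.map β ▷ g ≫ (I.flip f' g).hom = (I.flip f g).hom ≫ I.inv.map (I.inv.obj g ◁ β) := by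
  have h := I.whiskerRight_invComp_inv (I.inv.obj g) β
  simp only [flip, Iso.trans_hom, whiskerLeftIso_hom, Iso.symm_hom, Category.assoc]
  rw [← whisker_exchange_assoc, h]

theorem whiskerLeft_flip {x y z : B} (f : x ⟶ y) {g g' : x ⟶ z} (β : g ⟶ g') :
    I.inv.obj f ◁ β ≫ (I.flip f g').hom = (I.flip f g).hom ≫ I.inv.map (I.inv.map β ▷ f) := by
  have h := I.whiskerLeft_invComp_inv (I.inv.map β) f
  have h' : β ≫ (I.invol g').inv = (I.invol g).inv ≫ I.inv.map (I.inv.map β) := by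
    rw [Iso.comp_inv_eq, Category.assoc, I.invol_natural, Iso.inv_hom_id_assoc]
  simp only [flip, Iso.trans_hom, whiskerLeftIso_hom, Iso.symm_hom, Category.assoc]
  rw [← h, ← whiskerLeft_comp_assoc, h', whiskerLeft_comp_assoc]

theorem invol_comp_inv {x y z : B} (g : x ⟶ y) (t : y ⟶ z) :
    (I.invol g).hom ▷ t ≫ (I.invol (g ≫ t)).inv =
      I.inv.obj (I.inv.obj g) ◁ (I.invol t).inv ≫
        (I.invComp (I.inv.obj t) (I.inv.obj g)).inv ≫ I.inv.map (I.invComp g t).inv := by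
  rw [Iso.comp_inv_eq, I.invol_comp]
  simp only [Category.assoc]
  rw [← Functor.map_comp_assoc, Iso.inv_hom_id, CategoryTheory.Functor.map_id, Category.id_comp,
    Iso.inv_hom_id_assoc, whisker_exchange_assoc, ← whiskerLeft_comp, Iso.inv_hom_id]
  simp

/-- The coherence needed to apply the involution to the equation defining a mate: it relates the two
ways of reassociating a threefold composite and its double involute. -/
theorem flip_comp {x y z t : B} (s : x ⟶ t) (g : x ⟶ y) (h : y ⟶ z) :
    (α_ _ _ _).inv ≫ (I.invComp (I.inv.obj g) s).inv ▷ h ≫ (I.flip (I.inv.obj g ≫ s) h).hom ≫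
      I.inv.map ((α_ _ _ _).inv ≫ (I.invComp g h).inv ▷ s) =
      I.inv.obj s ◁ (I.invol g).hom ▷ h ≫ (I.flip s (g ≫ h)).hom := by
  have h1 := I.invComp_inv_map_associator_inv (I.inv.obj h) (I.inv.obj g) s
  have h2 := I.whiskerLeft_invComp_inv (I.invComp g h).inv s
  simp only [flip, Iso.trans_hom, whiskerLeftIso_hom, Iso.symm_hom, Category.assoc,
    Functor.map_comp]
  rw [← whisker_exchange_assoc, reassoc_of% h1, ← h2]
  have h3 := I.invol_comp_inv g h
  have h4 : I.inv.obj s ◁ (I.invol g).hom ▷ h ≫ I.inv.obj s ◁ (I.invol (g ≫ h)).inv =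
      I.inv.obj s ◁ (I.inv.obj (I.inv.obj g) ◁ (I.invol h).inv ≫
        (I.invComp (I.inv.obj h) (I.inv.obj g)).inv ≫ I.inv.map (I.invComp g h).inv) := by
    rw [← h3, whiskerLeft_comp]
  rw [reassoc_of% h4]
  simp

end Involution

end

/-! ### Mates of morphisms between presingletons with symmetric adjoints. -/

section

section Mate

variable {I : Involution B} {x y z : B} {σ : Presingleton M x} {τ : Presingleton M y}
  {υ : Presingleton M z}

/-- The components `g° τ(a)° ⟶ σ(a)°` of the involute of a morphism `τ g ⟶ σ`. -/
def involuteApp (I : Involution B) {g : x ⟶ y} (p : τ.restrict g ⟶ σ) (a : M.carrier) :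
    I.inv.obj (τ.obj a) ≫ I.inv.obj g ⟶ I.inv.obj (σ.obj a) :=
  (I.invComp g (τ.obj a)).inv ≫ I.inv.map (restrictApp p a)

theorem involuteApp_precompose {g g' : x ⟶ y} (β : g' ⟶ g) (p : τ.restrict g ⟶ σ)
    (a : M.carrier) : involuteApp I (precompose β p) a =
      I.inv.obj (τ.obj a) ◁ I.inv.map β ≫ involuteApp I p a := by
  have h := I.whiskerLeft_invComp_inv β (τ.obj a)
  rw [involuteApp, involuteApp, restrictApp_precompose, Functor.map_comp, reassoc_of% h]

theorem involuteApp_idHom (a : M.carrier) : involuteApp I (idHom σ) a =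
    I.inv.obj (σ.obj a) ◁ (I.invId x).hom ≫ (ρ_ (I.inv.obj (σ.obj a))).hom := by
  rw [involuteApp, restrictApp_idHom, I.map_leftUnitor, Iso.inv_hom_id_assoc]

theorem involuteApp_compHom {f : y ⟶ z} {g : x ⟶ y} (p : υ.restrict f ⟶ τ)
    (q : τ.restrict g ⟶ σ) (a : M.carrier) : involuteApp I (compHom p q) a =
      I.inv.obj (υ.obj a) ◁ (I.invComp g f).hom ≫ (α_ _ _ _).inv ≫
        involuteApp I p a ▷ I.inv.obj g ≫ involuteApp I q a := by
  have h := I.whiskerRight_invComp_inv g (restrictApp p a)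
  have h1 := I.invComp_inv_map_associator_inv g f (υ.obj a)
  have h2 : (I.invComp f (υ.obj a)).inv ▷ I.inv.obj g ≫ (I.invComp g (f ≫ υ.obj a)).inv =
      ((α_ _ _ _).hom ≫ I.inv.obj (υ.obj a) ◁ (I.invComp g f).inv ≫
        (I.invComp (g ≫ f) (υ.obj a)).inv) ≫ I.inv.map (α_ g f (υ.obj a)).hom := by
    rw [← h1, Category.assoc, Category.assoc, ← Functor.map_comp, Iso.inv_hom_id]
    simp
  simp only [involuteApp, restrictApp_compHom, Functor.map_comp, comp_whiskerRight, Category.assoc]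
  rw [reassoc_of% h, reassoc_of% h2, Iso.inv_hom_id_assoc, ← whiskerLeft_comp_assoc,
    Iso.hom_inv_id]
  simp

/-- The involute of a morphism of presingletons is a morphism of precosingletons; this supplies
linearity on the side of `τ°` when mates are constructed. -/
theorem involuteApp_act (S : SymmetricStructure I M) {g : x ⟶ y} (p : τ.restrict g ⟶ σ)
    (a b : M.carrier) :
    M.hom a b ◁ involuteApp I p a ≫ (S.iso a b).hom ▷ I.inv.obj (σ.obj a) ≫
      (I.invComp (σ.obj a) (M.hom b a)).inv ≫ I.inv.map (σ.act b a) =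
    (α_ _ _ _).inv ≫ ((S.iso a b).hom ▷ I.inv.obj (τ.obj a) ≫
      (I.invComp (τ.obj a) (M.hom b a)).inv ≫ I.inv.map (τ.act b a)) ▷ I.inv.obj g ≫
        involuteApp I p b := by
  have h := I.whiskerRight_invComp_inv g (τ.act b a)
  have h1 := I.invComp_inv_map_associator_inv g (τ.obj a) (M.hom b a)
  have h2 : g ◁ τ.act b a ≫ restrictApp p b =
      (α_ _ _ _).inv ≫ restrictApp p a ▷ M.hom b a ≫ σ.act b a := by
    rw [restrictApp_act, Iso.inv_hom_id_assoc]
  have h3 := I.whiskerLeft_invComp_inv (restrictApp p a) (M.hom b a)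
  simp only [involuteApp, comp_whiskerRight, Category.assoc]
  rw [reassoc_of% h, ← Functor.map_comp, h2, Functor.map_comp, reassoc_of% h1, Functor.map_comp,
    ← reassoc_of% h3, whisker_exchange_assoc]
  simp

/-- `IsMate d e p q` says that `q : σ g° ⟶ τ` corresponds to `p : τ g ⟶ σ` under the adjunctions
`σ ⊣ σ°` and `τ ⊣ τ°` with counits `d` and `e`. -/
def IsMate (d : ∀ a b : M.carrier, I.inv.obj (σ.obj b) ≫ σ.obj a ⟶ M.hom a b)
    (e : ∀ a b : M.carrier, I.inv.obj (τ.obj b) ≫ τ.obj a ⟶ M.hom a b) {g : x ⟶ y}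
    (p : τ.restrict g ⟶ σ) (q : σ.restrict (I.inv.obj g) ⟶ τ) : Prop :=
  ∀ a b, I.inv.obj (τ.obj a) ◁ restrictApp q b ≫ e b a =
    (α_ _ _ _).inv ≫ involuteApp I p a ▷ σ.obj b ≫ d b a

variable {d : ∀ a b : M.carrier, I.inv.obj (σ.obj b) ≫ σ.obj a ⟶ M.hom a b}
  {e : ∀ a b : M.carrier, I.inv.obj (τ.obj b) ≫ τ.obj a ⟶ M.hom a b}
  {e' : ∀ a b : M.carrier, I.inv.obj (υ.obj b) ≫ υ.obj a ⟶ M.hom a b}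

namespace IsMate

theorem precompose {g g' : x ⟶ y} {p : τ.restrict g ⟶ σ} {q : σ.restrict (I.inv.obj g) ⟶ τ}
    (h : IsMate d e p q) (β : g' ⟶ g) :
    IsMate d e (precompose β p) (precompose (I.inv.map β) q) := by
  intro a b
  rw [involuteApp_precompose, restrictApp_precompose, whiskerLeft_comp, Category.assoc, h]
  simp

theorem idHom : IsMate d d (idHom σ) (Presingleton.precompose (I.invId x).hom (idHom σ)) := by
  intro a b
  rw [involuteApp_idHom, restrictApp_precompose, restrictApp_idHom]
  simp

theorem compHom {f : y ⟶ z} {g : x ⟶ y} {p : υ.restrict f ⟶ τ}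
    {p' : τ.restrict (I.inv.obj f) ⟶ υ} {q : τ.restrict g ⟶ σ}
    {q' : σ.restrict (I.inv.obj g) ⟶ τ} (hp : IsMate e e' p p') (hq : IsMate d e q q') :
    IsMate d e' (compHom p q)
      (Presingleton.precompose (I.invComp g f).hom (Singleton.compHom q' p')) := by
  intro a b
  have h1 := hp a b
  have h2 := hq a b
  rw [involuteApp_compHom, restrictApp_precompose, restrictApp_compHom]
  simp only [whiskerLeft_comp, Category.assoc]
  rw [h1]
  have h3 : I.inv.obj (υ.obj a) ◁ I.inv.obj f ◁ restrictApp q' b ≫ (α_ _ _ _).inv ≫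
      involuteApp I p a ▷ τ.obj b ≫ e b a = (α_ _ _ _).inv ≫
        involuteApp I p a ▷ (I.inv.obj g ≫ σ.obj b) ≫ (α_ _ _ _).inv ≫
          involuteApp I q a ▷ σ.obj b ≫ d b a := by
    rw [← h2, ← whisker_exchange_assoc]
    simp
  rw [h3]
  bicategory

/-- Applying the involution to the equation that makes `q` a mate of `p` gives the equation that
makes `p` a mate of `q`, since both counits are fixed by the involution. -/
theorem symm {S : SymmetricStructure I M} (hd : IsSymmetricCounit S σ d)
    (he : IsSymmetricCounit S τ e) {g : x ⟶ y} {p : τ.restrict g ⟶ σ}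
    {q : σ.restrict (I.inv.obj g) ⟶ τ} (h : IsMate d e p q) :
    IsMate e d q (Presingleton.precompose (I.invol g).hom p) := by
  intro b a
  -- The comparison takes place in `M(b, a)°`, where symmetry replaces each counit by an involute.
  rw [← cancel_mono (S.iso a b).hom]
  have h1 := hd a b
  have h2 := he a b
  have h3 := I.whiskerRight_flip (restrictApp q b) (τ.obj a)
  have h4 := I.whiskerLeft_flip (σ.obj b) (restrictApp p a)
  have h5 := congrArg (fun k => I.inv.map k) (h a b)
  have h6 := I.flip_comp (σ.obj b) g (τ.obj a)
  simp only [restrictApp_precompose, involuteApp, Category.assoc, whiskerLeft_comp,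
    comp_whiskerRight]
  rw [← h1, ← h2]
  rw [Functor.map_comp] at h5
  rw [reassoc_of% h4, reassoc_of% h3, h5, ← reassoc_of% h6]
  simp [involuteApp]

variable {S : SymmetricStructure I M} [ClosedBicategory B]

theorem unique (adj : IsAdjunction τ (τ.involute S) e) {g : x ⟶ y} {p : τ.restrict g ⟶ σ}
    {q q' : σ.restrict (I.inv.obj g) ⟶ τ} (h : IsMate d e p q) (h' : IsMate d e p q') : q = q' :=
  restrictHom_ext fun b => adj.hom_ext fun a => (h a b).trans (h' a b).symm

/-- The involute of `p` paired with the counit of `σ` is a morphism of distributors from `σ g° τ°`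
to `M`, which the adjunction `τ ⊣ τ°` transposes. -/
theorem exists_isMate (adj : IsAdjunction σ (σ.involute S) d)
    (adj' : IsAdjunction τ (τ.involute S) e) {g : x ⟶ y} (p : τ.restrict g ⟶ σ) :
    ∃ q, IsMate d e p q := by
  let n (a b : M.carrier) : I.inv.obj (τ.obj a) ≫ I.inv.obj g ≫ σ.obj b ⟶ M.hom b a :=
    (α_ _ _ _).inv ≫ involuteApp I p a ▷ σ.obj b ≫ d b a
  have hl (a b' b : M.carrier) : n a b ▷ M.hom b' b ≫ M.comp b' b a =
      (α_ _ _ _).hom ≫ I.inv.obj (τ.obj a) ◁ ((α_ _ _ _).hom ≫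
        I.inv.obj g ◁ σ.act b' b) ≫ n a b' := by
    have h : d b a ▷ M.hom b' b ≫ M.comp b' b a =
        (α_ _ _ _).hom ≫ I.inv.obj (σ.obj a) ◁ σ.act b' b ≫ d b' a := adj.counit_left b' b a
    simp only [n, comp_whiskerRight, Category.assoc]
    rw [h]
    calc
      _ = 𝟙 _ ⊗≫ (involuteApp I p a ▷ (σ.obj b ≫ M.hom b' b) ≫
          I.inv.obj (σ.obj a) ◁ σ.act b' b) ≫ d b' a := by bicategory
      _ = _ := by rw [← whisker_exchange]; bicategory
  have hr (a a' b : M.carrier) : M.hom a a' ◁ n a b ≫ M.comp b a a' =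
      (α_ _ _ _).inv ≫ ((S.iso a a').hom ▷ I.inv.obj (τ.obj a) ≫
        (I.invComp (τ.obj a) (M.hom a' a)).inv ≫ I.inv.map (τ.act a' a)) ▷
          (I.inv.obj g ≫ σ.obj b) ≫ n a' b := by
    have h : M.hom a a' ◁ d b a ≫ M.comp b a a' = (α_ _ _ _).inv ≫
        ((S.iso a a').hom ▷ I.inv.obj (σ.obj a) ≫
          (I.invComp (σ.obj a) (M.hom a' a)).inv ≫ I.inv.map (σ.act a' a)) ▷ σ.obj b ≫ d b a' :=
      adj.counit_right b a a'
    have h1 := involuteApp_act S p a a'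
    simp only [n, whiskerLeft_comp, Category.assoc]
    rw [h]
    calc
      _ = 𝟙 _ ⊗≫ (M.hom a a' ◁ involuteApp I p a ≫ (S.iso a a').hom ▷ I.inv.obj (σ.obj a) ≫
          (I.invComp (σ.obj a) (M.hom a' a)).inv ≫ I.inv.map (σ.act a' a)) ▷ σ.obj b ≫
            d b a' := by bicategory
      _ = _ := by rw [h1]; bicategory
  obtain ⟨q, hq, h⟩ := adj'.exists_hom (σ.restrict (I.inv.obj g)) n hl hr
  exact ⟨restrictMk q fun a b => (hq a b).trans (Category.assoc _ _ _), h⟩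

end IsMate

end Mate

end

/-! ### The canonical symmetric structure on the symmetric singletons. -/

section

variable {I : Involution B} {S : SymmetricStructure I M} [ClosedBicategory B]

namespace SymSingleton

section Mate

variable {σ τ υ : SymSingleton S}

/-- The morphism `σ g° ⟶ τ` which corresponds to `τ g ⟶ σ`. -/
noncomputable def mate {g : σ.type ⟶ τ.type} (p : τ.val.restrict g ⟶ σ.val) :
    σ.val.restrict (I.inv.obj g) ⟶ τ.val :=
  (IsMate.exists_isMate σ.adjunction τ.adjunction p).choose

theorem isMate_mate {g : σ.type ⟶ τ.type} (p : τ.val.restrict g ⟶ σ.val) :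
    IsMate σ.counit τ.counit p (mate p) :=
  (IsMate.exists_isMate σ.adjunction τ.adjunction p).choose_spec

theorem eq_mate {g : σ.type ⟶ τ.type} {p : τ.val.restrict g ⟶ σ.val}
    {q : σ.val.restrict (I.inv.obj g) ⟶ τ.val} (h : IsMate σ.counit τ.counit p q) : q = mate p :=
  h.unique τ.adjunction (isMate_mate p)

theorem precompose_mate {g g' : σ.type ⟶ τ.type} (β : g' ⟶ g) (p : τ.val.restrict g ⟶ σ.val) :
    precompose (I.inv.map β) (mate p) = mate (precompose β p) :=
  eq_mate ((isMate_mate p).precompose β)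

theorem mate_idHom : mate (idHom σ.val) = precompose (I.invId σ.type).hom (idHom σ.val) :=
  (eq_mate IsMate.idHom).symm

theorem mate_compHom {f : τ.type ⟶ υ.type} {g : σ.type ⟶ τ.type}
    (p : υ.val.restrict f ⟶ τ.val) (q : τ.val.restrict g ⟶ σ.val) :
    mate (compHom p q) = precompose (I.invComp g f).hom (compHom (mate q) (mate p)) :=
  (eq_mate ((isMate_mate p).compHom (isMate_mate q))).symm

theorem mate_mate {g : σ.type ⟶ τ.type} (p : τ.val.restrict g ⟶ σ.val) :
    mate (mate p) = precompose (I.invol g).hom p :=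
  (eq_mate ((isMate_mate p).symm σ.symmetric τ.symmetric)).symm

end Mate

variable [∀ x y : B, HasColimitsOfSize.{s, s} (x ⟶ y)] (σ τ υ : SymSingleton S)

/-- The `1`-cell `S(σ, τ)` between symmetric singletons. -/
noncomputable def hom : τ.type ⟶ σ.type :=
  σ.toSingleton.hom τ.toSingleton

/-- The evaluation `σ S(σ, τ) ⟶ τ`. -/
noncomputable def ev : σ.val.restrict (σ.hom τ) ⟶ τ.val :=
  σ.toSingleton.ev τ.toSingleton

/-- The canonical inclusion `f ⟶ S(σ, τ)` associated with `p : σ f ⟶ τ`. -/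
noncomputable def incl {f : τ.type ⟶ σ.type} (p : σ.val.restrict f ⟶ τ.val) : f ⟶ σ.hom τ :=
  σ.toSingleton.incl τ.toSingleton p

/-- The composition `S(σ, τ) S(τ, υ) ⟶ S(σ, υ)`. -/
noncomputable def comp : τ.hom υ ≫ σ.hom τ ⟶ σ.hom υ :=
  Singleton.comp σ.toSingleton τ.toSingleton υ.toSingleton

theorem precompose_incl_ev {f : τ.type ⟶ σ.type} (p : σ.val.restrict f ⟶ τ.val) :
    precompose (σ.incl τ p) (σ.ev τ) = p :=
  Singleton.precompose_incl_ev σ.toSingleton τ.toSingleton p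

theorem incl_precompose_ev {f : τ.type ⟶ σ.type} (k : f ⟶ σ.hom τ) :
    σ.incl τ (precompose k (σ.ev τ)) = k :=
  Singleton.incl_precompose_ev σ.toSingleton τ.toSingleton k

theorem comp_incl {f g : τ.type ⟶ σ.type} (β : g ⟶ f) (p : σ.val.restrict f ⟶ τ.val) :
    β ≫ σ.incl τ p = σ.incl τ (precompose β p) :=
  Singleton.comp_incl σ.toSingleton τ.toSingleton β p

theorem precompose_comp_ev : precompose (σ.comp τ υ) (σ.ev υ) = compHom (σ.ev τ) (τ.ev υ) :=
  Singleton.precompose_comp_ev σ.toSingleton τ.toSingleton υ.toSingleton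

theorem incl_comp {f : τ.type ⟶ σ.type} {g : υ.type ⟶ τ.type} (p : σ.val.restrict f ⟶ τ.val)
    (q : τ.val.restrict g ⟶ υ.val) :
    g ◁ σ.incl τ p ≫ τ.incl υ q ▷ σ.hom τ ≫ σ.comp τ υ = σ.incl υ (compHom p q) :=
  Singleton.incl_comp σ.toSingleton τ.toSingleton υ.toSingleton p q

/-- The `2`-cell `S(τ, σ)° ⟶ S(σ, τ)` which corresponds to the evaluation. -/
noncomputable def involuteHom : I.inv.obj (τ.hom σ) ⟶ σ.hom τ :=
  σ.incl τ (mate (τ.ev σ))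

/-- Both `2`-cells into `S(σ, τ)` classify the same morphism: precomposing the mate of an evaluation
gives the double mate of the other evaluation, which is the latter up to the double involution. -/
theorem map_involuteHom_comp :
    I.inv.map (τ.involuteHom σ) ≫ σ.involuteHom τ = (I.invol (σ.hom τ)).hom := by
  rw [involuteHom, involuteHom, comp_incl, precompose_mate, precompose_incl_ev, mate_mate,
    incl_precompose_ev]

/-- The other composite, obtained by applying the involution to the previous identity with `σ` and
`τ` exchanged. -/
theorem involuteHom_comp_map :
    (σ.involuteHom τ ≫ (I.invol (σ.hom τ)).inv) ≫ I.inv.map (τ.involuteHom σ) = 𝟙 _ := by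
  have h := congrArg (fun k => I.inv.map k) (map_involuteHom_comp τ σ)
  rw [Functor.map_comp, I.map_invol] at h
  have h1 : σ.involuteHom τ ≫ (I.invol (σ.hom τ)).inv =
      (I.invol (I.inv.obj (τ.hom σ))).inv ≫ I.inv.map (I.inv.map (σ.involuteHom τ)) := by
    rw [Iso.comp_inv_eq, Category.assoc, I.invol_natural, Iso.inv_hom_id_assoc]
  rw [h1, Category.assoc, h, Iso.inv_hom_id]

/-- The isomorphism `S(σ, τ) ≅ S(τ, σ)°`. -/
noncomputable def symIso : σ.hom τ ≅ I.inv.obj (τ.hom σ) where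
  hom := (I.invol (σ.hom τ)).inv ≫ I.inv.map (τ.involuteHom σ)
  inv := σ.involuteHom τ
  hom_inv_id := by rw [Category.assoc, map_involuteHom_comp, Iso.inv_hom_id]
  inv_hom_id := by rw [← Category.assoc, involuteHom_comp_map]

theorem symIso_symIso : (σ.symIso τ).hom ≫ I.inv.map (τ.symIso σ).hom ≫
    (I.invol (σ.hom τ)).hom = 𝟙 (σ.hom τ) := by
  rw [← Iso.eq_inv_comp]
  change _ = σ.involuteHom τ ≫ 𝟙 _
  simp only [symIso, Functor.map_comp, Category.assoc, Category.comp_id]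
  rw [I.invol_natural, ← I.map_invol, ← Functor.map_comp_assoc, Iso.inv_hom_id,
    CategoryTheory.Functor.map_id, Category.id_comp]

theorem refl_symIso : σ.incl σ (idHom σ.val) ≫ (σ.symIso σ).hom =
    (I.invId σ.type).inv ≫ I.inv.map (σ.incl σ (idHom σ.val)) := by
  rw [← Iso.eq_comp_inv]
  change _ = _ ≫ σ.involuteHom σ
  rw [Category.assoc, involuteHom, comp_incl, precompose_mate, precompose_incl_ev, mate_idHom,
    ← comp_incl, Iso.inv_hom_id_assoc]

/-- Taking mates reverses composition, and composition in `S` classifies composites of evaluations.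
The identity is proved for the inverse isomorphisms, which are inclusions of mates. -/
theorem comp_symIso : σ.comp τ υ ≫ (σ.symIso υ).hom =
    τ.hom υ ◁ (σ.symIso τ).hom ≫ (τ.symIso υ).hom ▷ I.inv.obj (τ.hom σ) ≫
      (I.invComp (τ.hom σ) (υ.hom τ)).inv ≫ I.inv.map (υ.comp τ σ) := by
  have h : I.inv.map (υ.comp τ σ) ≫ (σ.symIso υ).inv =
      (I.invComp (τ.hom σ) (υ.hom τ)).hom ≫ I.inv.obj (υ.hom τ) ◁ (σ.symIso τ).inv ≫
        (τ.symIso υ).inv ▷ σ.hom τ ≫ σ.comp τ υ := by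
    change _ ≫ σ.involuteHom υ = _ ≫ _ ◁ σ.involuteHom τ ≫ τ.involuteHom υ ▷ _ ≫ _
    rw [involuteHom, comp_incl, precompose_mate, precompose_comp_ev, mate_compHom, ← comp_incl,
      involuteHom, involuteHom, incl_comp]
  rw [← Iso.eq_comp_inv]
  simp only [Category.assoc]
  rw [h, Iso.inv_hom_id_assoc, ← whisker_exchange_assoc]
  simp

end SymSingleton

variable [∀ x y : B, HasColimitsOfSize.{s, s} (x ⟶ y)]

variable (S) in
/-- The canonical symmetric structure on the `B`-category of symmetric singletons. -/
noncomputable def symSingletonsSymmetric : SymmetricStructure I (symSingletons S) where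
  iso σ τ := SymSingleton.symIso σ τ
  iso_iso σ τ := SymSingleton.symIso_symIso σ τ
  refl_iso σ := SymSingleton.refl_symIso σ
  comp_iso σ τ υ := SymSingleton.comp_symIso σ τ υ

/-- The evaluation of `S(σ, τ)` is the symmetry isomorphism followed by the mate of the opposite
evaluation; canonicity is then the equation defining this mate. -/
theorem isCanonical_symSingletonsSymmetric : IsCanonical (symSingletonsSymmetric S) := by
  intro σ τ a b
  have h : I.inv.obj (τ.val.obj b) ◁ restrictApp (SymSingleton.mate (τ.ev σ)) a ≫ τ.counit a b =
      (α_ _ _ _).inv ≫ involuteApp I (τ.ev σ) b ▷ σ.val.obj a ≫ σ.counit a b :=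
    SymSingleton.isMate_mate (τ.ev σ) b a
  have h1 : restrictApp (σ.ev τ) a =
      (σ.symIso τ).hom ▷ σ.val.obj a ≫ restrictApp (SymSingleton.mate (τ.ev σ)) a := by
    have h2 : (σ.symIso τ).inv ▷ σ.val.obj a ≫ restrictApp (σ.ev τ) a =
        restrictApp (SymSingleton.mate (τ.ev σ)) a :=
      congrArg (restrictApp · a) (σ.precompose_incl_ev τ (SymSingleton.mate (τ.ev σ)))
    rw [← h2, hom_inv_whiskerRight_assoc]
  change I.inv.obj (τ.val.obj b) ◁ restrictApp (σ.ev τ) a ≫ τ.counit a b =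
    (α_ (I.inv.obj (τ.val.obj b)) (σ.hom τ) (σ.val.obj a)).inv ≫
      (I.inv.obj (τ.val.obj b) ◁ (σ.symIso τ).hom) ▷ σ.val.obj a ≫
      (I.invComp (τ.hom σ) (τ.val.obj b)).inv ▷ σ.val.obj a ≫
      I.inv.map (restrictApp (τ.ev σ) b) ▷ σ.val.obj a ≫ σ.counit a b
  rw [h1, whiskerLeft_comp, Category.assoc, h]
  simp [involuteApp]

end

end EnrichedBicat

theorem mainTheorem6 {B : Type u} [Bicategory.{w, v} B] [EnrichedBicat.ClosedBicategory B]
    [∀ x y : B, HasColimitsOfSize.{s, s} (x ⟶ y)] (M : EnrichedBicat.EnrichedCat.{s} B) :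
    M.singletons.IsComplete ∧
      ∀ (I : EnrichedBicat.Involution B) (S : EnrichedBicat.SymmetricStructure I M),
        (∃ K : EnrichedBicat.SymmetricStructure I (EnrichedBicat.symSingletons S),
          EnrichedBicat.IsCanonical K) ∧
        ∀ K : EnrichedBicat.SymmetricStructure I (EnrichedBicat.symSingletons S),
          EnrichedBicat.IsCanonical K → K.IsSymmetricallyComplete :=
  ⟨M.isComplete_singletons, fun _ _ => ⟨⟨_, EnrichedBicat.isCanonical_symSingletonsSymmetric⟩,
    fun _ hK => hK.isSymmetricallyComplete⟩⟩
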